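/- Let $k$ be a field of characteristic zero and let $V,W$ be nonzero finite dimensional $k$-linear spaces. Write $\mathcal L(X)$ for the algebra of linear endomorphisms of $X$, and $t:\mathcal L(X)\to\mathcal L(X^*)$ for the transposition. Let $u\in\mathcal L(V)\otimes\mathcal L(W)$ be an invertible element satisfying $$(t\otimes id)u^{-1}=((t\otimes id)u)^{-1}.\qquad(\star)$$ *Models.* A corepresentation of a Hopf $k$-algebra $H$ is an element $v\in\mathcal L(X)\otimes H$, with $X$ a finite dimensional linear space, such that $(id\otimes\Delta)v=v_{12}v_{13}$ and $(id\otimes\varepsilon)v=1$; its contragredient is $\hat v=(t\otimes S)v\in\mathcal L(X^*)\otimes H$. A model for an element $w\in\mathcal L(X)\otimes\mathcal L(Y)$ is a triple $(H,v,\pi)$ consisting of a Hopf $k$-algebra $H$, a corepresentation $v\in\mathcal L(X)\otimes H$ and a morphism of algebras $\pi:H\to\mathcal L(Y)$ such that $(id\otimes\pi)v=w$. It is left-faithful if $H$ is generated as an algebra by $\bigcup_{n\ge 0}S^n(\mathcal C_v)$, where $\mathcal C_v=\{(f\otimes id)v\mid f\in\mathcal L(X)^*\}$. A morphism $(H_1,v_1,\pi_1)\to(H_2,v_2,\pi_2)$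 of left-faithful models is a Hopf algebra morphism $f:H_1\to H_2$ such that $(id\otimes f)v_1=v_2$ and $\pi_1=\pi_2f$. The minimal model for $w$ is the terminal object of the category of left-faithful models for $w$. *The lattice $L(v)$.* For $x\in\mathcal L(X)\otimes H$ and $y\in\mathcal L(Y)\otimes H$ let $x\otimes y=x_{13}y_{23}\in\mathcal L(X\otimes Y)\otimes H$ and $End(x)=\{T\in\mathcal L(X)\mid (T\otimes 1)x=x(T\otimes 1)\}$. For a corepresentation $v$ and $0\le j\le i$, the algebra of $L(v)$ on the position $(i,-j)$ is $End(r_{j,i})$, where $r_{j,i}$ is the alternating tensor product of $v$ and $\hat v$ with $i-j$ terms which begins with $v$ if $j$ is even and with $\hat v$ if $j$ is odd (for $i=j$ it is the unit $1\in\mathcal L(k)\otimes H$, so that $End(r_{i,i})=k$). The inclusions are $T\mapsto T\otimes id$ from $(i,-j)$ to $(i+1,-j)$ and $T\mapsto id\otimes T$ from $(i,-j-1)$ to $(i,-j)$. *The lattice $L(\Box_u)$.* Let $\Box_u$ be the square of algebras $$A_{01}=k\otimes\mathcal L(W)\subset A_{11}=\mathcal L(V)\otimes\mathcal L(W),\qquad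 A_{00}=k\subset A_{10}=u(\mathcal L(V)\otimes k)u^{-1},$$ with the normalized trace of $A_{11}$. Perform successive basic constructions: for $i\ge1$, $e_i$ is the conditional expectation $A_{i1}\to A_{i-1,1}$ with respect to the trace of $A_{i1}$, viewed as a linear endomorphism of $A_{i1}$; $A_{i+1,1}=\langle A_{i1},e_i\rangle$ is the algebra of linear endomorphisms of $A_{i1}$ generated by $A_{i1}$ (acting by left multiplication) and by $e_i$, with the Markov extension of the trace of $A_{i1}$, i.e. the trace on $A_{i+1,1}$ which extends that of $A_{i1}$ and for which there is a nonzero scalar $\beta$ such that $\beta\,tr(be_i)=tr(b)$ for all $b\in A_{i1}$; and $A_{i+1,0}$ is the subalgebra of $A_{i+1,1}$ generated by $A_{i0}$ and $e_i$. The lattice $L(\Box_u)$ of higher relative commutants of the vertical inclusion associated to $\Box_u$ has the algebra $A_{j1}'\cap A_{i0}$ (commutant taken in $A_{i1}$) on the position $(i,-j)$, for $0\le j\le i$, and its inclusions are those induced by $A_{i1}\subset A_{i+1,1}$ (from $(i,-j)$ to $(i+1,-j)$) and by $A_{j1}\subset A_{j+1,1}$ (from $(i,-j-1)$ to $(i,-j)$).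 **Theorem.** Let $(H,v,\pi)$ be the minimal model for the element $$u'=u_{12}((id\otimes t)u^{-1})_{13}\in\mathcal L(V)\otimes\mathcal L(W)\otimes\mathcal L(W^*)=\mathcal L(V)\otimes\mathcal L(W\otimes W^*).$$ Then the lattices $L(\Box_u)$ and $L(v)$ are equal, in the sense that there is a family of isomorphisms of $k$-algebras $$\Phi_{ij}:A_{j1}'\cap A_{i0}\to End(r_{j,i})\qquad(0\le j\le i)$$ which commute with all the horizontal and vertical inclusions of the two lattices. -/

import Mathlib

open scoped TensorProduct

universe u

noncomputable section

namespace VertexModel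

/-! ### Transposition, leg notation, and the equation `(⋆)` -/

section Star

variable {k V W : Type u} [Field k] [AddCommGroup V] [Module k V] [AddCommGroup W] [Module k W]

/-- `t ⊗ id : L(V) ⊗ A → L(V*) ⊗ A`. -/
def transposeLeft (A : Type u) [Ring A] [Algebra k A] :
    Module.End k V ⊗[k] A →ₗ[k] Module.End k (Module.Dual k V) ⊗[k] A :=
  LinearMap.rTensor A (Module.Dual.transpose (R := k) (M := V) (M' := V))

/-- `id ⊗ t : A ⊗ L(W) → A ⊗ L(W*)`. -/
def transposeRight (A : Type u) [Ring A] [Algebra k A] :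
    A ⊗[k] Module.End k W →ₗ[k] A ⊗[k] Module.End k (Module.Dual k W) :=
  LinearMap.lTensor A (Module.Dual.transpose (R := k) (M := W) (M' := W))

/-- The equation `(t ⊗ id)(u⁻¹) = ((t ⊗ id)u)⁻¹` for an invertible `u ∈ L(V) ⊗ L(W)`: the element
`(t ⊗ id)(u⁻¹)` is a two-sided inverse of `(t ⊗ id)u`. -/
def SatisfiesStar (u : (Module.End k V ⊗[k] Module.End k W)ˣ) : Prop :=
  transposeLeft (Module.End k W) (u : Module.End k V ⊗[k] Module.End k W) *
      transposeLeft (Module.End k W) (↑u⁻¹ : Module.End k V ⊗[k] Module.End k W) = 1 ∧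
    transposeLeft (Module.End k W) (↑u⁻¹ : Module.End k V ⊗[k] Module.End k W) *
      transposeLeft (Module.End k W) (u : Module.End k V ⊗[k] Module.End k W) = 1

/-- `u' = u₁₂ ((id ⊗ t)u⁻¹)₁₃ ∈ L(V) ⊗ L(W ⊗ W*)`. -/
def uPrime (u : (Module.End k V ⊗[k] Module.End k W)ˣ) :
    Module.End k V ⊗[k] Module.End k (W ⊗[k] Module.Dual k W) :=
  Algebra.TensorProduct.map (AlgHom.id k (Module.End k V))
      (Module.End.rTensorAlgHom k W (Module.Dual k W))
      (u : Module.End k V ⊗[k] Module.End k W) *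
    Algebra.TensorProduct.map (AlgHom.id k (Module.End k V))
      (Module.End.lTensorAlgHom k (Module.Dual k W) W)
      (transposeRight (Module.End k V) (↑u⁻¹ : Module.End k V ⊗[k] Module.End k W))

end Star

/-! ### Corepresentations and models -/

section Models

variable {k V W H : Type u} [Field k] [AddCommGroup V] [Module k V] [AddCommGroup W] [Module k W]
  [Ring H] [HopfAlgebra k H]

/-- `v ∈ L(V) ⊗ H` is a corepresentation: `(id ⊗ Δ)v = v₁₂ v₁₃` and `(id ⊗ ε)v = 1`. -/
def IsCorep (v : Module.End k V ⊗[k] H) : Prop :=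
  LinearMap.lTensor (Module.End k V) (Coalgebra.comul (R := k) (A := H)) v =
      Algebra.TensorProduct.map (AlgHom.id k (Module.End k V))
        (Algebra.TensorProduct.includeLeft : H →ₐ[k] H ⊗[k] H) v *
      Algebra.TensorProduct.map (AlgHom.id k (Module.End k V))
        (Algebra.TensorProduct.includeRight : H →ₐ[k] H ⊗[k] H) v ∧
    TensorProduct.rid k (Module.End k V)
      (LinearMap.lTensor (Module.End k V) (Coalgebra.counit (R := k) (A := H)) v) = 1

/-- The set of coefficients `C_v = {(f ⊗ id)v | f ∈ L(V)*}`. -/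
def coeffs (v : Module.End k V ⊗[k] H) : Set H :=
  Set.range fun f : Module.Dual k (Module.End k V) => TensorProduct.lid k H (LinearMap.rTensor H f v)

/-- The contragredient `v̂ = (t ⊗ S)v ∈ L(V*) ⊗ H`. -/
def contragredient (v : Module.End k V ⊗[k] H) : Module.End k (Module.Dual k V) ⊗[k] H :=
  TensorProduct.map (Module.Dual.transpose (R := k) (M := V) (M' := V)) (HopfAlgebra.antipode k) v

/-- `(H, v, π)` is a model for `u`: `v` is a corepresentation of `H`, `π` is a representation of `H`
and `(id ⊗ π)v = u`. -/
def IsModel (u : Module.End k V ⊗[k] Module.End k W) (v : Module.End k V ⊗[k] H)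
    (π : H →ₐ[k] Module.End k W) : Prop :=
  IsCorep v ∧ Algebra.TensorProduct.map (AlgHom.id k (Module.End k V)) π v = u

/-- The subalgebra generated by `⋃ₙ Sⁿ(C_v)` is the whole of `H`. -/
def IsLeftFaithful (v : Module.End k V ⊗[k] H) : Prop :=
  Algebra.adjoin k (⋃ n : ℕ, (HopfAlgebra.antipode k (A := H))^[n] '' coeffs v) = ⊤

/-- `(H, v, π)` is the minimal model for `u`: the universally attracting (terminal) object of the
category of left-faithful models for `u`, with Hopf algebra morphisms `f` such that
`(id ⊗ f)w = v` and `ρ = π ∘ f` as morphisms `(K, w, ρ) → (H, v, π)`. -/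
def IsMinimalModel (u : Module.End k V ⊗[k] Module.End k W) (v : Module.End k V ⊗[k] H)
    (π : H →ₐ[k] Module.End k W) : Prop :=
  (IsModel u v π ∧ IsLeftFaithful v) ∧
    ∀ (K : Type u) [Ring K] [HopfAlgebra k K] (w : Module.End k V ⊗[k] K)
      (ρ : K →ₐ[k] Module.End k W), IsModel u w ρ → IsLeftFaithful w →
        ∃! f : K →ₐc[k] H,
          Algebra.TensorProduct.map (AlgHom.id k (Module.End k V)) (f : K →ₐ[k] H) w = v ∧
            ρ = π.comp (f : K →ₐ[k] H)

end Models

/-! ### The tensor category of elements of `L(X) ⊗ A` and the lattice `L(v)` -/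

/-- An element of `L(X) ⊗ A`, with `X` a linear space. -/
structure Obj (k A : Type u) [Field k] [Ring A] [Algebra k A] where
  /-- The underlying space. -/
  X : Type u
  [addCommGroup : AddCommGroup X]
  [module : Module k X]
  /-- The element. -/
  el : Module.End k X ⊗[k] A

attribute [instance] Obj.addCommGroup Obj.module

namespace Obj

variable {k A : Type u} [Field k] [Ring A] [Algebra k A]

/-- The tensor unit `1 ∈ L(k) ⊗ A`. -/
def unit (k A : Type u) [Field k] [Ring A] [Algebra k A] : Obj k A where
  X := k
  el := 1

/-- The tensor product `x ⊗ y = x₁₃ y₂₃ ∈ L(X ⊗ Y) ⊗ A`. -/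
def tensor (x y : Obj k A) : Obj k A where
  X := x.X ⊗[k] y.X
  el := Algebra.TensorProduct.map (Module.End.rTensorAlgHom k x.X y.X) (AlgHom.id k A) x.el *
    Algebra.TensorProduct.map (Module.End.lTensorAlgHom k y.X x.X) (AlgHom.id k A) y.el

/-- `End(x) = {T ∈ L(X) | (T ⊗ 1)x = x(T ⊗ 1)}`. -/
def endAlg (x : Obj k A) : Subalgebra k (Module.End k x.X) :=
  (Subalgebra.centralizer k {x.el}).comap
    (Algebra.TensorProduct.includeLeft : Module.End k x.X →ₐ[k] Module.End k x.X ⊗[k] A)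

/-- The alternating sequence `x, y, x, y, …`. -/
def alt : Obj k A → Obj k A → ℕ → Obj k A
  | x, _, 0 => x
  | x, y, n + 1 => alt y x n

/-- The alternating tensor product with `m` terms that starts with the `j`-th term of
`x, y, x, y, …`. -/
def word (x y : Obj k A) : ℕ → ℕ → Obj k A
  | _, 0 => unit k A
  | j, m + 1 => tensor (alt x y j) (word x y (j + 1) m)

/-- The index `j + m` of the term following those of `word x y j m`, written so that it unfolds
along with `word`. -/
def nextIndex : ℕ → ℕ → ℕ
  | j, 0 => j
  | j, m + 1 => nextIndex (j + 1) m

/-- The canonical identification (associativity and unit constraints only) of the word with `m + 1`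
terms with the tensor product of the word with `m` terms by its last term. -/
def wordSnoc (x y : Obj k A) : (j m : ℕ) →
    ((word x y j m).X ⊗[k] (alt x y (nextIndex j m)).X) ≃ₗ[k] (word x y j (m + 1)).X
  | j, 0 => (TensorProduct.lid k (alt x y j).X).trans (TensorProduct.rid k (alt x y j).X).symm
  | j, m + 1 =>
    (TensorProduct.assoc k (alt x y j).X (word x y (j + 1) m).X
      (alt x y (nextIndex (j + 1) m)).X).trans
      (TensorProduct.congr (LinearEquiv.refl k (alt x y j).X) (wordSnoc x y (j + 1) m))

/-- `T ↦ T ⊗ id`, a tensor factor being added on the right. -/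
def addRight (x y : Obj k A) (j m : ℕ) :
    Module.End k (word x y j m).X →ₐ[k] Module.End k (word x y j (m + 1)).X :=
  ((wordSnoc x y j m).conjAlgEquiv k : _ →ₐ[k] _).comp
    (Module.End.rTensorAlgHom k (word x y j m).X (alt x y (nextIndex j m)).X)

/-- `T ↦ id ⊗ T`, a tensor factor being added on the left. -/
def addLeft (x y : Obj k A) (j m : ℕ) :
    Module.End k (word x y (j + 1) m).X →ₐ[k] Module.End k (word x y j (m + 1)).X :=
  Module.End.lTensorAlgHom k (word x y (j + 1) m).X (alt x y j).X

theorem mem_endAlg {x : Obj k A} {T : Module.End k x.X} :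
    T ∈ x.endAlg ↔ (T ⊗ₜ[k] (1 : A)) * x.el = x.el * (T ⊗ₜ[k] (1 : A)) := by
  simp only [endAlg, Subalgebra.mem_comap, Subalgebra.mem_centralizer_iff, Set.mem_singleton_iff,
    forall_eq, Algebra.TensorProduct.includeLeft_apply]
  exact eq_comm

theorem commute_legs_left (X Y : Type u) [AddCommGroup X] [Module k X] [AddCommGroup Y] [Module k Y]
    (S : Module.End k X) (y : Module.End k Y ⊗[k] A) :
    Commute (Module.End.rTensorAlgHom k X Y S ⊗ₜ[k] (1 : A))
      (Algebra.TensorProduct.map (Module.End.lTensorAlgHom k Y X) (AlgHom.id k A) y) := by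
  induction y with
  | zero => simp
  | add a b ha hb => rw [map_add]; exact ha.add_right hb
  | tmul T a =>
    simp only [Algebra.TensorProduct.map_tmul, AlgHom.id_apply, Commute, SemiconjBy,
      Algebra.TensorProduct.tmul_mul_tmul, one_mul, mul_one]
    congr 1
    ext; rfl

theorem commute_legs_right (X Y : Type u) [AddCommGroup X] [Module k X] [AddCommGroup Y] [Module k Y]
    (T : Module.End k Y) (x : Module.End k X ⊗[k] A) :
    Commute (Module.End.lTensorAlgHom k Y X T ⊗ₜ[k] (1 : A))
      (Algebra.TensorProduct.map (Module.End.rTensorAlgHom k X Y) (AlgHom.id k A) x) := by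
  induction x with
  | zero => simp
  | add a b ha hb => rw [map_add]; exact ha.add_right hb
  | tmul S a =>
    simp only [Algebra.TensorProduct.map_tmul, AlgHom.id_apply, Commute, SemiconjBy,
      Algebra.TensorProduct.tmul_mul_tmul, one_mul, mul_one]
    congr 1
    ext; rfl

theorem lTensor_mem (x y : Obj k A) {T : Module.End k y.X} (hT : T ∈ y.endAlg) :
    Module.End.lTensorAlgHom k y.X x.X T ∈ (tensor x y).endAlg := by
  rw [mem_endAlg] at hT
  refine mem_endAlg.2 ?_
  have h2 : Commute (Module.End.lTensorAlgHom k y.X x.X T ⊗ₜ[k] (1 : A))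
      (Algebra.TensorProduct.map (Module.End.lTensorAlgHom k y.X x.X) (AlgHom.id k A) y.el) := by
    have := congrArg
      (Algebra.TensorProduct.map (Module.End.lTensorAlgHom k y.X x.X) (AlgHom.id k A)) hT
    simp only [map_mul, Algebra.TensorProduct.map_tmul, map_one] at this
    exact this
  exact (commute_legs_right x.X y.X T x.el).mul_right h2

theorem rTensor_mem (x y : Obj k A) {T : Module.End k x.X} (hT : T ∈ x.endAlg) :
    Module.End.rTensorAlgHom k x.X y.X T ∈ (tensor x y).endAlg := by
  rw [mem_endAlg] at hT
  refine mem_endAlg.2 ?_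
  have h2 : Commute (Module.End.rTensorAlgHom k x.X y.X T ⊗ₜ[k] (1 : A))
      (Algebra.TensorProduct.map (Module.End.rTensorAlgHom k x.X y.X) (AlgHom.id k A) x.el) := by
    have := congrArg
      (Algebra.TensorProduct.map (Module.End.rTensorAlgHom k x.X y.X) (AlgHom.id k A)) hT
    simp only [map_mul, Algebra.TensorProduct.map_tmul, map_one] at this
    exact this
  exact h2.mul_right (commute_legs_left x.X y.X T y.el)

/-- Transport of elements of `L(X) ⊗ A` along a linear isomorphism `X ≃ Y`. -/
abbrev cj {X Y : Type u} [AddCommGroup X] [Module k X] [AddCommGroup Y] [Module k Y]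
    (e : X ≃ₗ[k] Y) : Module.End k X ⊗[k] A →ₐ[k] Module.End k Y ⊗[k] A :=
  Algebra.TensorProduct.map (e.conjAlgEquiv k : Module.End k X →ₐ[k] Module.End k Y) (AlgHom.id k A)

theorem conj_mem (x y : Obj k A) (e : x.X ≃ₗ[k] y.X) (he : cj e x.el = y.el)
    {T : Module.End k x.X} (hT : T ∈ x.endAlg) : e.conjAlgEquiv k T ∈ y.endAlg := by
  rw [mem_endAlg] at hT ⊢
  have := congrArg (cj e) hT
  simp only [map_mul, he, Algebra.TensorProduct.map_tmul, map_one] at this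
  exact this

theorem map_eq_map_of {X Y : Type u} [AddCommGroup X] [Module k X] [AddCommGroup Y] [Module k Y]
    (f g : Module.End k X →ₐ[k] Module.End k Y) (h : ∀ T, f T = g T) (z : Module.End k X ⊗[k] A) :
    Algebra.TensorProduct.map f (AlgHom.id k A) z = Algebra.TensorProduct.map g (AlgHom.id k A) z := by
  rw [AlgHom.ext h]

theorem map_map_apply {X Y Z : Type u} [AddCommGroup X] [Module k X] [AddCommGroup Y] [Module k Y]
    [AddCommGroup Z] [Module k Z] (f : Module.End k Y →ₐ[k] Module.End k Z)
    (g : Module.End k X →ₐ[k] Module.End k Y) (z : Module.End k X ⊗[k] A) :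
    Algebra.TensorProduct.map f (AlgHom.id k A) (Algebra.TensorProduct.map g (AlgHom.id k A) z) =
      Algebra.TensorProduct.map (f.comp g) (AlgHom.id k A) z := by
  induction z with
  | zero => simp
  | add a b ha hb => simp only [map_add, ha, hb]
  | tmul T a => simp

theorem conj_eq {X Y : Type u} [AddCommGroup X] [Module k X] [AddCommGroup Y] [Module k Y]
    (e : X ≃ₗ[k] Y) (S : Module.End k X) (R : Module.End k Y)
    (h : e.toLinearMap ∘ₗ S = R ∘ₗ e.toLinearMap) : e.conjAlgEquiv k S = R := by
  ext z
  obtain ⟨z, rfl⟩ := e.surjective z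
  have := LinearMap.congr_fun h z
  simpa using this

theorem wordSnoc_el (x y : Obj k A) : (m j : ℕ) →
    cj (wordSnoc x y j m) (tensor (word x y j m) (alt x y (nextIndex j m))).el =
      (word x y j (m + 1)).el
  | 0, j => by
    change cj ((TensorProduct.lid k (alt x y j).X).trans (TensorProduct.rid k (alt x y j).X).symm)
      (Algebra.TensorProduct.map (Module.End.rTensorAlgHom k k (alt x y j).X) (AlgHom.id k A) 1 *
        Algebra.TensorProduct.map (Module.End.lTensorAlgHom k (alt x y j).X k) (AlgHom.id k A)
          (alt x y j).el) =
      Algebra.TensorProduct.map (Module.End.rTensorAlgHom k (alt x y j).X k) (AlgHom.id k A)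
          (alt x y j).el *
        Algebra.TensorProduct.map (Module.End.lTensorAlgHom k k (alt x y j).X) (AlgHom.id k A) 1
    rw [map_one, map_one, one_mul, mul_one, cj, map_map_apply]
    refine map_eq_map_of _ _ (fun T => ?_) _
    ext a
    change (TensorProduct.rid k _).symm (TensorProduct.lid k _ (Module.End.lTensorAlgHom k _ k T
      ((TensorProduct.lid k _).symm (TensorProduct.rid k _ (a ⊗ₜ[k] (1 : k)))))) = T a ⊗ₜ[k] 1
    rw [TensorProduct.rid_tmul, one_smul, TensorProduct.lid_symm_apply]
    change (TensorProduct.rid k _).symm (TensorProduct.lid k _ (1 ⊗ₜ[k] T a)) = _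
    rw [TensorProduct.lid_tmul, one_smul, TensorProduct.rid_symm_apply]
  | m + 1, j => by
    have ih := wordSnoc_el x y m (j + 1)
    set X := alt x y j
    set P := word x y (j + 1) m
    set Z := alt x y (nextIndex (j + 1) m)
    set e := wordSnoc x y (j + 1) m
    change cj ((TensorProduct.assoc k X.X P.X Z.X).trans
        (TensorProduct.congr (LinearEquiv.refl k X.X) e)) (tensor (tensor X P) Z).el =
      Algebra.TensorProduct.map (Module.End.rTensorAlgHom k X.X _) (AlgHom.id k A) X.el *
        Algebra.TensorProduct.map (Module.End.lTensorAlgHom k _ X.X) (AlgHom.id k A)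
          (word x y (j + 1) (m + 1)).el
    rw [← ih]
    simp only [tensor, map_mul, map_map_apply, mul_assoc]
    congr 1
    · refine map_eq_map_of _ _ (fun T => conj_eq _ _ _ ?_) _
      ext a b c; rfl
    congr 1
    · refine map_eq_map_of _ _ (fun T => conj_eq _ _ _ ?_) _
      ext a b c
      change a ⊗ₜ[k] e (T b ⊗ₜ[k] c) = a ⊗ₜ[k] e (Module.End.rTensorAlgHom k _ _ T (e.symm (e (b ⊗ₜ[k] c))))
      rw [e.symm_apply_apply]; rfl
    · refine map_eq_map_of _ _ (fun T => conj_eq _ _ _ ?_) _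
      ext a b c
      change a ⊗ₜ[k] e (b ⊗ₜ[k] T c) = a ⊗ₜ[k] e (Module.End.lTensorAlgHom k _ _ T (e.symm (e (b ⊗ₜ[k] c))))
      rw [e.symm_apply_apply]; rfl

theorem addLeft_mem (x y : Obj k A) (j m : ℕ) {T : Module.End k (word x y (j + 1) m).X}
    (hT : T ∈ (word x y (j + 1) m).endAlg) : addLeft x y j m T ∈ (word x y j (m + 1)).endAlg :=
  lTensor_mem _ _ hT

theorem addRight_mem (x y : Obj k A) (j m : ℕ) {T : Module.End k (word x y j m).X}
    (hT : T ∈ (word x y j m).endAlg) : addRight x y j m T ∈ (word x y j (m + 1)).endAlg :=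
  conj_mem (tensor (word x y j m) (alt x y (nextIndex j m))) _ (wordSnoc x y j m)
    (wordSnoc_el x y m j) (rTensor_mem _ _ hT)

/-- The vertical inclusion `End(s) ⊂ End(r ⊗ s)`, `T ↦ id ⊗ T`, between algebras of `L(v)`. -/
def endVert (x y : Obj k A) (j m : ℕ) :
    (word x y (j + 1) m).endAlg →ₐ[k] (word x y j (m + 1)).endAlg :=
  ((addLeft x y j m).comp (word x y (j + 1) m).endAlg.val).codRestrict _
    fun T => addLeft_mem x y j m T.2

/-- The horizontal inclusion `End(r) ⊂ End(r ⊗ s)`, `T ↦ T ⊗ id`, between algebras of `L(v)`. -/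
def endHoriz (x y : Obj k A) (j m : ℕ) :
    (word x y j m).endAlg →ₐ[k] (word x y j (m + 1)).endAlg :=
  ((addRight x y j m).comp (word x y j m).endAlg.val).codRestrict _
    fun T => addRight_mem x y j m T.2

end Obj

section Lv

variable {k V H : Type u} [Field k] [AddCommGroup V] [Module k V] [Ring H] [HopfAlgebra k H]

/-- `v ∈ L(V) ⊗ H` as an object. -/
def vObj (v : Module.End k V ⊗[k] H) : Obj k H := ⟨V, v⟩

/-- `v̂ ∈ L(V*) ⊗ H` as an object. -/
def vHatObj (v : Module.End k V ⊗[k] H) : Obj k H := ⟨Module.Dual k V, contragredient v⟩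

/-- For `j ≤ i` and `m = i - j`, the algebra of the lattice `L(v)` on the position `(i, -j)`: the
algebra `End(v ⊗ v̂ ⊗ v ⊗ ⋯)` (`m` terms) if `j` is even, `End(v̂ ⊗ v ⊗ v̂ ⊗ ⋯)` (`m` terms) if `j`
is odd. -/
abbrev latticeEnd (v : Module.End k V ⊗[k] H) (j m : ℕ) :
    Subalgebra k (Module.End k (Obj.word (vObj v) (vHatObj v) j m).X) :=
  (Obj.word (vObj v) (vHatObj v) j m).endAlg

end Lv

/-! ### Squares of algebras with a trace, basic constructions, and the lattice `L(□)` -/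

/-- A square of inclusions of algebras `A₀ = A₀₀ ⊂ A = A₀₁`, `B₀ = A₁₀ ⊂ B = A₁₁`, `A ⊂ B`,
`A₀ ⊂ B₀`, with a linear form (the trace) on the biggest algebra `B`. -/
structure Square (k : Type u) [Field k] where
  /-- `A₀₁` -/
  A : Type u
  /-- `A₁₁` -/
  B : Type u
  [ringA : Ring A]
  [ringB : Ring B]
  [algA : Algebra k A]
  [algB : Algebra k B]
  /-- the inclusion `A₀₁ ⊂ A₁₁` -/
  ι : A →ₐ[k] B
  /-- `A₀₀` -/
  A₀ : Subalgebra k A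
  /-- `A₁₀` -/
  B₀ : Subalgebra k B
  /-- `A₀₀ ⊂ A₁₀` -/
  le : A₀.map ι ≤ B₀
  /-- the trace -/
  τ : B →ₗ[k] k

attribute [instance] Square.ringA Square.ringB Square.algA Square.algB

namespace Square

variable {k : Type u} [Field k]

/-- `E : B → A` is the conditional expectation with respect to the trace. -/
def IsCondExp (s : Square k) (E : s.B →ₗ[k] s.A) : Prop :=
  ∀ (b : s.B) (a : s.A), s.τ (s.ι (E b) * s.ι a) = s.τ (b * s.ι a)

open Classical in
/-- The conditional expectation `B → A` (`0` if there is none). -/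
def condExp (s : Square k) : s.B →ₗ[k] s.A :=
  if h : ∃ E, s.IsCondExp E then h.choose else 0

/-- The Jones projection: the conditional expectation as a linear endomorphism of `B`. -/
def jones (s : Square k) : Module.End k s.B := s.ι.toLinearMap ∘ₗ s.condExp

/-- The basic construction `⟨B, e⟩` for `A ⊂ B`: the algebra of linear endomorphisms of `B` generated
by the left multiplications by elements of `B` and by the Jones projection. -/
def basic (s : Square k) : Subalgebra k (Module.End k s.B) :=
  Algebra.adjoin k (Set.range (Algebra.lmul k s.B) ∪ {s.jones})

/-- The inclusion `B ⊂ ⟨B, e⟩`. -/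
def toBasic (s : Square k) : s.B →ₐ[k] s.basic :=
  (Algebra.lmul k s.B).codRestrict s.basic
    fun b => Algebra.subset_adjoin (Or.inl ⟨b, rfl⟩)

/-- The Jones projection as an element of `⟨B, e⟩`. -/
def jonesMem (s : Square k) : s.basic := ⟨s.jones, Algebra.subset_adjoin (Or.inr rfl)⟩

/-- `σ` is a Markov extension of the trace of `B` to `⟨B, e⟩`: a trace that extends the trace of `B`
and such that `β σ(be) = τ(b)` for all `b ∈ B`, for some nonzero scalar `β`. -/
def IsMarkovExt (s : Square k) (σ : s.basic →ₗ[k] k) : Prop :=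
  (∀ x y, σ (x * y) = σ (y * x)) ∧ (∀ b, σ (s.toBasic b) = s.τ b) ∧
    ∃ β : k, β ≠ 0 ∧ ∀ b, β * σ (s.toBasic b * s.jonesMem) = s.τ b

open Classical in
/-- The Markov extension of the trace of `B` to `⟨B, e⟩` (`0` if there is none). -/
def markovExt (s : Square k) : s.basic →ₗ[k] k :=
  if h : ∃ σ, s.IsMarkovExt σ then h.choose else 0

/-- The basic construction for squares: the square `B₀ ⊂ B`, `⟨B₀, e⟩ ⊂ ⟨B, e⟩`, where `⟨B₀, e⟩` is
the subalgebra of `⟨B, e⟩` generated by `B₀` and by the Jones projection. -/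
def next (s : Square k) : Square k where
  A := s.B
  B := s.basic
  ι := s.toBasic
  A₀ := s.B₀
  B₀ := Algebra.adjoin k (s.toBasic '' (s.B₀ : Set s.B) ∪ {s.jonesMem})
  le := by
    rintro _ ⟨b, hb, rfl⟩
    exact Algebra.subset_adjoin (Or.inl ⟨b, hb, rfl⟩)
  τ := s.markovExt

/-- The sequence of iterated basic constructions; its `i`-th term is the square with sides
`A_{i0} ⊂ A_{i1}` and `A_{i+1,0} ⊂ A_{i+1,1}`. -/
def tower (s : Square k) : ℕ → Square k
  | 0 => s
  | n + 1 => (tower s n).next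

/-- The algebra `A_{i1}`. -/
abbrev upper (s : Square k) (i : ℕ) : Type u := (s.tower i).A

/-- The algebra `A_{i0}`, as a subalgebra of `A_{i1}`. -/
def lower (s : Square k) (i : ℕ) : Subalgebra k (s.upper i) := (s.tower i).A₀

/-- The inclusion `A_{i1} ⊂ A_{i+1,1}`. -/
def incl (s : Square k) (i : ℕ) : s.upper i →ₐ[k] s.upper (i + 1) := (s.tower i).ι

/-- For `j ≤ i`, the algebra `A_{j1}` as a subalgebra of `A_{i1}`. -/
def upperIn (s : Square k) (j : ℕ) : (i : ℕ) → Subalgebra k (s.upper i)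
  | 0 => ⊤
  | i + 1 => if j ≤ i then (upperIn s j i).map (s.incl i) else ⊤

/-- For `j ≤ i`, the algebra `A_{j1}' ∩ A_{i0}` of the lattice `L(□)`. -/
def relComm (s : Square k) (i j : ℕ) : Subalgebra k (s.upper i) :=
  Subalgebra.centralizer k (s.upperIn j i : Set (s.upper i)) ⊓ s.lower i

theorem incl_mem_relComm (s : Square k) {i j : ℕ} (hij : j ≤ i) {x : s.upper i}
    (hx : x ∈ s.relComm i j) : s.incl i x ∈ s.relComm (i + 1) j := by
  refine ⟨?_, (s.tower i).le ⟨x, hx.2, rfl⟩⟩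
  have h1 : s.upperIn j (i + 1) = (s.upperIn j i).map (s.incl i) := if_pos hij
  rw [h1]
  refine Subalgebra.mem_centralizer_iff k |>.2 ?_
  rintro _ ⟨a, ha, rfl⟩
  have := (Subalgebra.mem_centralizer_iff k).1 hx.1 a ha
  simpa using congrArg (s.incl i) this

theorem upperIn_le (s : Square k) (j : ℕ) : ∀ i, j + 1 ≤ i → s.upperIn j i ≤ s.upperIn (j + 1) i
  | 0, h => absurd h (by omega)
  | i + 1, h => by
    have h1 : s.upperIn j (i + 1) = (s.upperIn j i).map (s.incl i) := if_pos (by omega)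
    by_cases h2 : j + 1 ≤ i
    · have h3 : s.upperIn (j + 1) (i + 1) = (s.upperIn (j + 1) i).map (s.incl i) := if_pos h2
      rw [h1, h3]
      exact Subalgebra.map_mono (upperIn_le s j i h2)
    · have h3 : s.upperIn (j + 1) (i + 1) = ⊤ := if_neg h2
      rw [h3]
      exact le_top

theorem relComm_le (s : Square k) {i j : ℕ} (hij : j + 1 ≤ i) :
    s.relComm i (j + 1) ≤ s.relComm i j :=
  inf_le_inf_right _ (Subalgebra.centralizer_le k _ _ (s.upperIn_le j i hij))

/-- The horizontal inclusion `A_{j1}' ∩ A_{i0} ⊂ A_{j1}' ∩ A_{i+1,0}`. -/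
def horiz (s : Square k) {i j : ℕ} (hij : j ≤ i) : s.relComm i j →ₐ[k] s.relComm (i + 1) j :=
  ((s.incl i).comp (s.relComm i j).val).codRestrict _ fun x => s.incl_mem_relComm hij x.2

/-- The vertical inclusion `A_{j+1,1}' ∩ A_{i0} ⊂ A_{j1}' ∩ A_{i0}`. -/
def vert (s : Square k) {i j : ℕ} (hij : j + 1 ≤ i) : s.relComm i (j + 1) →ₐ[k] s.relComm i j :=
  Subalgebra.inclusion (s.relComm_le hij)

end Square

section Box

variable {k V W : Type u} [Field k] [AddCommGroup V] [Module k V] [AddCommGroup W] [Module k W]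

/-- `ad(u) : x ↦ u x u⁻¹`. -/
def ad {B : Type u} [Ring B] [Algebra k B] (u : Bˣ) : B →ₐ[k] B where
  toFun x := u * x * (↑u⁻¹ : B)
  map_one' := by simp
  map_mul' x y := by simp [mul_assoc]
  map_zero' := by simp
  map_add' x y := by simp [mul_add, add_mul]
  commutes' r := by
    rw [← Algebra.commutes, mul_assoc, Units.mul_inv, mul_one]

/-- The square `□_u`, with `A₀₀ = k`, `A₀₁ = k ⊗ L(W)`, `A₁₀ = u(L(V) ⊗ k)u⁻¹` and
`A₁₁ = L(V) ⊗ L(W)`, and with the normalized trace of `L(V) ⊗ L(W)`. -/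
def box (u : (Module.End k V ⊗[k] Module.End k W)ˣ) : Square k where
  A := (Algebra.TensorProduct.includeRight :
    Module.End k W →ₐ[k] Module.End k V ⊗[k] Module.End k W).range
  B := Module.End k V ⊗[k] Module.End k W
  ι := Subalgebra.val _
  A₀ := ⊥
  B₀ := (Algebra.TensorProduct.includeLeft :
    Module.End k V →ₐ[k] Module.End k V ⊗[k] Module.End k W).range.map (ad u)
  le := by simp
  τ := ((Module.finrank k V * Module.finrank k W : k)⁻¹) •
    (LinearMap.mul' k k ∘ₗ TensorProduct.map (LinearMap.trace k V) (LinearMap.trace k W))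

end Box

end VertexModel

end

/-!
Let `X_i` be the alternating tensor product of `i` copies of `V` and `V*`, and let
`U_i ∈ L(X_i) ⊗ L(W)` be the alternating product of `u` and `û = (t ⊗ id)u⁻¹`. The duality between
`V` and `V*` carries the basic construction of `L(X_i) ⊗ L(W) ⊂ L(X_{i+1}) ⊗ L(W)` to
`L(X_{i+2}) ⊗ L(W)`, with Jones projection a multiple of `coev ∘ ev` on the last two factors. By
`(⋆)` this projection commutes with `U_{i+2}`, so by induction `A_{i1}` is `L(X_i) ⊗ L(W)` and
`A_{i0}` is `U_i (L(X_i) ⊗ 1) U_i⁻¹`. Hence `A_{j1}' ∩ A_{i0}` is the algebra of the operators `T`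
on the last `i - j` factors of `X_i` with `U⁻¹(T ⊗ 1)U ∈ L ⊗ 1`, for the alternating product `U` on
these factors.

By `(⋆)` again, `U⁻¹(T ⊗ 1)U ∈ L ⊗ 1` if and only if `T ⊗ 1` commutes with
`U' = U₁₂ ((id ⊗ t)U⁻¹)₁₃`, which is the image of `r_{j,i}` under `id ⊗ π`. The coefficients of
`[T ⊗ 1, r_{j,i}]` generate a Hopf ideal; if `π` kills them, then minimality forces this ideal to
vanish. So `T ⊗ 1` commutes with `r_{j,i}` itself.
-/

noncomputable section

namespace VertexModel

open Module (Dual End finrank)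
open Module.End (lTensorAlgHom rTensorAlgHom)
open Algebra.TensorProduct (includeLeft includeRight map map_tmul tmul_mul_tmul)

/-! ### Coefficients, legs and transposition -/

section Coefficients

variable {k M A B : Type*} [Field k] [AddCommGroup M] [Module k M]
  [AddCommGroup A] [Module k A] [AddCommGroup B] [Module k B]

/-- The slice map `f ⊗ id : M ⊗ A → A` of a linear form `f` on `M`; its values at a fixed `z` are
the coefficients of `z`. -/
def coeff (f : Dual k M) : M ⊗[k] A →ₗ[k] A :=
  (TensorProduct.lid k A).toLinearMap ∘ₗ LinearMap.rTensor A f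

@[simp]
theorem coeff_tmul (f : Dual k M) (m : M) (a : A) : coeff f (m ⊗ₜ[k] a) = f m • a := by
  simp [coeff]

theorem coeff_lTensor (f : Dual k M) (q : A →ₗ[k] B) (z : M ⊗[k] A) :
    coeff f (LinearMap.lTensor M q z) = q (coeff f z) := by
  induction z with
  | zero => simp
  | add a b ha hb => simp only [map_add, ha, hb]
  | tmul m a => simp

theorem eq_zero_of_coeff {z : M ⊗[k] A} (h : ∀ f : Dual k M, coeff f z = 0) : z = 0 := by
  classical
  let b := Module.Basis.ofVectorSpace k M
  refine (TensorProduct.equivFinsuppOfBasisLeft b (N := A)).injective ?_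
  ext i
  rw [TensorProduct.equivFinsuppOfBasisLeft_apply, map_zero]
  exact h (b.coord i)

theorem lTensor_eq_zero_iff (q : A →ₗ[k] B) (z : M ⊗[k] A) :
    LinearMap.lTensor M q z = 0 ↔ ∀ f : Dual k M, q (coeff f z) = 0 := by
  simp only [← coeff_lTensor]
  exact ⟨fun h f => by rw [h, map_zero], eq_zero_of_coeff⟩

end Coefficients

section Legs

variable {k : Type*} [Field k]

/-- `f ⊗ id : S ⊗ A → T ⊗ A`, for a morphism of algebras `f`. -/
abbrev mapLeft {S T : Type*} [Ring S] [Algebra k S] [Ring T] [Algebra k T] (f : S →ₐ[k] T)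
    (A : Type*) [Ring A] [Algebra k A] : S ⊗[k] A →ₐ[k] T ⊗[k] A :=
  map f (AlgHom.id k A)

/-- `id ⊗ f : S ⊗ A → S ⊗ B`, for a morphism of algebras `f`. -/
abbrev mapRight (S : Type*) [Ring S] [Algebra k S] {A B : Type*} [Ring A] [Algebra k A]
    [Ring B] [Algebra k B] (f : A →ₐ[k] B) : S ⊗[k] A →ₐ[k] S ⊗[k] B :=
  map (AlgHom.id k S) f

section

variable {S S' T A A' B C : Type*} [Ring S] [Algebra k S] [Ring S'] [Algebra k S'] [Ring T]
  [Algebra k T] [Ring A] [Algebra k A] [Ring A'] [Algebra k A'] [Ring B] [Algebra k B]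
  [Ring C] [Algebra k C]

theorem mapRight_mapRight (g : B →ₐ[k] C) (f : A →ₐ[k] B) (z : S ⊗[k] A) :
    mapRight S g (mapRight S f z) = mapRight S (g.comp f) z :=
  (AlgHom.congr_fun (Algebra.TensorProduct.map_comp (.id k S) (.id k S) g f) z).symm

theorem mapRight_mapLeft (g : S →ₐ[k] T) (f : A →ₐ[k] B) (z : S ⊗[k] A) :
    mapRight T f (mapLeft g A z) = map g f z :=
  (AlgHom.congr_fun (Algebra.TensorProduct.map_comp (.id k T) g f (.id k A)) z).symm

theorem mapLeft_mapRight (g : S →ₐ[k] T) (f : A →ₐ[k] B) (z : S ⊗[k] A) :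
    mapLeft g B (mapRight S f z) = map g f z :=
  (AlgHom.congr_fun (Algebra.TensorProduct.map_comp g (.id k S) (.id k B) f) z).symm

theorem lTensor_tmul_one_mul (φ : A →ₗ[k] B) (s : S) (z : S ⊗[k] A) :
    LinearMap.lTensor S φ ((s ⊗ₜ[k] 1) * z) = (s ⊗ₜ[k] 1) * LinearMap.lTensor S φ z := by
  induction z with
  | zero => simp
  | add z w hz hw => simp only [map_add, mul_add, hz, hw]
  | tmul t a => simp

theorem lTensor_mul_tmul_one (φ : A →ₗ[k] B) (z : S ⊗[k] A) (s : S) :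
    LinearMap.lTensor S φ (z * (s ⊗ₜ[k] 1)) = LinearMap.lTensor S φ z * (s ⊗ₜ[k] 1) := by
  induction z with
  | zero => simp
  | add z w hz hw => simp only [map_add, add_mul, hz, hw]
  | tmul t a => simp

theorem commute_map_map {f : S →ₐ[k] T} {g : S' →ₐ[k] T} {f' : A →ₐ[k] B} {g' : A' →ₐ[k] B}
    (h : ∀ s s', Commute (f s) (g s')) (h' : ∀ a a', Commute (f' a) (g' a')) (z : S ⊗[k] A)
    (w : S' ⊗[k] A') : Commute (map f f' z) (map g g' w) := by
  induction z with
  | zero => simp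
  | add z z' hz hz' => rw [map_add]; exact hz.add_left hz'
  | tmul s a =>
    induction w with
    | zero => simp
    | add w w' hw hw' => rw [map_add]; exact hw.add_right hw'
    | tmul s' a' => exact (h s s').tmul (h' a a')

theorem commute_includeLeft_includeRight (a : A) (b : B) :
    Commute (includeLeft (S := k) (R := k) a : A ⊗[k] B) (includeRight b) :=
  (Commute.one_right a).tmul (Commute.one_left b)

end

section

variable {X Y : Type*} [AddCommGroup X] [Module k X] [AddCommGroup Y] [Module k Y]

theorem commute_rTensorAlgHom_lTensorAlgHom (S : End k X) (T : End k Y) :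
    Commute (rTensorAlgHom k X Y S) (lTensorAlgHom k Y X T) :=
  TensorProduct.ext' fun _ _ => rfl

theorem rTensorAlgHom_injective [Nontrivial Y] : Function.Injective (rTensorAlgHom k X Y) :=
  (injective_iff_map_eq_zero _).2 fun S hS =>
    (Module.FaithfullyFlat.zero_iff_rTensor_zero k Y S).2 hS

theorem lTensorAlgHom_injective [Nontrivial X] : Function.Injective (lTensorAlgHom k Y X) :=
  (injective_iff_map_eq_zero _).2 fun T hT =>
    (Module.FaithfullyFlat.zero_iff_lTensor_zero k X T).2 hT

/-- The product `a₁₃ b₂₃ ∈ L(X ⊗ Y) ⊗ A` of `a ∈ L(X) ⊗ A` and `b ∈ L(Y) ⊗ A`. -/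
abbrev legMul {A : Type*} [Ring A] [Algebra k A] (a : End k X ⊗[k] A) (b : End k Y ⊗[k] A) :
    End k (X ⊗[k] Y) ⊗[k] A :=
  mapLeft (rTensorAlgHom k X Y) A a * mapLeft (lTensorAlgHom k Y X) A b

theorem mapRight_legMul {A B : Type*} [Ring A] [Algebra k A] [Ring B] [Algebra k B]
    (f : A →ₐ[k] B) (a : End k X ⊗[k] A) (b : End k Y ⊗[k] A) :
    mapRight (End k (X ⊗[k] Y)) f (legMul a b) =
      legMul (mapRight (End k X) f a) (mapRight (End k Y) f b) := by
  rw [map_mul, mapRight_mapLeft, mapRight_mapLeft, legMul, mapLeft_mapRight, mapLeft_mapRight]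

theorem mapRight_legMul_mul {A B C : Type*} [Ring A] [Algebra k A] [Ring B] [Algebra k B]
    [Ring C] [Algebra k C] {f : A →ₐ[k] C} {g : B →ₐ[k] C} (hfg : ∀ a b, Commute (f a) (g b))
    (a : End k X ⊗[k] A) (b : End k Y ⊗[k] A) (a' : End k X ⊗[k] B) (b' : End k Y ⊗[k] B) :
    mapRight (End k (X ⊗[k] Y)) f (legMul a b) * mapRight (End k (X ⊗[k] Y)) g (legMul a' b') =
      legMul (mapRight (End k X) f a * mapRight (End k X) g a')
        (mapRight (End k Y) f b * mapRight (End k Y) g b') := by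
  have h : Commute (map (lTensorAlgHom k Y X) f b) (map (rTensorAlgHom k X Y) g a') :=
    commute_map_map (fun T S => (commute_rTensorAlgHom_lTensorAlgHom S T).symm) hfg b a'
  simp only [legMul, map_mul, mapRight_mapLeft, mapLeft_mapRight]
  exact h.mul_mul_mul_comm _ _

end

end Legs

section Transposition

variable {k X W A B C : Type u} [Field k] [AddCommGroup X] [Module k X] [AddCommGroup W]
  [Module k W] [Ring A] [Algebra k A] [Ring B] [Algebra k B] [Ring C] [Algebra k C]

theorem transpose_injective : Function.Injective (Dual.transpose (R := k) (M := X) (M' := X)) := by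
  intro S T h
  ext x
  refine sub_eq_zero.1 ((Module.forall_dual_apply_eq_zero_iff k _).1 fun f => ?_)
  rw [map_sub, sub_eq_zero]
  exact LinearMap.congr_fun (LinearMap.congr_fun h f) x

theorem transposeLeft_injective : Function.Injective (transposeLeft (k := k) (V := X) A) :=
  Module.Flat.rTensor_preserves_injective_linearMap _ transpose_injective

@[simp]
theorem transposeLeft_tmul (S : End k X) (a : A) :
    transposeLeft A (S ⊗ₜ[k] a) = Dual.transpose (R := k) S ⊗ₜ[k] a :=
  LinearMap.rTensor_tmul _ _ _ _

@[simp]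
theorem transposeRight_tmul (a : A) (S : End k W) :
    transposeRight A (a ⊗ₜ[k] S) = a ⊗ₜ[k] Dual.transpose (R := k) S :=
  LinearMap.lTensor_tmul _ _ _ _

theorem transposeLeft_one : transposeLeft (k := k) (V := X) A 1 = 1 :=
  transposeLeft_tmul _ _

theorem transposeRight_one : transposeRight (k := k) (W := W) A 1 = 1 :=
  transposeRight_tmul _ _

theorem mapRight_transposeLeft (f : A →ₐ[k] B) (z : End k X ⊗[k] A) :
    mapRight (End k (Dual k X)) f (transposeLeft A z) =
      transposeLeft B (mapRight (End k X) f z) := by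
  induction z with
  | zero => simp
  | add a b ha hb => simp only [map_add, ha, hb]
  | tmul S a => simp

theorem transposeLeft_mul {f : A →ₐ[k] C} {g : B →ₐ[k] C} (h : ∀ a b, Commute (f a) (g b))
    (z : End k X ⊗[k] A) (w : End k X ⊗[k] B) :
    transposeLeft C (mapRight (End k X) f z * mapRight (End k X) g w) =
      mapRight (End k (Dual k X)) g (transposeLeft B w) *
        mapRight (End k (Dual k X)) f (transposeLeft A z) := by
  induction z with
  | zero => simp
  | add z z' hz hz' => simp only [map_add, add_mul, mul_add, hz, hz']
  | tmul S a =>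
    induction w with
    | zero => simp
    | add w w' hw hw' => simp only [map_add, mul_add, add_mul, hw, hw']
    | tmul T b =>
      simp only [map_tmul, AlgHom.id_apply, tmul_mul_tmul, transposeLeft_tmul, (h a b).eq]
      rfl

theorem transposeRight_mul {f : A →ₐ[k] C} {g : B →ₐ[k] C} (h : ∀ a b, Commute (f a) (g b))
    (z : A ⊗[k] End k W) (w : B ⊗[k] End k W) :
    transposeRight C (mapLeft f (End k W) z * mapLeft g (End k W) w) =
      mapLeft g (End k (Dual k W)) (transposeRight B w) *
        mapLeft f (End k (Dual k W)) (transposeRight A z) := by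
  induction z with
  | zero => simp
  | add z z' hz hz' => simp only [map_add, add_mul, mul_add, hz, hz']
  | tmul a S =>
    induction w with
    | zero => simp
    | add w w' hw hw' => simp only [map_add, mul_add, add_mul, hw, hw']
    | tmul b T =>
      simp only [map_tmul, AlgHom.id_apply, tmul_mul_tmul, transposeRight_tmul, (h a b).eq]
      rfl

theorem transposeLeft_transposeRight_mul (z w : End k X ⊗[k] End k W) :
    transposeLeft (End k (Dual k W)) (transposeRight (End k X) z * transposeRight (End k X) w) =
      transposeRight (End k (Dual k X))
        (transposeLeft (End k W) w * transposeLeft (End k W) z) := by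
  induction z with
  | zero => simp
  | add z z' hz hz' => simp only [map_add, add_mul, mul_add, hz, hz']
  | tmul S P =>
    induction w with
    | zero => simp
    | add w w' hw hw' => simp only [map_add, add_mul, mul_add, hw, hw']
    | tmul T Q =>
      simp only [transposeLeft_tmul, transposeRight_tmul, tmul_mul_tmul]
      rfl

theorem transposeRight_transposeLeft_mul (z w : End k X ⊗[k] End k W) :
    transposeRight (End k (Dual k X)) (transposeLeft (End k W) z) *
        transposeRight (End k (Dual k X)) (transposeLeft (End k W) w) =
      transposeLeft (End k (Dual k W)) (transposeRight (End k X) (w * z)) := by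
  induction z with
  | zero => simp
  | add z z' hz hz' => simp only [map_add, add_mul, mul_add, hz, hz']
  | tmul S P =>
    induction w with
    | zero => simp
    | add w w' hw hw' => simp only [map_add, add_mul, mul_add, hw, hw']
    | tmul T Q =>
      simp only [transposeLeft_tmul, transposeRight_tmul, tmul_mul_tmul]
      rfl

end Transposition

/-! ### Corepresentations and minimal models -/

section Corep

variable {k X Y H K : Type u} [Field k] [AddCommGroup X] [Module k X] [AddCommGroup Y] [Module k Y]
  [Ring H] [HopfAlgebra k H] [Ring K] [HopfAlgebra k K]

theorem isCorep_iff (r : End k X ⊗[k] H) :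
    IsCorep r ↔
      mapRight (End k X) (Bialgebra.comulAlgHom k H) r =
          mapRight (End k X) includeLeft r * mapRight (End k X) includeRight r ∧
        mapRight (End k X) (Bialgebra.counitAlgHom k H) r = 1 := by
  have h : TensorProduct.rid k (End k X) (1 : End k X ⊗[k] k) = 1 :=
    (TensorProduct.rid_tmul _ _).trans (one_smul k _)
  refine and_congr Iff.rfl ?_
  rw [← (TensorProduct.rid k (End k X)).injective.eq_iff, h]
  rfl

theorem isCorep_one : IsCorep (1 : End k X ⊗[k] H) := by
  simp only [isCorep_iff, map_one, mul_one, and_self]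

theorem IsCorep.map {r : End k X ⊗[k] H} (hr : IsCorep r) (q : H →ₐc[k] K) :
    IsCorep (mapRight (End k X) (q : H →ₐ[k] K) r) := by
  rw [isCorep_iff] at hr ⊢
  refine ⟨?_, ?_⟩
  · rw [mapRight_mapRight, ← BialgHom.map_comp_comulAlgHom, ← mapRight_mapRight, hr.1, map_mul]
    simp only [mapRight_mapRight, Algebra.TensorProduct.map_comp_includeLeft,
      Algebra.TensorProduct.map_comp_includeRight]
  · rw [mapRight_mapRight, BialgHom.counitAlgHom_comp, hr.2]

theorem IsCorep.legMul {a : End k X ⊗[k] H} {b : End k Y ⊗[k] H} (ha : IsCorep a)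
    (hb : IsCorep b) : IsCorep (legMul a b) := by
  rw [isCorep_iff] at ha hb ⊢
  rw [mapRight_legMul_mul commute_includeLeft_includeRight, mapRight_legMul, mapRight_legMul,
    ha.1, hb.1, ha.2, hb.2]
  exact ⟨rfl, by simp only [VertexModel.legMul, map_one, mul_one]⟩

theorem lTensor_mul_legs (φ ψ : H →ₗ[k] H) (a b : End k X ⊗[k] H) :
    LinearMap.lTensor (End k X) (LinearMap.mul' k H ∘ₗ TensorProduct.map φ ψ)
        (mapRight (End k X) includeLeft a * mapRight (End k X) includeRight b) =
      LinearMap.lTensor (End k X) φ a * LinearMap.lTensor (End k X) ψ b := by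
  induction a with
  | zero => simp
  | add a a' ha ha' => simp only [map_add, add_mul, ha, ha']
  | tmul S h =>
    induction b with
    | zero => simp
    | add b b' hb hb' => simp only [map_add, mul_add, hb, hb']
    | tmul T h' => simp

theorem IsCorep.lTensor_counit {r : End k X ⊗[k] H} (hr : IsCorep r) :
    LinearMap.lTensor (End k X) (Algebra.linearMap k H ∘ₗ Coalgebra.counit) r = 1 := by
  have h := congrArg (mapRight (End k X) (Algebra.ofId k H)) ((isCorep_iff r).1 hr).2
  rwa [map_one, mapRight_mapRight] at h

/-- The antipode applied to the second leg of `r`, the inverse of `r` when `r` is a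
corepresentation. -/
abbrev antipodeRight (r : End k X ⊗[k] H) : End k X ⊗[k] H :=
  LinearMap.lTensor (End k X) (HopfAlgebra.antipode k) r

theorem IsCorep.lTensor_convolution {r : End k X ⊗[k] H} (hr : IsCorep r) (φ ψ : H →ₗ[k] H) :
    LinearMap.lTensor (End k X) φ r * LinearMap.lTensor (End k X) ψ r =
      LinearMap.lTensor (End k X)
        (LinearMap.mul' k H ∘ₗ TensorProduct.map φ ψ ∘ₗ Coalgebra.comul) r := by
  rw [← lTensor_mul_legs, ← ((isCorep_iff r).1 hr).1, ← LinearMap.comp_assoc]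
  exact (LinearMap.lTensor_comp_apply _ _ _ r).symm

theorem IsCorep.mul_antipodeRight {r : End k X ⊗[k] H} (hr : IsCorep r) :
    r * antipodeRight r = 1 := by
  have h := hr.lTensor_convolution LinearMap.id (HopfAlgebra.antipode k)
  rw [LinearMap.lTensor_id, LinearMap.id_apply] at h
  rw [h, ← hr.lTensor_counit]
  exact LinearMap.congr_fun
    (congrArg (LinearMap.lTensor (End k X)) (HopfAlgebra.mul_antipode_lTensor_comul)) r

theorem IsCorep.antipodeRight_mul {r : End k X ⊗[k] H} (hr : IsCorep r) :
    antipodeRight r * r = 1 := by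
  have h := hr.lTensor_convolution (HopfAlgebra.antipode k) LinearMap.id
  rw [LinearMap.lTensor_id, LinearMap.id_apply] at h
  rw [h, ← hr.lTensor_counit]
  exact LinearMap.congr_fun
    (congrArg (LinearMap.lTensor (End k X)) (HopfAlgebra.mul_antipode_rTensor_comul)) r

theorem IsCorep.comul_antipodeRight {r : End k X ⊗[k] H} (hr : IsCorep r) :
    mapRight (End k X) (Bialgebra.comulAlgHom k H) (antipodeRight r) =
      mapRight (End k X) includeRight (antipodeRight r) *
        mapRight (End k X) includeLeft (antipodeRight r) := by
  refine left_inv_eq_right_inv (a := mapRight (End k X) (Bialgebra.comulAlgHom k H) r) ?_ ?_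
  · rw [← map_mul, hr.antipodeRight_mul, map_one]
  · rw [((isCorep_iff r).1 hr).1, mul_assoc,
      ← mul_assoc (mapRight (End k X) (includeRight : H →ₐ[k] H ⊗[k] H) r), ← map_mul,
      hr.mul_antipodeRight, map_one, one_mul, ← map_mul, hr.mul_antipodeRight, map_one]

theorem IsCorep.counit_antipodeRight {r : End k X ⊗[k] H} (hr : IsCorep r) :
    mapRight (End k X) (Bialgebra.counitAlgHom k H) (antipodeRight r) = 1 := by
  have h := congrArg (mapRight (End k X) (Bialgebra.counitAlgHom k H)) hr.mul_antipodeRight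
  rwa [map_mul, ((isCorep_iff r).1 hr).2, one_mul, map_one] at h

theorem contragredient_eq_transposeLeft (r : End k X ⊗[k] H) :
    contragredient r = transposeLeft H (antipodeRight r) := by
  rw [contragredient, transposeLeft, ← LinearMap.comp_apply, LinearMap.rTensor_comp_lTensor]

theorem IsCorep.contragredient {r : End k X ⊗[k] H} (hr : IsCorep r) :
    IsCorep (contragredient r) := by
  rw [isCorep_iff, contragredient_eq_transposeLeft]
  constructor
  · rw [mapRight_transposeLeft, hr.comul_antipodeRight,
      transposeLeft_mul fun a b => (commute_includeLeft_includeRight b a).symm]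
  · rw [mapRight_transposeLeft, hr.counit_antipodeRight, transposeLeft_one]

theorem IsCorep.alt {x y : Obj k H} (hx : IsCorep x.el) (hy : IsCorep y.el) (j : ℕ) :
    IsCorep (Obj.alt x y j).el := by
  induction j generalizing x y with
  | zero => exact hx
  | succ _ ih => exact ih hy hx

theorem IsCorep.word {x y : Obj k H} (hx : IsCorep x.el) (hy : IsCorep y.el) (j m : ℕ) :
    IsCorep (Obj.word x y j m).el := by
  induction m generalizing j with
  | zero => exact isCorep_one
  | succ _ ih => exact (hx.alt hy j).legMul (ih (j + 1))

end Corep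

section CoeffIdeal

variable {k M A B : Type*} [Field k] [AddCommGroup M] [Module k M] [Ring A] [Algebra k A]
  [Ring B] [Algebra k B]

/-- The two-sided ideal of `A` generated by the coefficients of an element of `M ⊗ A`. -/
def coeffIdeal (z : M ⊗[k] A) : Ideal A :=
  (TwoSidedIdeal.span (Set.range fun f : Dual k M => coeff f z)).asIdeal

instance (z : M ⊗[k] A) : (coeffIdeal z).IsTwoSided :=
  inferInstanceAs (TwoSidedIdeal.asIdeal _).IsTwoSided

theorem coeff_mem_coeffIdeal (f : Dual k M) (z : M ⊗[k] A) : coeff f z ∈ coeffIdeal z :=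
  TwoSidedIdeal.subset_span ⟨f, rfl⟩

theorem map_eq_zero_of_mem_coeffIdeal (f : A →ₐ[k] B) {z : M ⊗[k] A}
    (hz : LinearMap.lTensor M f.toLinearMap z = 0) {a : A} (ha : a ∈ coeffIdeal z) : f a = 0 := by
  have h : TwoSidedIdeal.span (Set.range fun f : Dual k M => coeff f z) ≤ TwoSidedIdeal.ker f := by
    rw [TwoSidedIdeal.span_le]
    rintro _ ⟨g, rfl⟩
    exact (TwoSidedIdeal.mem_ker f).2 ((lTensor_eq_zero_iff f.toLinearMap z).1 hz g)
  exact (TwoSidedIdeal.mem_ker f).1 (h ha)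

theorem lTensor_mk_coeffIdeal (z : M ⊗[k] A) :
    LinearMap.lTensor M (Ideal.Quotient.mkₐ k (coeffIdeal z)).toLinearMap z = 0 :=
  (lTensor_eq_zero_iff _ z).2 fun f => Ideal.Quotient.eq_zero_iff_mem.2 (coeff_mem_coeffIdeal f z)

variable {S : Type*} [Ring S] [Algebra k S]

theorem mapRight_lie_eq_zero_iff (f : A →ₐ[k] B) (s : S) (r : S ⊗[k] A) :
    mapRight S f ⁅s ⊗ₜ[k] (1 : A), r⁆ = 0 ↔ Commute (s ⊗ₜ[k] (1 : B)) (mapRight S f r) := by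
  rw [commute_iff_lie_eq, Ring.lie_def, Ring.lie_def, map_sub, map_mul, map_mul, map_tmul, map_one]
  rfl

end CoeffIdeal

section IntertwiningIdeal

variable {k X H : Type u} [Field k] [AddCommGroup X] [Module k X] [Ring H] [HopfAlgebra k H]
  {r : End k X ⊗[k] H}

theorem counit_eq_zero_of_mem_coeffIdeal (hr : IsCorep r) {T : End k X} {a : H}
    (ha : a ∈ coeffIdeal ⁅T ⊗ₜ[k] (1 : H), r⁆) : Coalgebra.counit (R := k) a = 0 := by
  refine map_eq_zero_of_mem_coeffIdeal (Bialgebra.counitAlgHom k H) ?_ ha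
  refine (mapRight_lie_eq_zero_iff _ T r).2 ?_
  rw [((isCorep_iff r).1 hr).2]
  exact Commute.one_right _

theorem map_mk_comul_eq_zero_of_mem_coeffIdeal (hr : IsCorep r) {T : End k X} {a : H}
    (ha : a ∈ coeffIdeal ⁅T ⊗ₜ[k] (1 : H), r⁆) :
    map (Ideal.Quotient.mkₐ k (coeffIdeal ⁅T ⊗ₜ[k] (1 : H), r⁆))
      (Ideal.Quotient.mkₐ k (coeffIdeal ⁅T ⊗ₜ[k] (1 : H), r⁆))
      (Coalgebra.comul (R := k) a) = 0 := by
  set J := coeffIdeal ⁅T ⊗ₜ[k] (1 : H), r⁆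
  set q := Ideal.Quotient.mkₐ k J
  have hT : Commute (T ⊗ₜ[k] 1) (mapRight (End k X) q r) :=
    (mapRight_lie_eq_zero_iff q T r).1 (lTensor_mk_coeffIdeal _)
  have hT' : ∀ i : H ⧸ J →ₐ[k] (H ⧸ J) ⊗[k] (H ⧸ J),
      Commute (T ⊗ₜ[k] 1) (mapRight (End k X) (i.comp q) r) := fun i => by
    have h := hT.map (mapRight (End k X) i)
    rwa [map_tmul, map_one, mapRight_mapRight] at h
  refine map_eq_zero_of_mem_coeffIdeal ((map q q).comp (Bialgebra.comulAlgHom k H)) ?_ ha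
  refine (mapRight_lie_eq_zero_iff _ T r).2 ?_
  rw [← mapRight_mapRight, ((isCorep_iff r).1 hr).1, map_mul, mapRight_mapRight, mapRight_mapRight,
    Algebra.TensorProduct.map_comp_includeLeft, Algebra.TensorProduct.map_comp_includeRight]
  exact (hT' _).mul_right (hT' _)

theorem antipode_mem_coeffIdeal (hr : IsCorep r) {T : End k X} {a : H}
    (ha : a ∈ coeffIdeal ⁅T ⊗ₜ[k] (1 : H), r⁆) :
    HopfAlgebra.antipode k a ∈ coeffIdeal ⁅T ⊗ₜ[k] (1 : H), r⁆ := by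
  set J := coeffIdeal ⁅T ⊗ₜ[k] (1 : H), r⁆
  set q := Ideal.Quotient.mkₐ k J
  have hT : Commute (T ⊗ₜ[k] 1) (mapRight (End k X) q r) :=
    (mapRight_lie_eq_zero_iff q T r).1 (lTensor_mk_coeffIdeal _)
  have hT' : Commute (T ⊗ₜ[k] 1) (mapRight (End k X) q (antipodeRight r)) := by
    refine Commute.units_inv_right (u := ⟨_, mapRight (End k X) q (antipodeRight r), ?_, ?_⟩) hT
    · rw [← map_mul, hr.mul_antipodeRight, map_one]
    · rw [← map_mul, hr.antipodeRight_mul, map_one]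
  have hS : antipodeRight ⁅T ⊗ₜ[k] (1 : H), r⁆ = ⁅T ⊗ₜ[k] (1 : H), antipodeRight r⁆ := by
    rw [Ring.lie_def, Ring.lie_def, antipodeRight, map_sub, lTensor_tmul_one_mul,
      lTensor_mul_tmul_one]
  have h0 : LinearMap.lTensor (End k X) (q.toLinearMap ∘ₗ HopfAlgebra.antipode k)
      ⁅T ⊗ₜ[k] (1 : H), r⁆ = 0 := by
    rw [LinearMap.lTensor_comp, LinearMap.comp_apply]
    exact (congrArg (mapRight (End k X) q) hS).trans ((mapRight_lie_eq_zero_iff q T _).2 hT')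
  refine Ideal.Quotient.eq_zero_iff_mem.1 (MulOpposite.op_injective
    (map_eq_zero_of_mem_coeffIdeal ((AlgHom.op q).comp (HopfAlgebra.antipodeAlgHomOp k H)) ?_ ha))
  exact (lTensor_eq_zero_iff _ _).2 fun f =>
    congrArg MulOpposite.op ((lTensor_eq_zero_iff _ _).1 h0 f)

theorem isHopfIdeal_coeffIdeal (hr : IsCorep r) (T : End k X) :
    (coeffIdeal ⁅T ⊗ₜ[k] (1 : H), r⁆).IsHopfIdeal k where
  counit_eq_zero _ ha := counit_eq_zero_of_mem_coeffIdeal hr ha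
  map_mkQ_comul_eq_zero _ ha := map_mk_comul_eq_zero_of_mem_coeffIdeal hr ha
  antipode_mem _ ha := antipode_mem_coeffIdeal hr ha

end IntertwiningIdeal

section Minimal

variable {k V W X H K : Type u} [Field k] [AddCommGroup V] [Module k V] [AddCommGroup W]
  [Module k W] [AddCommGroup X] [Module k X] [Ring H] [HopfAlgebra k H] [Ring K] [HopfAlgebra k K]

theorem IsLeftFaithful.map {v : End k V ⊗[k] H} (hv : IsLeftFaithful v) {q : H →ₐ[k] K}
    (hq : Function.Surjective q)
    (hS : Function.Semiconj q (HopfAlgebra.antipode k) (HopfAlgebra.antipode k)) :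
    IsLeftFaithful (mapRight (End k V) q v) := by
  have h := congrArg (Subalgebra.map q) hv
  rw [AlgHom.map_adjoin, Algebra.map_top, (AlgHom.range_eq_top q).2 hq] at h
  rw [IsLeftFaithful, eq_top_iff, ← h, Set.image_iUnion]
  refine Algebra.adjoin_mono (Set.iUnion_mono fun n => ?_)
  rintro _ ⟨_, ⟨_, ⟨f, rfl⟩, rfl⟩, rfl⟩
  exact ⟨_, ⟨f, rfl⟩, (congrArg _ (coeff_lTensor f q.toLinearMap v)).trans
    ((hS.iterate_right n).eq _).symm⟩

variable {w : End k V ⊗[k] End k W} {v : End k V ⊗[k] H} {π : H →ₐ[k] End k W}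

theorem IsMinimalModel.apply_eq_self (hmin : IsMinimalModel w v π) (f : H →ₐc[k] H)
    (hv : mapRight (End k V) (f : H →ₐ[k] H) v = v) (hπ : π = π.comp (f : H →ₐ[k] H)) (a : H) :
    f a = a := by
  obtain ⟨g, -, hg⟩ := hmin.2 H v π hmin.1.1 hmin.1.2
  have hid : BialgHom.id k H = g :=
    hg _ ⟨DFunLike.congr_fun (Algebra.TensorProduct.map_id (R := k) (S := k)) v, rfl⟩
  exact DFunLike.congr_fun ((hg f ⟨hv, hπ⟩).trans hid.symm) a

theorem IsMinimalModel.injective_of_surjective (hmin : IsMinimalModel w v π) (q : H →ₐc[k] K)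
    (hq : Function.Surjective q)
    (hS : Function.Semiconj q (HopfAlgebra.antipode k) (HopfAlgebra.antipode k))
    (π' : K →ₐ[k] End k W) (hπ : π'.comp (q : H →ₐ[k] K) = π) : Function.Injective q := by
  have hmodel : IsModel w (mapRight (End k V) (q : H →ₐ[k] K) v) π' := by
    refine ⟨hmin.1.1.1.map q, (mapRight_mapRight _ _ _).trans ?_⟩
    rw [hπ, hmin.1.1.2]
  obtain ⟨f, ⟨hfv, hfπ⟩, -⟩ := hmin.2 K _ π' hmodel (hmin.1.2.map hq hS)
  have hfq := hmin.apply_eq_self (f.comp q)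
    (by rw [BialgHom.comp_toAlgHom, ← mapRight_mapRight, hfv])
    (by rw [BialgHom.comp_toAlgHom, ← AlgHom.comp_assoc, ← hfπ, hπ])
  exact Function.LeftInverse.injective (g := f) hfq

theorem IsMinimalModel.eq_zero_of_mem (hmin : IsMinimalModel w v π) (J : Ideal H) [J.IsTwoSided]
    [J.IsHopfIdeal k] (hJ : ∀ a ∈ J, π a = 0) {a : H} (ha : a ∈ J) : a = 0 := by
  have hinj := hmin.injective_of_surjective (Bialgebra.Quotient.mkBialgHom J)
    (Ideal.Quotient.mkₐ_surjective k J) (fun _ => rfl) (Ideal.Quotient.liftₐ J π hJ)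
    (Ideal.Quotient.liftₐ_comp J π hJ)
  exact hinj ((Ideal.Quotient.eq_zero_iff_mem.2 ha).trans (map_zero _).symm)

theorem IsMinimalModel.commute_of_commute_mapRight (hmin : IsMinimalModel w v π)
    {r : End k X ⊗[k] H} (hr : IsCorep r) {T : End k X}
    (hT : Commute (T ⊗ₜ[k] (1 : End k W)) (mapRight (End k X) π r)) :
    Commute (T ⊗ₜ[k] (1 : H)) r := by
  have := isHopfIdeal_coeffIdeal hr T
  refine commute_iff_lie_eq.2 (eq_zero_of_coeff fun f => ?_)
  exact hmin.eq_zero_of_mem _ (fun a ha =>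
    map_eq_zero_of_mem_coeffIdeal π ((mapRight_lie_eq_zero_iff π T r).2 hT) ha)
    (coeff_mem_coeffIdeal f _)

end Minimal

/-! ### The element `u'` and conjugation -/

section Star

variable {k X Y W : Type u} [Field k] [AddCommGroup X] [Module k X] [AddCommGroup Y] [Module k Y]
  [AddCommGroup W] [Module k W]

/-- The analogue of `(⋆)` for the transposition of the second leg: `(id ⊗ t)U⁻¹` is a two-sided
inverse of `(id ⊗ t)U`. Unlike `(⋆)`, it passes to the products `a₁₃ b₂₃`. -/
def TransposeInv (U : (End k X ⊗[k] End k W)ˣ) : Prop :=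
  transposeRight (End k X) U.1 * transposeRight (End k X) U⁻¹.1 = 1 ∧
    transposeRight (End k X) U⁻¹.1 * transposeRight (End k X) U.1 = 1

/-- The contragredient `û = (t ⊗ id)u⁻¹`, with inverse `(t ⊗ id)u`. -/
def hatUnit (u : (End k X ⊗[k] End k W)ˣ) (hu : SatisfiesStar u) :
    (End k (Dual k X) ⊗[k] End k W)ˣ :=
  ⟨transposeLeft (End k W) u⁻¹.1, transposeLeft (End k W) u.1, hu.2, hu.1⟩

theorem SatisfiesStar.transposeInv {u : (End k X ⊗[k] End k W)ˣ} (hu : SatisfiesStar u) :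
    TransposeInv u := by
  constructor <;> refine transposeLeft_injective (X := X) (A := End k (Dual k W)) ?_
  · rw [transposeLeft_transposeRight_mul, hu.2, transposeLeft_one, transposeRight_one]
  · rw [transposeLeft_transposeRight_mul, hu.1, transposeLeft_one, transposeRight_one]

theorem SatisfiesStar.transposeInv_hatUnit {u : (End k X ⊗[k] End k W)ˣ}
    (hu : SatisfiesStar u) : TransposeInv (hatUnit u hu) := by
  constructor <;> refine (transposeRight_transposeLeft_mul _ _).trans ?_
  · rw [Units.mul_inv, transposeRight_one, transposeLeft_one]
  · rw [Units.inv_mul, transposeRight_one, transposeLeft_one]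

theorem transposeInv_one : TransposeInv (1 : (End k X ⊗[k] End k W)ˣ) := by
  rw [TransposeInv, inv_one, Units.val_one, transposeRight_one, mul_one, and_self]

theorem uPrime_one : uPrime (1 : (End k X ⊗[k] End k W)ˣ) = 1 := by
  rw [uPrime, inv_one, Units.val_one, transposeRight_one, map_one, map_one, mul_one]

end Star

section LegUnits

variable {k X Y : Type*} [Field k] [AddCommGroup X] [Module k X] [AddCommGroup Y] [Module k Y]

/-- The product `a₁₃ b₂₃` of invertible elements. -/
def legMulU {A : Type*} [Ring A] [Algebra k A] (a : (End k X ⊗[k] A)ˣ) (b : (End k Y ⊗[k] A)ˣ) :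
    (End k (X ⊗[k] Y) ⊗[k] A)ˣ :=
  Units.map (mapLeft (rTensorAlgHom k X Y) A : _ →* _) a *
    Units.map (mapLeft (lTensorAlgHom k Y X) A : _ →* _) b

theorem coe_legMulU {A : Type*} [Ring A] [Algebra k A] (a : (End k X ⊗[k] A)ˣ)
    (b : (End k Y ⊗[k] A)ˣ) : (legMulU a b).1 = legMul a.1 b.1 :=
  rfl

theorem coe_inv_legMulU {A : Type*} [Ring A] [Algebra k A] (a : (End k X ⊗[k] A)ˣ)
    (b : (End k Y ⊗[k] A)ˣ) :
    (legMulU a b)⁻¹.1 =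
      mapLeft (lTensorAlgHom k Y X) A b⁻¹.1 * mapLeft (rTensorAlgHom k X Y) A a⁻¹.1 := by
  rw [legMulU, mul_inv_rev]
  rfl

end LegUnits

section LegTransposition

variable {k X Y W : Type u} [Field k] [AddCommGroup X] [Module k X] [AddCommGroup Y] [Module k Y]
  [AddCommGroup W] [Module k W]

theorem transposeRight_legMulU (a : (End k X ⊗[k] End k W)ˣ) (b : (End k Y ⊗[k] End k W)ˣ) :
    transposeRight (End k (X ⊗[k] Y)) (legMulU a b).1 =
      mapLeft (lTensorAlgHom k Y X) (End k (Dual k W)) (transposeRight (End k Y) b.1) *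
        mapLeft (rTensorAlgHom k X Y) (End k (Dual k W)) (transposeRight (End k X) a.1) :=
  transposeRight_mul commute_rTensorAlgHom_lTensorAlgHom a.1 b.1

theorem transposeRight_inv_legMulU (a : (End k X ⊗[k] End k W)ˣ) (b : (End k Y ⊗[k] End k W)ˣ) :
    transposeRight (End k (X ⊗[k] Y)) (legMulU a b)⁻¹.1 =
      legMul (A := End k (Dual k W)) (transposeRight (End k X) a⁻¹.1)
        (transposeRight (End k Y) b⁻¹.1) := by
  rw [coe_inv_legMulU]
  exact transposeRight_mul (fun T S => (commute_rTensorAlgHom_lTensorAlgHom S T).symm) b⁻¹.1 a⁻¹.1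

theorem TransposeInv.legMulU {a : (End k X ⊗[k] End k W)ˣ} {b : (End k Y ⊗[k] End k W)ˣ}
    (ha : TransposeInv a) (hb : TransposeInv b) : TransposeInv (legMulU a b) := by
  rw [TransposeInv, transposeRight_legMulU, transposeRight_inv_legMulU]
  constructor
  · rw [mul_assoc, ← mul_assoc (mapLeft (rTensorAlgHom k X Y) _ _), ← map_mul, ha.1, map_one,
      one_mul, ← map_mul, hb.1, map_one]
  · rw [mul_assoc, ← mul_assoc (mapLeft (lTensorAlgHom k Y X) _ _), ← map_mul, hb.2, map_one,
      one_mul, ← map_mul, ha.2, map_one]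

theorem uPrime_legMulU (a : (End k X ⊗[k] End k W)ˣ) (b : (End k Y ⊗[k] End k W)ˣ) :
    uPrime (legMulU a b) = legMul (uPrime a) (uPrime b) := by
  rw [uPrime, transposeRight_inv_legMulU]
  exact mapRight_legMul_mul commute_rTensorAlgHom_lTensorAlgHom a.1 b.1
    (transposeRight (End k X) a⁻¹.1) (transposeRight (End k Y) b⁻¹.1)

end LegTransposition

section Centralizer

variable {k A W : Type*} [Field k] [Ring A] [Algebra k A] [AddCommGroup W] [Module k W]

theorem exists_eq_tmul_one_iff_commute {z : A ⊗[k] End k W} :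
    (∃ S : A, z = S ⊗ₜ[k] 1) ↔ ∀ c : End k W, Commute (1 ⊗ₜ[k] c) z := by
  refine ⟨?_, fun hz => ?_⟩
  · rintro ⟨S, rfl⟩ c
    exact (commute_includeLeft_includeRight S c).symm
  have hcent : z ∈ Subalgebra.centralizer k
      ((includeRight : End k W →ₐ[k] A ⊗[k] End k W).range : Set (A ⊗[k] End k W)) := by
    rw [Subalgebra.mem_centralizer_iff]
    rintro _ ⟨c, rfl⟩
    exact hz c
  rw [Subalgebra.centralizer_range_includeRight_eq_center_tensorProduct,
    Algebra.IsCentral.center_eq_bot] at hcent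
  obtain ⟨y, rfl⟩ := hcent
  clear hz
  induction y with
  | zero => exact ⟨0, by simp⟩
  | add y y' hy hy' =>
    obtain ⟨S, hS⟩ := hy
    obtain ⟨S', hS'⟩ := hy'
    exact ⟨S + S', by rw [TensorProduct.add_tmul, ← hS, ← hS']; exact map_add _ _ _⟩
  | tmul S c =>
    obtain ⟨_, r, rfl⟩ := c
    exact ⟨r • S, by
      rw [TensorProduct.smul_tmul, ← Algebra.algebraMap_eq_smul_one]
      rfl⟩

end Centralizer

section Conjugation

variable {k X Y A : Type u} [Field k] [AddCommGroup X] [Module k X] [AddCommGroup Y] [Module k Y]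
  [Ring A] [Algebra k A]

/-- `U⁻¹(T ⊗ 1)U` belongs to `L(X) ⊗ 1`. -/
def Conjugable (U : (End k X ⊗[k] A)ˣ) (T : End k X) : Prop :=
  ∃ S : End k X, U⁻¹.1 * (T ⊗ₜ[k] 1) * U.1 = S ⊗ₜ[k] 1

theorem inv_legMulU_conj (a : (End k Y ⊗[k] A)ˣ) (U : (End k X ⊗[k] A)ˣ) (T : End k X) :
    (legMulU a U)⁻¹.1 * (lTensorAlgHom k X Y T ⊗ₜ[k] 1) * (legMulU a U).1 =
      mapLeft (lTensorAlgHom k X Y) A (U⁻¹.1 * (T ⊗ₜ[k] 1) * U.1) := by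
  have hc : (lTensorAlgHom k X Y T ⊗ₜ[k] 1) * mapLeft (rTensorAlgHom k Y X) A a.1 =
      mapLeft (rTensorAlgHom k Y X) A a.1 * (lTensorAlgHom k X Y T ⊗ₜ[k] 1) :=
    Obj.commute_legs_right Y X T a.1
  calc _ = mapLeft (lTensorAlgHom k X Y) A U⁻¹.1 *
        mapLeft (rTensorAlgHom k Y X) A (a⁻¹.1 * a.1) * (lTensorAlgHom k X Y T ⊗ₜ[k] 1) *
          mapLeft (lTensorAlgHom k X Y) A U.1 := by
        rw [coe_inv_legMulU, coe_legMulU, legMul, map_mul]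
        simp only [mul_assoc]
        rw [← mul_assoc (lTensorAlgHom k X Y T ⊗ₜ[k] 1), hc, mul_assoc]
    _ = _ := by
        rw [Units.inv_mul, map_one, mul_one, map_mul, map_mul, map_tmul]
        rfl

variable {W : Type u} [AddCommGroup W] [Module k W]

theorem conjugable_iff_commute {U : (End k X ⊗[k] End k W)ˣ} {T : End k X} :
    Conjugable U T ↔ ∀ c : End k W, Commute (1 ⊗ₜ[k] c) (U⁻¹.1 * (T ⊗ₜ[k] 1) * U.1) :=
  exists_eq_tmul_one_iff_commute

theorem conjugable_legMulU_iff [Nontrivial Y] (a : (End k Y ⊗[k] End k W)ˣ)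
    (U : (End k X ⊗[k] End k W)ˣ) (T : End k X) :
    Conjugable (legMulU a U) (lTensorAlgHom k X Y T) ↔ Conjugable U T := by
  have hinj : Function.Injective (mapLeft (lTensorAlgHom k X Y) (End k W)) :=
    Module.Flat.rTensor_preserves_injective_linearMap _ lTensorAlgHom_injective
  simp only [conjugable_iff_commute, inv_legMulU_conj]
  refine forall_congr' fun c => ?_
  have hc : (1 ⊗ₜ[k] c : End k (Y ⊗[k] X) ⊗[k] End k W) =
      mapLeft (lTensorAlgHom k X Y) (End k W) (1 ⊗ₜ[k] c) := by
    rw [map_tmul, map_one, AlgHom.id_apply]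
  rw [hc]
  exact ⟨Commute.of_map hinj, fun h => h.map _⟩

end Conjugation

section UPrime

theorem commute_one_tmul_mapRight {k S A B C : Type*} [Field k] [Ring S] [Algebra k S] [Ring A]
    [Algebra k A] [Ring B] [Algebra k B] [Ring C] [Algebra k C] {f : A →ₐ[k] C} {g : B →ₐ[k] C}
    (h : ∀ a b, Commute (f a) (g b)) (a : A) (z : S ⊗[k] B) :
    Commute (1 ⊗ₜ[k] f a) (mapRight S g z) := by
  induction z with
  | zero => simp
  | add z w hz hw => rw [map_add]; exact hz.add_right hw
  | tmul s b => exact (Commute.one_left s).tmul (h a b)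

theorem transposeRight_tmul_one_mul {k A W : Type u} [Field k] [Ring A] [Algebra k A]
    [AddCommGroup W] [Module k W] (a : A) (z : A ⊗[k] End k W) :
    transposeRight A ((a ⊗ₜ[k] 1) * z) = (a ⊗ₜ[k] 1) * transposeRight A z :=
  lTensor_tmul_one_mul (A := End k W) (B := End k (Dual k W)) _ a z

theorem transposeRight_mul_tmul_one {k A W : Type u} [Field k] [Ring A] [Algebra k A]
    [AddCommGroup W] [Module k W] (z : A ⊗[k] End k W) (a : A) :
    transposeRight A (z * (a ⊗ₜ[k] 1)) = transposeRight A z * (a ⊗ₜ[k] 1) :=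
  lTensor_mul_tmul_one (A := End k W) (B := End k (Dual k W)) _ z a

theorem conj_eq_conj_of_commute_mul {M : Type*} [Monoid M] {a a' b b' t : M} (ha : a' * a = 1)
    (hb : b * b' = 1) (h : Commute t (a * b)) : a' * t * a = b * t * b' :=
  calc a' * t * a = a' * (t * (a * b)) * b' := by simp only [mul_assoc, hb, mul_one]
    _ = a' * a * (b * t * b') := by rw [h.eq]; simp only [mul_assoc]
    _ = b * t * b' := by rw [ha, one_mul]

variable {k X W : Type u} [Field k] [AddCommGroup X] [Module k X] [AddCommGroup W] [Module k W]
  {U : (End k X ⊗[k] End k W)ˣ} {T : End k X}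

-- The assumption says that `U⁻¹(T ⊗ 1)U`, acting on `W`, agrees with an element acting on `W*`.
theorem Conjugable.of_commute_uPrime [Nontrivial W] (hU : TransposeInv U)
    (h : Commute (T ⊗ₜ[k] 1) (uPrime U)) : Conjugable U T := by
  have hinj : Function.Injective (mapRight (End k X) (rTensorAlgHom k W (Dual k W))) :=
    Module.Flat.lTensor_preserves_injective_linearMap _ rTensorAlgHom_injective
  have hconj := conj_eq_conj_of_commute_mul
    (a' := mapRight (End k X) (rTensorAlgHom k W (Dual k W)) U⁻¹.1)
    (b' := mapRight (A := End k (Dual k W)) (End k X) (lTensorAlgHom k (Dual k W) W)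
      (transposeRight (End k X) U.1))
    (by rw [← map_mul, Units.inv_mul, map_one]) (by rw [← map_mul, hU.2, map_one]) h
  have hT : ∀ {B : Type u} [Ring B] [Algebra k B] (f : B →ₐ[k] End k (W ⊗[k] Dual k W)),
      T ⊗ₜ[k] 1 = mapRight (End k X) f (T ⊗ₜ[k] 1) := fun f => by
    rw [map_tmul, map_one, AlgHom.id_apply]
  refine conjugable_iff_commute.2 fun c => Commute.of_map hinj ?_
  rw [map_mul, map_mul, ← hT, hconj, hT (B := End k (Dual k W)) (lTensorAlgHom k (Dual k W) W),
    ← map_mul, ← map_mul, map_tmul]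
  exact commute_one_tmul_mapRight commute_rTensorAlgHom_lTensorAlgHom _ _

theorem Conjugable.commute_uPrime (h : Conjugable U T) : Commute (T ⊗ₜ[k] 1) (uPrime U) := by
  obtain ⟨S, hS⟩ := h
  have hU : (T ⊗ₜ[k] 1) * U.1 = U.1 * (S ⊗ₜ[k] 1) := by
    rw [← hS, ← mul_assoc, ← mul_assoc, Units.mul_inv, one_mul]
  have hUinv : U⁻¹.1 * (T ⊗ₜ[k] 1) = (S ⊗ₜ[k] 1) * U⁻¹.1 := by
    rw [← hS, mul_assoc, Units.mul_inv, mul_one]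
  have hU' : SemiconjBy (mapRight (End k X) (rTensorAlgHom k W (Dual k W)) U.1)
      (S ⊗ₜ[k] 1) (T ⊗ₜ[k] 1) := by
    have := congrArg (mapRight (End k X) (rTensorAlgHom k W (Dual k W))) hU
    rw [map_mul, map_mul, map_tmul, map_tmul, map_one] at this
    exact this.symm
  have hUinv' : SemiconjBy (mapRight (A := End k (Dual k W)) (End k X)
      (lTensorAlgHom k (Dual k W) W) (transposeRight (End k X) U⁻¹.1))
      (T ⊗ₜ[k] 1) (S ⊗ₜ[k] 1) := by
    have h := congrArg (transposeRight (End k X)) hUinv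
    rw [transposeRight_mul_tmul_one, transposeRight_tmul_one_mul] at h
    have := congrArg (mapRight (A := End k (Dual k W)) (End k X) (lTensorAlgHom k (Dual k W) W)) h
    rw [map_mul, map_mul, map_tmul, map_tmul, map_one] at this
    exact this
  exact (hU'.mul_left hUinv').symm

theorem commute_uPrime_iff [Nontrivial W] (hU : TransposeInv U) :
    Commute (T ⊗ₜ[k] 1) (uPrime U) ↔ Conjugable U T :=
  ⟨Conjugable.of_commute_uPrime hU, Conjugable.commute_uPrime⟩

end UPrime

open Obj (alt word nextIndex wordSnoc addRight addLeft)

/-! ### Alternating words -/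

section Words

variable {k A : Type u} [Field k] [Ring A] [Algebra k A] (x y : Obj k A)

instance finiteDimensional_alt (x y : Obj k A) [FiniteDimensional k x.X] [FiniteDimensional k y.X] :
    (j : ℕ) → FiniteDimensional k (alt x y j).X
  | 0 => ‹FiniteDimensional k x.X›
  | j + 1 => finiteDimensional_alt y x j

instance nontrivial_alt (x y : Obj k A) [Nontrivial x.X] [Nontrivial y.X] :
    (j : ℕ) → Nontrivial (alt x y j).X
  | 0 => ‹Nontrivial x.X›
  | j + 1 => nontrivial_alt y x j

theorem finrank_alt {x y : Obj k A} {d : ℕ} (hx : finrank k x.X = d) (hy : finrank k y.X = d) :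
    (j : ℕ) → finrank k (alt x y j).X = d
  | 0 => hx
  | j + 1 => finrank_alt hy hx j

instance finiteDimensional_word [FiniteDimensional k x.X] [FiniteDimensional k y.X] :
    (j m : ℕ) → FiniteDimensional k (word x y j m).X
  | _, 0 => inferInstanceAs (FiniteDimensional k k)
  | j, m + 1 =>
    have := finiteDimensional_word (j + 1) m
    inferInstanceAs (FiniteDimensional k ((alt x y j).X ⊗[k] (word x y (j + 1) m).X))

instance nontrivial_word [Nontrivial x.X] [Nontrivial y.X] :
    (j m : ℕ) → Nontrivial (word x y j m).X
  | _, 0 => inferInstanceAs (Nontrivial k)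
  | j, m + 1 =>
    have := nontrivial_word (j + 1) m
    inferInstanceAs (Nontrivial ((alt x y j).X ⊗[k] (word x y (j + 1) m).X))

theorem finrank_word {x y : Obj k A} {d : ℕ} (hx : finrank k x.X = d) (hy : finrank k y.X = d)
    (j m : ℕ) : finrank k (word x y j m).X = d ^ m := by
  induction m generalizing j with
  | zero => exact Module.finrank_self k
  | succ m ih =>
    refine (Module.finrank_tensorProduct (R := k) (S := k) (M := (alt x y j).X)
      (M' := (word x y (j + 1) m).X)).trans ?_
    rw [ih, finrank_alt hx hy, pow_succ']

/-- The tensor product of an operator on the first factor of a word with an operator on the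
remaining ones. -/
def wordMap (j m : ℕ) (S : End k (alt x y j).X) (T : End k (word x y (j + 1) m).X) :
    End k (word x y j (m + 1)).X :=
  TensorProduct.map S T

/-- `T ↦ T ⊗ id`, from operators on the first tensor factor of a word. -/
def onFirst (j m : ℕ) : End k (alt x y j).X →ₐ[k] End k (word x y j (m + 1)).X :=
  rTensorAlgHom k (alt x y j).X (word x y (j + 1) m).X

/-- `T ↦ id ⊗ T`, from operators on the last tensor factor of a word. -/
def onLast (j m : ℕ) : End k (alt x y (nextIndex j m)).X →ₐ[k] End k (word x y j (m + 1)).X :=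
  ((wordSnoc x y j m).conjAlgEquiv k : _ →ₐ[k] _).comp
    (lTensorAlgHom k (alt x y (nextIndex j m)).X (word x y j m).X)

theorem addRight_wordSnoc (j m : ℕ) (T : End k (word x y j m).X) (b : (word x y j m).X)
    (c : (alt x y (nextIndex j m)).X) :
    addRight x y j m T (wordSnoc x y j m (b ⊗ₜ[k] c)) = wordSnoc x y j m (T b ⊗ₜ[k] c) := by
  change wordSnoc x y j m (rTensorAlgHom k _ _ T
    ((wordSnoc x y j m).symm (wordSnoc x y j m (b ⊗ₜ[k] c)))) = _
  rw [LinearEquiv.symm_apply_apply]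
  rfl

theorem onLast_wordSnoc (j m : ℕ) (T : End k (alt x y (nextIndex j m)).X)
    (b : (word x y j m).X) (c : (alt x y (nextIndex j m)).X) :
    onLast x y j m T (wordSnoc x y j m (b ⊗ₜ[k] c)) = wordSnoc x y j m (b ⊗ₜ[k] T c) := by
  change wordSnoc x y j m (lTensorAlgHom k _ _ T
    ((wordSnoc x y j m).symm (wordSnoc x y j m (b ⊗ₜ[k] c)))) = _
  rw [LinearEquiv.symm_apply_apply]
  rfl

theorem addRight_wordMap (j m : ℕ) (S : End k (alt x y j).X) (T : End k (word x y (j + 1) m).X) :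
    addRight x y j (m + 1) (wordMap x y j m S T) =
      wordMap x y j (m + 1) S (addRight x y (j + 1) m T) := by
  refine Obj.conj_eq _ _ _ (TensorProduct.ext_threefold fun a b c => ?_)
  exact congrArg (fun z => S a ⊗ₜ[k] z) (addRight_wordSnoc x y (j + 1) m T b c).symm

theorem addRight_addLeft (j m : ℕ) (T : End k (word x y (j + 1) m).X) :
    addRight x y j (m + 1) (addLeft x y j m T) =
      addLeft x y j (m + 1) (addRight x y (j + 1) m T) :=
  addRight_wordMap x y j m 1 T

theorem addRight_onFirst (j m : ℕ) (T : End k (alt x y j).X) :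
    addRight x y j (m + 1) (onFirst x y j m T) = onFirst x y j (m + 1) T :=
  (addRight_wordMap x y j m T 1).trans (by rw [map_one]; rfl)

theorem addLeft_onLast (j m : ℕ) (T : End k (alt x y (nextIndex (j + 1) m)).X) :
    addLeft x y j (m + 1) (onLast x y (j + 1) m T) = onLast x y j (m + 1) T := by
  refine (Obj.conj_eq _ _ _ (TensorProduct.ext_threefold fun a b c => ?_)).symm
  exact congrArg (fun z => a ⊗ₜ[k] z) (onLast_wordSnoc x y (j + 1) m T b c).symm

theorem conj_lid_rid {Z : Type*} [AddCommGroup Z] [Module k Z] (T : End k Z) :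
    ((TensorProduct.lid k Z).trans (TensorProduct.rid k Z).symm).conjAlgEquiv k
      (lTensorAlgHom k Z k T) = rTensorAlgHom k Z k T := by
  ext a
  change (TensorProduct.rid k Z).symm (TensorProduct.lid k Z (lTensorAlgHom k Z k T
    ((TensorProduct.lid k Z).symm (TensorProduct.rid k Z (a ⊗ₜ[k] (1 : k)))))) = T a ⊗ₜ[k] 1
  rw [TensorProduct.rid_tmul, one_smul, TensorProduct.lid_symm_apply]
  change (TensorProduct.rid k Z).symm (TensorProduct.lid k Z (1 ⊗ₜ[k] T a)) = _
  rw [TensorProduct.lid_tmul, one_smul, TensorProduct.rid_symm_apply]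

theorem onLast_zero (j : ℕ) (T : End k (alt x y j).X) : onLast x y j 0 T = onFirst x y j 0 T :=
  conj_lid_rid T

theorem addLeft_injective [Nontrivial x.X] [Nontrivial y.X] (j m : ℕ) :
    Function.Injective (addLeft x y j m) :=
  lTensorAlgHom_injective (X := (alt x y j).X)

/-- The iterated inclusion `T ↦ id ⊗ T`, from the words that start at `j` to those that start at
`0`. -/
def emb : (j m i : ℕ) → j + m = i → (End k (word x y j m).X →ₐ[k] End k (word x y 0 i).X)
  | 0, m, i, h => (by
      obtain rfl : m = i := by omega
      exact AlgHom.id k _)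
  | j + 1, m, i, h => (emb j (m + 1) i (by omega)).comp (addLeft x y j m)

theorem emb_succ (j m i : ℕ) (h : j + 1 + m = i) (h' : j + (m + 1) = i)
    (T : End k (word x y (j + 1) m).X) :
    emb x y (j + 1) m i h T = emb x y j (m + 1) i h' (addLeft x y j m T) :=
  rfl

theorem emb_addRight (j m i : ℕ) (h : j + m = i) (h' : j + (m + 1) = i + 1)
    (T : End k (word x y j m).X) :
    emb x y j (m + 1) (i + 1) h' (addRight x y j m T) = addRight x y 0 i (emb x y j m i h T) := by
  induction j generalizing m with
  | zero =>
    obtain rfl : m = i := by omega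
    rfl
  | succ j ih =>
    rw [emb_succ x y j m i h (by omega), ← ih (m + 1) (by omega) (by omega), addRight_addLeft]
    rfl

theorem emb_injective [Nontrivial x.X] [Nontrivial y.X] (j m i : ℕ) (h : j + m = i) :
    Function.Injective (emb x y j m i h) := by
  induction j generalizing m with
  | zero =>
    obtain rfl : m = i := by omega
    exact Function.injective_id
  | succ j ih => exact (ih (m + 1) (by omega)).comp (addLeft_injective x y j m)

end Words

section WordUnits

variable {k A R : Type u} [Field k] [Ring A] [Algebra k A] [Ring R] [Algebra k R]

/-- The alternating sequence `a, b, a, b, …`, over the alternating sequence of spaces. -/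
def altU : (x y : Obj k A) → (End k x.X ⊗[k] R)ˣ → (End k y.X ⊗[k] R)ˣ → (j : ℕ) →
    (End k (alt x y j).X ⊗[k] R)ˣ
  | _, _, a, _, 0 => a
  | x, y, a, b, j + 1 => altU y x b a j

variable (x y : Obj k A)

/-- The alternating product `a ⊗ b ⊗ a ⊗ ⋯`, over the spaces of the words in `x` and `y`. -/
def wordU (a : (End k x.X ⊗[k] R)ˣ) (b : (End k y.X ⊗[k] R)ˣ) :
    (j m : ℕ) → (End k (word x y j m).X ⊗[k] R)ˣ
  | _, 0 => 1
  | j, m + 1 => legMulU (altU x y a b j) (wordU a b (j + 1) m)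

theorem coe_wordU_succ (a : (End k x.X ⊗[k] R)ˣ) (b : (End k y.X ⊗[k] R)ˣ) (j m : ℕ) :
    (wordU x y a b j (m + 1)).1 =
      mapLeft (onFirst x y j m) R (altU x y a b j).1 *
        mapLeft (addLeft x y j m) R (wordU x y a b (j + 1) m).1 :=
  rfl

theorem coe_wordU_snoc (a : (End k x.X ⊗[k] R)ˣ) (b : (End k y.X ⊗[k] R)ˣ) (j m : ℕ) :
    (wordU x y a b j (m + 1)).1 =
      mapLeft (addRight x y j m) R (wordU x y a b j m).1 *
        mapLeft (onLast x y j m) R (altU x y a b (nextIndex j m)).1 := by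
  induction m generalizing j with
  | zero =>
    rw [coe_wordU_succ, wordU, wordU, Units.val_one, Units.val_one, map_one, map_one, mul_one,
      one_mul]
    exact Obj.map_eq_map_of _ _ (fun T => (onLast_zero x y j T).symm) _
  | succ m ih =>
    rw [coe_wordU_succ, ih, coe_wordU_succ, map_mul, map_mul, Obj.map_map_apply,
      Obj.map_map_apply, Obj.map_map_apply, Obj.map_map_apply, mul_assoc]
    congr 1
    · exact Obj.map_eq_map_of _ _ (fun T => (addRight_onFirst x y j m T).symm) _
    · congr 1
      · exact Obj.map_eq_map_of _ _ (fun T => (addRight_addLeft x y j m T).symm) _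
      · exact Obj.map_eq_map_of _ _ (fun T => addLeft_onLast x y j m T) _

variable {W : Type u} [AddCommGroup W] [Module k W]

theorem conjugable_emb_iff [Nontrivial x.X] [Nontrivial y.X] (a : (End k x.X ⊗[k] End k W)ˣ)
    (b : (End k y.X ⊗[k] End k W)ˣ) (j m i : ℕ) (h : j + m = i) (T : End k (word x y j m).X) :
    Conjugable (wordU x y a b 0 i) (emb x y j m i h T) ↔ Conjugable (wordU x y a b j m) T := by
  induction j generalizing m with
  | zero =>
    obtain rfl : m = i := by omega
    rfl
  | succ j ih =>
    rw [emb_succ x y j m i h (by omega), ih]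
    exact conjugable_legMulU_iff _ _ T

variable {x y} {a : (End k x.X ⊗[k] End k W)ˣ} {b : (End k y.X ⊗[k] End k W)ˣ}

theorem transposeInv_altU {x y : Obj k A} {a : (End k x.X ⊗[k] End k W)ˣ}
    {b : (End k y.X ⊗[k] End k W)ˣ} (ha : TransposeInv a) (hb : TransposeInv b) :
    (j : ℕ) → TransposeInv (altU x y a b j)
  | 0 => ha
  | j + 1 => transposeInv_altU hb ha j

theorem transposeInv_wordU (ha : TransposeInv a) (hb : TransposeInv b) (j m : ℕ) :
    TransposeInv (wordU x y a b j m) := by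
  induction m generalizing j with
  | zero => exact transposeInv_one
  | succ m ih => exact (transposeInv_altU ha hb j).legMulU (ih (j + 1))

theorem mapRight_alt {π : A →ₐ[k] End k (W ⊗[k] Dual k W)} {x y : Obj k A}
    {a : (End k x.X ⊗[k] End k W)ˣ} {b : (End k y.X ⊗[k] End k W)ˣ}
    (ha : mapRight (End k x.X) π x.el = uPrime a) (hb : mapRight (End k y.X) π y.el = uPrime b) :
    (j : ℕ) → mapRight (End k (alt x y j).X) π (alt x y j).el = uPrime (altU x y a b j)
  | 0 => ha
  | j + 1 => mapRight_alt hb ha j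

theorem mapRight_word {π : A →ₐ[k] End k (W ⊗[k] Dual k W)}
    (ha : mapRight (End k x.X) π x.el = uPrime a) (hb : mapRight (End k y.X) π y.el = uPrime b)
    (j m : ℕ) :
    mapRight (End k (word x y j m).X) π (word x y j m).el = uPrime (wordU x y a b j m) := by
  induction m generalizing j with
  | zero => exact (map_one _).trans uPrime_one.symm
  | succ m ih =>
    refine Eq.trans ?_ (uPrime_legMulU (altU x y a b j) (wordU x y a b (j + 1) m)).symm
    rw [← ih, ← mapRight_alt ha hb]
    exact mapRight_legMul π (alt x y j).el (word x y (j + 1) m).el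

end WordUnits

section Models

variable {k V W H : Type u} [Field k] [AddCommGroup V] [Module k V] [AddCommGroup W] [Module k W]

theorem transposeLeft_transposeRight (z : End k V ⊗[k] End k W) :
    transposeLeft (End k (Dual k W)) (transposeRight (End k V) z) =
      transposeRight (End k (Dual k V)) (transposeLeft (End k W) z) := by
  induction z with
  | zero => simp
  | add a b ha hb => simp only [map_add, ha, hb]
  | tmul S r => rfl

/-- The inverse `((id ⊗ t)u)₁₃ (u⁻¹)₁₂` of `u'`. -/
def uPrimeInv (u : (End k V ⊗[k] End k W)ˣ) : End k V ⊗[k] End k (W ⊗[k] Dual k W) :=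
  mapRight (A := End k (Dual k W)) (End k V) (lTensorAlgHom k (Dual k W) W)
      (transposeRight (End k V) u.1) *
    mapRight (End k V) (rTensorAlgHom k W (Dual k W)) u⁻¹.1

theorem uPrime_mul_uPrimeInv {u : (End k V ⊗[k] End k W)ˣ} (hu : TransposeInv u) :
    uPrime u * uPrimeInv u = 1 := by
  have h := congrArg (mapRight (A := End k (Dual k W)) (End k V)
    (lTensorAlgHom k (Dual k W) W)) hu.2
  have h' := congrArg (mapRight (End k V) (rTensorAlgHom k W (Dual k W))) u.mul_inv
  rw [map_mul, map_one] at h h'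
  rw [uPrime, uPrimeInv, mul_assoc]
  refine (congrArg (mapRight (End k V) (rTensorAlgHom k W (Dual k W)) u.1 * ·) ?_).trans h'
  exact (mul_assoc _ _ _).symm.trans ((congrArg (· * _) h).trans (one_mul _))

theorem transposeLeft_uPrimeInv (u : (End k V ⊗[k] End k W)ˣ) (hu : SatisfiesStar u) :
    transposeLeft (End k (W ⊗[k] Dual k W)) (uPrimeInv u) = uPrime (hatUnit u hu) := by
  have hcomm (b : End k (Dual k W)) (c : End k W) :
      Commute (lTensorAlgHom k (Dual k W) W b) (rTensorAlgHom k W (Dual k W) c) :=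
    TensorProduct.ext' fun _ _ => rfl
  have h := transposeLeft_mul (A := End k (Dual k W)) (B := End k W)
    (C := End k (W ⊗[k] Dual k W)) (f := lTensorAlgHom k (Dual k W) W)
    (g := rTensorAlgHom k W (Dual k W)) hcomm (transposeRight (End k V) u.1) u⁻¹.1
  exact h.trans (congrArg _ (congrArg _ (transposeLeft_transposeRight u.1)))

variable [Ring H] [HopfAlgebra k H] {u : (End k V ⊗[k] End k W)ˣ}
  {v : End k V ⊗[k] H} {π : H →ₐ[k] End k (W ⊗[k] Dual k W)}

theorem mapRight_contragredient (hv : IsCorep v) (hu : SatisfiesStar u)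
    (hπ : mapRight (End k V) π v = uPrime u) :
    mapRight (End k (Dual k V)) π (contragredient v) = uPrime (hatUnit u hu) := by
  rw [contragredient_eq_transposeLeft, mapRight_transposeLeft, ← transposeLeft_uPrimeInv]
  refine congrArg _ (left_inv_eq_right_inv ?_ (uPrime_mul_uPrimeInv hu.transposeInv))
  rw [← hπ, ← map_mul, hv.antipodeRight_mul, map_one]

theorem mem_latticeEnd_iff [Nontrivial W] (hu : SatisfiesStar u)
    (hmin : IsMinimalModel (uPrime u) v π) (j m : ℕ) (T : End k (word (vObj v) (vHatObj v) j m).X) :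
    T ∈ latticeEnd v j m ↔ Conjugable (wordU (vObj v) (vHatObj v) u (hatUnit u hu) j m) T := by
  have hv : IsCorep v := hmin.1.1.1
  have hword := mapRight_word (x := vObj v) (y := vHatObj v) hmin.1.1.2
    (mapRight_contragredient hv hu hmin.1.1.2) j m
  rw [Obj.mem_endAlg, ← commute_uPrime_iff (transposeInv_wordU (x := vObj v) (y := vHatObj v)
    hu.transposeInv hu.transposeInv_hatUnit j m), ← hword]
  refine ⟨fun h => ?_, hmin.commute_of_commute_mapRight
    (IsCorep.word (x := vObj v) (y := vHatObj v) hv hv.contragredient j m)⟩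
  have h' := congrArg (mapRight (End k (word (vObj v) (vHatObj v) j m).X) π) h
  rwa [map_mul, map_mul, map_tmul, map_one] at h'

end Models

/-! ### Dualities between consecutive factors -/

section DualPair

variable {k Z Z' : Type*} [Field k] [AddCommGroup Z] [Module k Z] [AddCommGroup Z'] [Module k Z']

variable (k Z Z') in
/-- A duality between `Z` and `Z'`, given by its coevaluation `k → Z ⊗ Z'` (through the image of
`1`) and its evaluation `Z ⊗ Z' → k`. Of the usual axioms only the two trace identities are kept. -/
@[ext]
structure DualPair where
  coev : Z ⊗[k] Z'
  ev : Z ⊗[k] Z' →ₗ[k] k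
  ev_rTensor : ∀ T : End k Z, ev (LinearMap.rTensor Z' T coev) = LinearMap.trace k Z T
  ev_lTensor : ∀ T : End k Z', ev (LinearMap.lTensor Z T coev) = LinearMap.trace k Z' T

namespace DualPair

/-- The opposite duality. -/
def symm (D : DualPair k Z Z') : DualPair k Z' Z where
  coev := TensorProduct.comm k Z Z' D.coev
  ev := D.ev ∘ₗ (TensorProduct.comm k Z' Z).toLinearMap
  ev_rTensor T := (congrArg D.ev (LinearMap.congr_fun
    (LinearMap.comm_comp_rTensor_comp_comm_eq T) D.coev)).trans (D.ev_lTensor T)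
  ev_lTensor T := (congrArg D.ev (LinearMap.congr_fun
    (LinearMap.comm_comp_lTensor_comp_comm_eq T) D.coev)).trans (D.ev_rTensor T)

theorem symm_symm (D : DualPair k Z Z') : D.symm.symm = D :=
  DualPair.ext ((TensorProduct.comm k Z Z').symm_apply_apply D.coev)
    (TensorProduct.ext' fun _ _ => rfl)

/-- The rank one operator `coev ∘ ev`. -/
def cupCap (D : DualPair k Z Z') : End k (Z ⊗[k] Z') :=
  D.ev.smulRight D.coev

variable (k Z) in
/-- The canonical duality between a finite dimensional space and its dual. -/
def canonical [FiniteDimensional k Z] : DualPair k Z (Dual k Z) where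
  coev := coevaluation k Z 1
  ev := contractRight k Z
  ev_rTensor T := by
    classical
    rw [coevaluation_apply_one, LinearMap.trace_eq_matrix_trace k (Module.Basis.ofVectorSpace k Z)]
    simp [Matrix.trace, LinearMap.toMatrix_apply]
  ev_lTensor T := by
    classical
    rw [coevaluation_apply_one, LinearMap.trace_eq_matrix_trace k
      (Module.Basis.ofVectorSpace k Z).dualBasis]
    simp [Matrix.trace, LinearMap.toMatrix_apply]

theorem ev_map_rid (D : DualPair k Z Z') (T : End k Z) (c : k) :
    D.ev (LinearMap.lTensor Z (TensorProduct.rid k Z').toLinearMap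
      (TensorProduct.map T (algebraMap k (End k (Z' ⊗[k] k)) c)
        (LinearMap.lTensor Z (TensorProduct.rid k Z').symm.toLinearMap D.coev))) =
      LinearMap.trace k Z T * c := by
  rw [← D.ev_rTensor]
  generalize D.coev = z
  induction z with
  | zero => simp
  | add a b ha hb => simp only [map_add, ha, hb, add_mul]
  | tmul a b => simp [mul_comm]

end DualPair

theorem exists_eq_algebraMap (T : End k k) : ∃ c : k, T = algebraMap k (End k k) c :=
  ⟨T 1, by ext; simp⟩

theorem trace_algebraMap_self (c : k) : LinearMap.trace k k (algebraMap k (End k k) c) = c := by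
  rw [Algebra.algebraMap_eq_smul_one, map_smul, LinearMap.trace_one, Module.finrank_self,
    Nat.cast_one, smul_eq_mul, mul_one]

theorem trace_end_self (T : End k k) : LinearMap.trace k k T = T 1 := by
  obtain ⟨c, rfl⟩ := exists_eq_algebraMap T
  rw [trace_algebraMap_self, Module.algebraMap_end_apply, smul_eq_mul, mul_one]

theorem end_tensor_induction [FiniteDimensional k Z] [FiniteDimensional k Z']
    {P : End k (Z ⊗[k] Z') → Prop} (add : ∀ S T, P S → P T → P (S + T))
    (map : ∀ (S : End k Z) (T : End k Z'), P (TensorProduct.map S T)) (T : End k (Z ⊗[k] Z')) :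
    P T := by
  obtain ⟨z, rfl⟩ := (homTensorHomEquiv k Z Z' Z Z').surjective T
  induction z with
  | zero => simpa using map 0 0
  | add a b ha hb => rw [map_add]; exact add _ _ ha hb
  | tmul S T => simpa using map S T

end DualPair

section WordDuality

variable {k A : Type u} [Field k] [Ring A] [Algebra k A]

/-- The alternating sequence of dualities between consecutive tensor factors. -/
def altPair : (x y : Obj k A) → DualPair k x.X y.X → (j : ℕ) →
    DualPair k (alt x y j).X (alt x y (j + 1)).X
  | _, _, D, 0 => D
  | x, y, D, j + 1 => altPair y x D.symm j

variable (x y : Obj k A) (D : DualPair k x.X y.X)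

/-- The coevaluation `id ⊗ coev` onto the last two tensor factors of a word. -/
def wordCoev : (j m : ℕ) → (word x y j m).X →ₗ[k] (word x y j (m + 2)).X
  | j, 0 => LinearMap.toSpanSingleton k ((alt x y j).X ⊗[k] ((alt x y (j + 1)).X ⊗[k] k))
      (LinearMap.lTensor (alt x y j).X
        (TensorProduct.rid k (alt x y (j + 1)).X).symm.toLinearMap (altPair x y D j).coev)
  | j, m + 1 => LinearMap.lTensor (alt x y j).X (wordCoev (j + 1) m)

/-- The evaluation `id ⊗ ev` of the last two tensor factors of a word. -/
def wordEv : (j m : ℕ) → (word x y j (m + 2)).X →ₗ[k] (word x y j m).X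
  | j, 0 => (altPair x y D j).ev ∘ₗ LinearMap.lTensor (alt x y j).X
        (TensorProduct.rid k (alt x y (j + 1)).X).toLinearMap
  | j, m + 1 => LinearMap.lTensor (alt x y j).X (wordEv (j + 1) m)

theorem exists_eq_algebraMap_word_zero (j : ℕ) (T : End k (word x y j 0).X) :
    ∃ c : k, T = algebraMap k (End k (word x y j 0).X) c :=
  exists_eq_algebraMap (T : End k k)

theorem trace_wordEv_wordMap_zero_wordCoev (j : ℕ) (S : End k (alt x y j).X) (c : k) :
    LinearMap.trace k (word x y j 0).X (wordEv x y D j 0 ∘ₗ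
        wordMap x y j 1 S (algebraMap k (End k (word x y (j + 1) 1).X) c) ∘ₗ wordCoev x y D j 0) =
      LinearMap.trace k (alt x y j).X S * c := by
  refine (trace_end_self (k := k) (wordEv x y D j 0 ∘ₗ
    wordMap x y j 1 S (algebraMap k (End k (word x y (j + 1) 1).X) c) ∘ₗ
      wordCoev x y D j 0)).trans ?_
  rw [← (altPair x y D j).ev_map_rid S c]
  exact congrArg (wordEv x y D j 0 ∘ₗ
    wordMap x y j 1 S (algebraMap k (End k (word x y (j + 1) 1).X) c)) (one_smul k _)

section FiniteDimensional

variable [FiniteDimensional k x.X] [FiniteDimensional k y.X]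

variable {x y} in
theorem end_word_induction {j m : ℕ} {P : End k (word x y j (m + 1)).X → Prop}
    (add : ∀ S T, P S → P T → P (S + T)) (wordMap : ∀ S T, P (wordMap x y j m S T))
    (T : End k (word x y j (m + 1)).X) : P T :=
  end_tensor_induction (Z := (alt x y j).X) (Z' := (word x y (j + 1) m).X) add wordMap T

theorem trace_wordMap (j m : ℕ) (S : End k (alt x y j).X) (T : End k (word x y (j + 1) m).X) :
    LinearMap.trace k _ (wordMap x y j m S T) = LinearMap.trace k _ S * LinearMap.trace k _ T :=
  LinearMap.trace_tensorProduct' S T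

variable {x y} in
theorem trace_addRight {d : ℕ} (hx : finrank k x.X = d) (hy : finrank k y.X = d) (j m : ℕ)
    (T : End k (word x y j m).X) :
    LinearMap.trace k _ (addRight x y j m T) = d * LinearMap.trace k _ T := by
  refine (LinearMap.trace_conj' (rTensorAlgHom k _ _ T) (wordSnoc x y j m)).trans ?_
  refine (LinearMap.trace_tensorProduct' T LinearMap.id).trans ?_
  rw [LinearMap.trace_id, finrank_alt hx hy, mul_comm]

theorem addRight_addRight_comp_wordCoev (j m : ℕ) (T : End k (word x y j m).X) :
    addRight x y j (m + 1) (addRight x y j m T) ∘ₗ wordCoev x y D j m =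
      wordCoev x y D j m ∘ₗ T := by
  induction m generalizing j with
  | zero =>
    obtain ⟨c, rfl⟩ := exists_eq_algebraMap_word_zero x y j T
    rw [AlgHom.commutes, AlgHom.commutes]
    exact LinearMap.ext fun z => (map_smul (wordCoev x y D j 0) c z).symm
  | succ m ih =>
    induction T using end_word_induction with
    | add S T hS hT => rw [map_add, map_add, LinearMap.add_comp, hS, hT, LinearMap.comp_add]
    | wordMap S T =>
      rw [addRight_wordMap, addRight_wordMap]
      refine TensorProduct.ext' fun a b => ?_
      exact congrArg (fun z => S a ⊗ₜ[k] z) (LinearMap.congr_fun (ih (j + 1) T) b)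

theorem trace_wordEv_addRight_wordCoev (j m : ℕ) (T : End k (word x y j (m + 1)).X) :
    LinearMap.trace k _ (wordEv x y D j m ∘ₗ addRight x y j (m + 1) T ∘ₗ wordCoev x y D j m) =
      LinearMap.trace k _ T := by
  induction m generalizing j with
  | zero =>
    induction T using end_word_induction with
    | add S T hS hT =>
      rw [map_add, LinearMap.add_comp, LinearMap.comp_add, map_add, map_add, hS, hT]
    | wordMap S T =>
      obtain ⟨c, rfl⟩ := exists_eq_algebraMap_word_zero x y (j + 1) T
      rw [addRight_wordMap, trace_wordMap, AlgHom.commutes, trace_wordEv_wordMap_zero_wordCoev]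
      exact congrArg (_ * ·) (trace_algebraMap_self c).symm
  | succ m ih =>
    induction T using end_word_induction with
    | add S T hS hT =>
      rw [map_add, LinearMap.add_comp, LinearMap.comp_add, map_add, map_add, hS, hT]
    | wordMap S T =>
      have h : wordEv x y D j (m + 1) ∘ₗ
          wordMap x y j (m + 2) S (addRight x y (j + 1) (m + 1) T) ∘ₗ wordCoev x y D j (m + 1) =
          wordMap x y j m S (wordEv x y D (j + 1) m ∘ₗ
            addRight x y (j + 1) (m + 1) T ∘ₗ wordCoev x y D (j + 1) m) :=
        TensorProduct.ext' fun a b => rfl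
      rw [addRight_wordMap, h, trace_wordMap, ih, trace_wordMap]

end FiniteDimensional

section Commute

variable {R : Type u} [Ring R] [Algebra k R]

theorem commute_altPair {x y : Obj k A} {D : DualPair k x.X y.X} {a : (End k x.X ⊗[k] R)ˣ}
    {b : (End k y.X ⊗[k] R)ˣ} (h : Commute (D.cupCap ⊗ₜ[k] 1) (legMul a.1 b.1))
    (h' : Commute (D.symm.cupCap ⊗ₜ[k] 1) (legMul b.1 a.1)) (j : ℕ) :
    Commute ((altPair x y D j).cupCap ⊗ₜ[k] 1)
      (legMul (altU x y a b j).1 (altU x y a b (j + 1)).1) := by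
  induction j generalizing x y with
  | zero => exact h
  | succ _ ih => exact ih h' (by rwa [DualPair.symm_symm])

/-- `Z ⊗ Z' ≃ Z ⊗ (Z' ⊗ k)`; a word of length two is built as the right hand side. -/
def addUnit (k Z Z' : Type*) [Field k] [AddCommGroup Z] [Module k Z] [AddCommGroup Z']
    [Module k Z'] : Z ⊗[k] Z' ≃ₗ[k] Z ⊗[k] (Z' ⊗[k] k) :=
  (TensorProduct.rid k Z').symm.lTensor Z

theorem cj_addUnit {Z Z' : Type u} [AddCommGroup Z] [Module k Z] [AddCommGroup Z'] [Module k Z']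
    (a : End k Z ⊗[k] R) (b : End k Z' ⊗[k] R) :
    Obj.cj (addUnit k Z Z') (legMul a b) = legMul a (legMul b (1 : End k k ⊗[k] R)) := by
  simp only [legMul, map_mul, Obj.map_map_apply, map_one, mul_one]
  congr 1
  · refine Obj.map_eq_map_of _ _ (fun T => Obj.conj_eq _ _ _ ?_) _
    ext a b
    rfl
  · refine Obj.map_eq_map_of _ _ (fun T => Obj.conj_eq _ _ _ ?_) _
    ext a b
    change a ⊗ₜ[k] (TensorProduct.rid k Z').symm (T b) =
      lTensorAlgHom k _ _ (rTensorAlgHom k Z' k T) (a ⊗ₜ[k] (TensorProduct.rid k Z').symm b)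
    rw [TensorProduct.rid_symm_apply, TensorProduct.rid_symm_apply]
    rfl

theorem wordCoev_comp_wordEv_zero (j : ℕ) :
    wordCoev x y D j 0 ∘ₗ wordEv x y D j 0 =
      (addUnit k (alt x y j).X (alt x y (j + 1)).X).conjAlgEquiv k (altPair x y D j).cupCap :=
  LinearMap.ext fun z => ((addUnit k (alt x y j).X (alt x y (j + 1)).X).map_smul
    (show k from wordEv x y D j 0 z) (altPair x y D j).coev).symm

theorem wordCoev_comp_wordEv_succ (j m : ℕ) :
    wordCoev x y D j (m + 1) ∘ₗ wordEv x y D j (m + 1) =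
      addLeft x y j (m + 2) (wordCoev x y D (j + 1) m ∘ₗ wordEv x y D (j + 1) m) :=
  TensorProduct.ext' fun _ _ => rfl

theorem commute_wordCoev_comp_wordEv {a : (End k x.X ⊗[k] R)ˣ} {b : (End k y.X ⊗[k] R)ˣ}
    (h : Commute (D.cupCap ⊗ₜ[k] 1) (legMul a.1 b.1))
    (h' : Commute (D.symm.cupCap ⊗ₜ[k] 1) (legMul b.1 a.1)) (j m : ℕ) :
    Commute ((wordCoev x y D j m ∘ₗ wordEv x y D j m : End k _) ⊗ₜ[k] 1)
      (wordU x y a b j (m + 2)).1 := by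
  induction m generalizing j with
  | zero =>
    have hj := (commute_altPair h h' j).map (Obj.cj (addUnit _ _ _))
    rw [cj_addUnit, map_tmul, map_one] at hj
    rw [wordCoev_comp_wordEv_zero]
    exact hj
  | succ m ih =>
    rw [wordCoev_comp_wordEv_succ]
    have hj := (ih (j + 1)).map (mapLeft (addLeft x y j (m + 2)) R)
    rw [map_tmul, map_one] at hj
    exact (Obj.commute_legs_right (alt x y j).X (word x y (j + 1) (m + 2)).X
      (wordCoev x y D (j + 1) m ∘ₗ wordEv x y D (j + 1) m) (altU x y a b j).1).mul_right hj

end Commute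

end WordDuality

/-! ### The basic construction for endomorphism algebras -/

section Trace

variable {k X Y W : Type*} [Field k] [AddCommGroup X] [Module k X] [AddCommGroup Y] [Module k Y]
  [AddCommGroup W] [Module k W]

theorem exists_dual_apply_eq_one (k X : Type*) [Field k] [AddCommGroup X] [Module k X]
    [Nontrivial X] : ∃ (φ : Dual k X) (x : X), φ x = 1 := by
  obtain ⟨x, hx⟩ := exists_ne (0 : X)
  obtain ⟨φ, hφ⟩ := Module.Projective.exists_dual_ne_zero k hx
  exact ⟨(φ x)⁻¹ • φ, x, inv_mul_cancel₀ hφ⟩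

section Finite

variable [FiniteDimensional k X]

theorem end_rankOne_induction {P : End k X → Prop} (zero : P 0)
    (add : ∀ S T, P S → P T → P (S + T)) (rankOne : ∀ (φ : Dual k X) (x : X), P (φ.smulRight x))
    (T : End k X) : P T := by
  obtain ⟨z, rfl⟩ := (dualTensorHomEquiv k X X).surjective T
  induction z with
  | zero => simpa using zero
  | add a b ha hb => rw [map_add]; exact add _ _ ha hb
  | tmul φ x =>
    convert rankOne φ x
    ext
    simp

theorem eq_zero_of_trace_mul {S : End k X} (h : ∀ T, LinearMap.trace k X (S * T) = 0) : S = 0 := by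
  ext x
  refine (Module.forall_dual_apply_eq_zero_iff k _).1 fun φ => ?_
  have hmul : S * φ.smulRight x = φ.smulRight (S x) := by ext; simp
  simpa only [hmul, LinearMap.trace_smulRight] using h (φ.smulRight x)

theorem exists_eq_mul_trace (σ : End k X →ₗ[k] k) (hσ : ∀ S T, σ (S * T) = σ (T * S)) :
    ∃ c : k, ∀ T, σ T = c * LinearMap.trace k X T := by
  rcases subsingleton_or_nontrivial X with _ | _
  · exact ⟨0, fun T => by rw [Subsingleton.elim T 0, map_zero, zero_mul]⟩
  obtain ⟨φ₀, x₀, h₀⟩ := exists_dual_apply_eq_one k X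
  refine ⟨σ (φ₀.smulRight x₀), fun T => ?_⟩
  induction T using end_rankOne_induction with
  | zero => simp
  | add S T hS hT => rw [map_add, map_add, hS, hT, mul_add]
  | rankOne φ x =>
    have hmul : φ.smulRight x = (φ₀.smulRight x * φ.smulRight x₀ : End k X) := by
      ext z
      simp [h₀]
    have hmul' : (φ.smulRight x₀ * φ₀.smulRight x : End k X) = φ x • φ₀.smulRight x₀ := by
      ext z
      simp [smul_smul, mul_comm]
    rw [LinearMap.trace_smulRight, hmul, hσ, hmul', map_smul, smul_eq_mul, mul_comm]

variable [FiniteDimensional k W]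

variable (k X W) in
/-- The isomorphism `L(X) ⊗ L(W) ≃ L(X ⊗ W)`. -/
def endTensorEnd : End k X ⊗[k] End k W ≃ₐ[k] End k (X ⊗[k] W) :=
  AlgEquiv.ofBijective
    (Module.endTensorEndAlgHom (R := k) (S := k) (A := k) (M := X) (N := W)) (by
      convert (homTensorHomEquiv k X W X W).bijective using 1
      funext z
      induction z with
      | zero => simp
      | add a b ha hb => simp only [map_add, ha, hb]
      | tmul S T =>
        rw [Module.endTensorEndAlgHom_apply, homTensorHomEquiv_apply]
        rfl)

end Finite

variable (k X W) in
/-- The trace `tr ⊗ tr` of `L(X) ⊗ L(W)`. -/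
def tensorTrace : End k X ⊗[k] End k W →ₗ[k] k :=
  LinearMap.mul' k k ∘ₗ TensorProduct.map (LinearMap.trace k X) (LinearMap.trace k W)

theorem tensorTrace_tmul (S : End k X) (T : End k W) :
    tensorTrace k X W (S ⊗ₜ[k] T) = LinearMap.trace k X S * LinearMap.trace k W T :=
  rfl

theorem tensorTrace_one [FiniteDimensional k X] [FiniteDimensional k W] :
    tensorTrace k X W 1 = finrank k X * finrank k W := by
  rw [Algebra.TensorProduct.one_def, tensorTrace_tmul, LinearMap.trace_one, LinearMap.trace_one]

theorem tensorTrace_mapLeft {f : End k X →ₐ[k] End k Y} {c : k}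
    (hf : ∀ S, LinearMap.trace k Y (f S) = c * LinearMap.trace k X S)
    (z : End k X ⊗[k] End k W) :
    tensorTrace k Y W (mapLeft f (End k W) z) = c * tensorTrace k X W z := by
  induction z with
  | zero => simp
  | add a b ha hb => simp only [map_add, ha, hb, mul_add]
  | tmul S T => rw [map_tmul, AlgHom.id_apply, tensorTrace_tmul, tensorTrace_tmul, hf, mul_assoc]

theorem tensorTrace_eq_trace [FiniteDimensional k X] [FiniteDimensional k W]
    (z : End k X ⊗[k] End k W) :
    tensorTrace k X W z = LinearMap.trace k _ (endTensorEnd k X W z) := by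
  induction z with
  | zero => simp
  | add a b ha hb => simp only [map_add, ha, hb]
  | tmul S T => exact (LinearMap.trace_tensorProduct' S T).symm

section Finite

variable [FiniteDimensional k X] [FiniteDimensional k W]

theorem tensorTrace_mul_comm (a b : End k X ⊗[k] End k W) :
    tensorTrace k X W (a * b) = tensorTrace k X W (b * a) := by
  rw [tensorTrace_eq_trace, tensorTrace_eq_trace, map_mul (endTensorEnd k X W),
    LinearMap.trace_mul_comm, map_mul (endTensorEnd k X W)]

theorem eq_zero_of_tensorTrace_mul {a : End k X ⊗[k] End k W}
    (h : ∀ b, tensorTrace k X W (a * b) = 0) : a = 0 := by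
  refine (map_eq_zero_iff _ (endTensorEnd k X W).injective).1 (eq_zero_of_trace_mul fun T => ?_)
  obtain ⟨b, rfl⟩ := (endTensorEnd k X W).surjective T
  rw [← map_mul, ← tensorTrace_eq_trace, h]

theorem exists_eq_mul_tensorTrace (σ : End k X ⊗[k] End k W →ₗ[k] k)
    (hσ : ∀ a b, σ (a * b) = σ (b * a)) : ∃ c : k, ∀ z, σ z = c * tensorTrace k X W z := by
  obtain ⟨c, hc⟩ := exists_eq_mul_trace (σ ∘ₗ (endTensorEnd k X W).symm.toLinearMap) fun a b => by
    simp only [LinearMap.comp_apply, AlgEquiv.toLinearMap_apply, map_mul, hσ]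
  refine ⟨c, fun z => ?_⟩
  rw [tensorTrace_eq_trace, ← hc, LinearMap.comp_apply, AlgEquiv.toLinearMap_apply,
    AlgEquiv.symm_apply_apply]

end Finite

theorem adjoin_range_mapLeft_union_eq_top {A B : Type*} [Ring A] [Algebra k A] [Ring B]
    [Algebra k B] {f : A →ₐ[k] B} {p : B} (h : Algebra.adjoin k (Set.range f ∪ {p}) = ⊤)
    (R : Type*) [Ring R] [Algebra k R] :
    Algebra.adjoin k (Set.range (mapLeft f R) ∪ {p ⊗ₜ[k] (1 : R)}) = ⊤ := by
  have hleft (b : B) :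
      b ⊗ₜ[k] (1 : R) ∈ Algebra.adjoin k (Set.range (mapLeft f R) ∪ {p ⊗ₜ[k] 1}) := by
    have hb : b ⊗ₜ[k] (1 : R) ∈ (Algebra.adjoin k (Set.range f ∪ {p})).map
        (includeLeft : B →ₐ[k] B ⊗[k] R) := ⟨b, h ▸ Algebra.mem_top, rfl⟩
    rw [AlgHom.map_adjoin] at hb
    refine Algebra.adjoin_mono ?_ hb
    rintro _ ⟨_, ⟨a, rfl⟩ | rfl, rfl⟩
    · exact Or.inl ⟨a ⊗ₜ[k] 1, map_tmul _ _ _ _⟩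
    · exact Or.inr rfl
  have hright (r : R) :
      (1 : B) ⊗ₜ[k] r ∈ Algebra.adjoin k (Set.range (mapLeft f R) ∪ {p ⊗ₜ[k] 1}) :=
    Algebra.subset_adjoin (Or.inl ⟨1 ⊗ₜ[k] r, by rw [map_tmul, map_one, AlgHom.id_apply]⟩)
  refine eq_top_iff.2 fun z _ => ?_
  induction z with
  | zero => exact zero_mem _
  | add a b ha hb => exact add_mem (ha trivial) (hb trivial)
  | tmul b r =>
    simpa only [tmul_mul_tmul, one_mul, mul_one] using mul_mem (hleft b) (hright r)

end Trace

/-- The data of a basic construction `L(X) ⊂ L(Y) ⊂ L(Y')`: the Jones projection is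
`d⁻¹ • cup ∘ cap`, for the coevaluation `cup : X → Y'` and the evaluation `cap : Y' → X` of a
duality of dimension `d`, which bend `L(Y)` into `L(X, Y')`. -/
structure BasicData (k X Y Y' : Type*) [Field k] [AddCommGroup X] [Module k X] [AddCommGroup Y]
    [Module k Y] [AddCommGroup Y'] [Module k Y'] where
  inc : End k X →ₐ[k] End k Y
  inc' : End k Y →ₐ[k] End k Y'
  cup : X →ₗ[k] Y'
  cap : Y' →ₗ[k] X
  d : k
  d_ne_zero : d ≠ 0
  inc'_inc_comp_cup : ∀ S, inc' (inc S) ∘ₗ cup = cup ∘ₗ S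
  trace_inc : ∀ S, LinearMap.trace k Y (inc S) = d * LinearMap.trace k X S
  trace_inc' : ∀ T, LinearMap.trace k Y' (inc' T) = d * LinearMap.trace k Y T
  trace_cap_comp_cup : ∀ T, LinearMap.trace k X (cap ∘ₗ inc' T ∘ₗ cup) = LinearMap.trace k Y T
  finrank_mul_self : finrank k Y * finrank k Y = finrank k X * finrank k Y'

namespace BasicData

variable {k X Y Y' : Type*} [Field k] [AddCommGroup X] [Module k X] [AddCommGroup Y] [Module k Y]
  [AddCommGroup Y'] [Module k Y'] (B : BasicData k X Y Y')

theorem finrank_eq_mul [FiniteDimensional k Y] [FiniteDimensional k Y'] :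
    (finrank k Y' : k) = B.d * finrank k Y := by
  simpa only [map_one, LinearMap.trace_one] using B.trace_inc' 1

/-- The Jones projection. -/
def proj : End k Y' :=
  B.d⁻¹ • (B.cup ∘ₗ B.cap)

/-- The conditional expectation `L(Y) → L(X)`. -/
def expect : End k Y →ₗ[k] End k X :=
  B.d⁻¹ • (LinearMap.compRight k B.cap ∘ₗ LinearMap.lcomp k Y' B.cup ∘ₗ B.inc'.toLinearMap)

theorem expect_apply (T : End k Y) : B.expect T = B.d⁻¹ • (B.cap ∘ₗ B.inc' T ∘ₗ B.cup) :=
  rfl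

section Trace

theorem trace_expect_mul (T : End k Y) (S : End k X) :
    B.d * LinearMap.trace k X (B.expect T * S) = LinearMap.trace k Y (T * B.inc S) := by
  rw [← B.trace_cap_comp_cup, map_mul B.inc', Module.End.mul_eq_comp, Module.End.mul_eq_comp,
    LinearMap.comp_assoc, B.inc'_inc_comp_cup, expect_apply, LinearMap.smul_comp, map_smul,
    smul_eq_mul, mul_inv_cancel_left₀ B.d_ne_zero]
  rfl

theorem trace_inc'_mul_proj [FiniteDimensional k X] [FiniteDimensional k Y'] (T : End k Y) :
    LinearMap.trace k Y' (B.inc' T * B.proj) = B.d⁻¹ * LinearMap.trace k Y T := by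
  rw [← B.trace_cap_comp_cup, proj, mul_smul_comm, map_smul, smul_eq_mul, Module.End.mul_eq_comp,
    ← LinearMap.comp_assoc, LinearMap.trace_comp_comm']

variable {W : Type*} [AddCommGroup W] [Module k W]

theorem tensorTrace_expect_mul (z : End k Y ⊗[k] End k W) (a : End k X ⊗[k] End k W) :
    B.d * tensorTrace k X W (LinearMap.rTensor _ B.expect z * a) =
      tensorTrace k Y W (z * mapLeft B.inc (End k W) a) := by
  induction z with
  | zero => simp
  | add z z' hz hz' => simp only [map_add, add_mul, mul_add, hz, hz']
  | tmul T Q =>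
    induction a with
    | zero => simp
    | add a a' ha ha' => simp only [map_add, mul_add, ha, ha']
    | tmul S R =>
      rw [LinearMap.rTensor_tmul, tmul_mul_tmul, map_tmul, tmul_mul_tmul, AlgHom.id_apply,
        tensorTrace_tmul, tensorTrace_tmul, ← B.trace_expect_mul, mul_assoc]

theorem tensorTrace_mapLeft_mul_proj [FiniteDimensional k X] [FiniteDimensional k Y']
    (z : End k Y ⊗[k] End k W) :
    tensorTrace k Y' W (mapLeft B.inc' (End k W) z * (B.proj ⊗ₜ[k] 1)) =
      B.d⁻¹ * tensorTrace k Y W z := by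
  induction z with
  | zero => simp
  | add z z' hz hz' => simp only [map_add, add_mul, mul_add, hz, hz']
  | tmul T Q =>
    rw [map_tmul, tmul_mul_tmul, AlgHom.id_apply, mul_one, tensorTrace_tmul, tensorTrace_tmul,
      B.trace_inc'_mul_proj, mul_assoc]

end Trace

variable [FiniteDimensional k Y]

theorem inc'_comp_cup_injective : Function.Injective fun T : End k Y => B.inc' T ∘ₗ B.cup := by
  intro S T h
  refine sub_eq_zero.1 (eq_zero_of_trace_mul fun Z => ?_)
  have h' : B.inc' (S - T) ∘ₗ B.cup = 0 := by
    rw [map_sub, LinearMap.sub_comp, sub_eq_zero]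
    exact h
  rw [LinearMap.trace_mul_comm, ← B.trace_cap_comp_cup, map_mul, Module.End.mul_eq_comp,
    LinearMap.comp_assoc, h', LinearMap.comp_zero, LinearMap.comp_zero, map_zero]

theorem cap_comp_inc'_injective : Function.Injective fun T : End k Y => B.cap ∘ₗ B.inc' T := by
  intro S T h
  refine sub_eq_zero.1 (eq_zero_of_trace_mul fun Z => ?_)
  have h' : B.cap ∘ₗ B.inc' (S - T) = 0 := by
    rw [map_sub, LinearMap.comp_sub, sub_eq_zero]
    exact h
  rw [← B.trace_cap_comp_cup, map_mul, Module.End.mul_eq_comp, ← LinearMap.comp_assoc,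
    ← LinearMap.comp_assoc, h', LinearMap.zero_comp, LinearMap.zero_comp, map_zero]

variable [FiniteDimensional k Y'] [FiniteDimensional k X]

/-- The isomorphism `L(Y) ≃ L(X, Y')`, `T ↦ T ∘ cup`. -/
def bend : End k Y ≃ₗ[k] (X →ₗ[k] Y') :=
  LinearEquiv.ofInjectiveOfFinrankEq (LinearMap.lcomp k Y' B.cup ∘ₗ B.inc'.toLinearMap)
    B.inc'_comp_cup_injective ((Module.finrank_linearMap k k Y Y).trans
      (B.finrank_mul_self.trans (Module.finrank_linearMap k k X Y').symm))

theorem bend_apply (T : End k Y) : B.bend T = B.inc' T ∘ₗ B.cup :=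
  rfl

theorem exists_cap_comp_inc'_eq (β : Y' →ₗ[k] X) : ∃ T : End k Y, B.cap ∘ₗ B.inc' T = β :=
  (LinearEquiv.ofInjectiveOfFinrankEq (LinearMap.compRight k B.cap ∘ₗ B.inc'.toLinearMap)
    B.cap_comp_inc'_injective ((Module.finrank_linearMap k k Y Y).trans (B.finrank_mul_self.trans
      ((mul_comm _ _).trans (Module.finrank_linearMap k k Y' X).symm)))).surjective β

theorem exists_inc'_mul_proj_mul_inc'_eq [Nontrivial X] (φ : Dual k Y') (y : Y') :
    ∃ S T : End k Y, φ.smulRight y = B.inc' S * (B.d • B.proj) * B.inc' T := by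
  obtain ⟨ψ, x, hψ⟩ := exists_dual_apply_eq_one k X
  obtain ⟨S, hS⟩ := B.bend.surjective (ψ.smulRight y)
  obtain ⟨T, hT⟩ := B.exists_cap_comp_inc'_eq (φ.smulRight x)
  refine ⟨S, T, ?_⟩
  calc φ.smulRight y = B.bend S ∘ₗ (B.cap ∘ₗ B.inc' T) := by
        rw [hS, hT]
        ext z
        simp [hψ]
    _ = B.inc' S * (B.d • B.proj) * B.inc' T := by
        rw [proj, smul_inv_smul₀ B.d_ne_zero]
        rfl

theorem adjoin_eq_top [Nontrivial X] : Algebra.adjoin k (Set.range B.inc' ∪ {B.proj}) = ⊤ := by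
  refine eq_top_iff.2 fun T _ => ?_
  induction T using end_rankOne_induction with
  | zero => exact zero_mem _
  | add S T hS hT => exact add_mem (hS trivial) (hT trivial)
  | rankOne φ y =>
    obtain ⟨S, T, h⟩ := B.exists_inc'_mul_proj_mul_inc'_eq φ y
    rw [h]
    refine mul_mem (mul_mem ?_ (Subalgebra.smul_mem _ ?_ _)) ?_
    · exact Algebra.subset_adjoin (Or.inl ⟨S, rfl⟩)
    · exact Algebra.subset_adjoin (Or.inr rfl)
    · exact Algebra.subset_adjoin (Or.inl ⟨T, rfl⟩)

/-- The action of `L(Y')` on `L(Y)`, carried over from `L(X, Y')`. -/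
def act : End k Y' →ₐ[k] End k (End k Y) :=
  (B.bend.symm.conjAlgEquiv k : _ →ₐ[k] _).comp (Algebra.lsmul k k (X →ₗ[k] Y'))

theorem bend_act (T : End k Y') (S : End k Y) : B.bend (B.act T S) = T ∘ₗ B.bend S :=
  B.bend.apply_symm_apply _

theorem act_inc' (T S : End k Y) : B.act (B.inc' T) S = T * S := by
  refine B.bend.injective ?_
  rw [bend_act, bend_apply, bend_apply, map_mul]
  rfl

theorem act_proj (T : End k Y) : B.act B.proj T = B.inc (B.expect T) := by
  refine B.bend.injective ?_
  rw [bend_act, bend_apply, bend_apply, B.inc'_inc_comp_cup, proj, expect_apply,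
    LinearMap.smul_comp, LinearMap.comp_smul, LinearMap.comp_assoc]

theorem act_injective [Nontrivial X] : Function.Injective B.act := by
  intro S T h
  obtain ⟨ψ, x, hψ⟩ := exists_dual_apply_eq_one k X
  ext y
  obtain ⟨Z, hZ⟩ := B.bend.surjective (ψ.smulRight y)
  have h' := congrArg B.bend (LinearMap.congr_fun h Z)
  rw [bend_act, bend_act, hZ] at h'
  simpa [hψ] using LinearMap.congr_fun h' x

variable (R : Type*) [Ring R] [Algebra k R]

/-- The action of `L(Y') ⊗ R` on `L(Y) ⊗ R`. -/
def actTensor : End k Y' ⊗[k] R →ₐ[k] End k (End k Y ⊗[k] R) :=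
  (Module.endTensorEndAlgHom (R := k) (S := k) (A := k) (M := End k Y) (N := R)).comp
    (map B.act (Algebra.lmul k R))

theorem actTensor_tmul_tmul (T : End k Y') (r : R) (S : End k Y) (s : R) :
    B.actTensor R (T ⊗ₜ[k] r) (S ⊗ₜ[k] s) = B.act T S ⊗ₜ[k] (r * s) :=
  rfl

theorem actTensor_injective [Nontrivial X] [FiniteDimensional k R] :
    Function.Injective (B.actTensor R) :=
  (endTensorEnd k (End k Y) R).injective.comp
    (TensorProduct.map_injective_of_flat_flat B.act.toLinearMap (Algebra.lmul k R).toLinearMap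
      B.act_injective Algebra.lmul_injective)

theorem actTensor_mapLeft (z : End k Y ⊗[k] R) :
    B.actTensor R (mapLeft B.inc' R z) = Algebra.lmul k (End k Y ⊗[k] R) z := by
  induction z with
  | zero => simp
  | add a b ha hb => simp only [map_add, ha, hb]
  | tmul T r =>
    refine TensorProduct.ext' fun S s => ?_
    rw [map_tmul, AlgHom.id_apply, actTensor_tmul_tmul, act_inc']
    exact (tmul_mul_tmul T S r s).symm

theorem actTensor_proj (z : End k Y ⊗[k] R) :
    B.actTensor R (B.proj ⊗ₜ[k] 1) z = mapLeft B.inc R (LinearMap.rTensor R B.expect z) := by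
  induction z with
  | zero => simp
  | add a b ha hb => simp only [map_add, ha, hb]
  | tmul T r =>
    rw [actTensor_tmul_tmul, act_proj, one_mul, LinearMap.rTensor_tmul, map_tmul, AlgHom.id_apply]

end BasicData

/-! ### Squares of the form `L(X) ⊗ L(W) ⊂ L(Y) ⊗ L(W)` -/

section ConjLeft

variable {k B B' R : Type u} [Field k] [Ring B] [Algebra k B] [Ring B'] [Algebra k B'] [Ring R]
  [Algebra k R]

/-- The embedding `T ↦ U(T ⊗ 1)U⁻¹`, whose range for `B = L(V)` and `U = u` is `A₁₀`. -/
def conjLeft (U : (B ⊗[k] R)ˣ) : B →ₐ[k] B ⊗[k] R :=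
  (ad U).comp includeLeft

theorem conjLeft_apply (U : (B ⊗[k] R)ˣ) (T : B) : conjLeft U T = U.1 * (T ⊗ₜ[k] 1) * U⁻¹.1 :=
  rfl

theorem conjLeft_map {f : B →ₐ[k] B'} {U : (B ⊗[k] R)ˣ} {U' : (B' ⊗[k] R)ˣ} {L : B' ⊗[k] R}
    (hU : U'.1 = mapLeft f R U.1 * L) (hL : ∀ T, Commute (f T ⊗ₜ[k] (1 : R)) L) (T : B) :
    conjLeft U' (f T) = mapLeft f R (conjLeft U T) := by
  rw [conjLeft_apply, Units.mul_inv_eq_iff_eq_mul]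
  calc U'.1 * (f T ⊗ₜ[k] 1) = mapLeft f R U.1 * (f T ⊗ₜ[k] 1) * L := by
        rw [hU, mul_assoc, ← (hL T).eq, mul_assoc]
    _ = mapLeft f R (conjLeft U T * U.1) * L := by
        rw [conjLeft_apply, Units.inv_mul_cancel_right, map_mul, map_tmul, AlgHom.id_apply]
    _ = mapLeft f R (conjLeft U T) * U'.1 := by rw [hU, map_mul, mul_assoc]

end ConjLeft

namespace Square

variable {k : Type u} [Field k] {s : Square k}

theorem isCondExp_condExp (h : ∃ E, s.IsCondExp E) : s.IsCondExp s.condExp := by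
  rw [condExp, dif_pos h]
  exact h.choose_spec

theorem isMarkovExt_markovExt (h : ∃ σ, s.IsMarkovExt σ) : s.IsMarkovExt s.markovExt := by
  rw [markovExt, dif_pos h]
  exact h.choose_spec

end Square

section Stage

variable {k X Y Y' W : Type u} [Field k] [AddCommGroup X] [Module k X] [AddCommGroup Y]
  [Module k Y] [AddCommGroup Y'] [Module k Y'] [AddCommGroup W] [Module k W]

/-- An identification of a square with a square of the form `L(X) ⊗ L(W) ⊂ L(Y) ⊗ L(W)`, whose
lower right algebra is `U(L(Y) ⊗ k)U⁻¹`. -/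
structure Stage (s : Square k) (inc : End k X →ₐ[k] End k Y) (U : (End k Y ⊗[k] End k W)ˣ) where
  /-- the identification of the smaller algebra -/
  αA : s.A ≃ₐ[k] End k X ⊗[k] End k W
  /-- the identification of the bigger algebra -/
  αB : s.B ≃ₐ[k] End k Y ⊗[k] End k W
  αB_ι : ∀ a, αB (s.ι a) = mapLeft inc (End k W) (αA a)
  /-- the normalization of the trace -/
  c : k
  c_mul : c * (finrank k Y * finrank k W) = 1
  τ_eq : ∀ b, s.τ b = c * tensorTrace k Y W (αB b)
  map_B₀ : s.B₀.map (αB : s.B →ₐ[k] End k Y ⊗[k] End k W) = (conjLeft U).range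

namespace Stage

variable {s : Square k} {B : BasicData k X Y Y'} {U : (End k Y ⊗[k] End k W)ˣ}
  (S : Stage s B.inc U)

theorem c_ne_zero : S.c ≠ 0 :=
  left_ne_zero_of_mul_eq_one S.c_mul

theorem c_div_mul [FiniteDimensional k Y] [FiniteDimensional k Y'] :
    S.c / B.d * (finrank k Y' * finrank k W) = 1 := by
  rw [B.finrank_eq_mul, ← S.c_mul, mul_assoc B.d, ← mul_assoc (S.c / B.d),
    div_mul_cancel₀ _ B.d_ne_zero]

theorem τ_mul_ι (b : s.B) (a : s.A) :
    s.τ (b * s.ι a) =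
      S.c * (B.d * tensorTrace k X W (LinearMap.rTensor _ B.expect (S.αB b) * S.αA a)) := by
  rw [S.τ_eq, map_mul S.αB, S.αB_ι, B.tensorTrace_expect_mul]

theorem τ_ι_mul_ι (a a' : s.A) :
    s.τ (s.ι a * s.ι a') = S.c * (B.d * tensorTrace k X W (S.αA a * S.αA a')) := by
  rw [S.τ_eq, ← map_mul s.ι, S.αB_ι, tensorTrace_mapLeft B.trace_inc, map_mul S.αA]

section Expect

variable [FiniteDimensional k X] [FiniteDimensional k W]

theorem isCondExp_iff {E : s.B →ₗ[k] s.A} :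
    s.IsCondExp E ↔ ∀ b, S.αA (E b) = LinearMap.rTensor _ B.expect (S.αB b) := by
  simp only [Square.IsCondExp, S.τ_ι_mul_ι]
  simp only [S.τ_mul_ι, mul_right_inj' S.c_ne_zero, mul_right_inj' B.d_ne_zero]
  refine forall_congr' fun b => ⟨fun h => sub_eq_zero.1 (eq_zero_of_tensorTrace_mul fun z => ?_),
    fun h a => by rw [h]⟩
  obtain ⟨a, rfl⟩ := S.αA.surjective z
  rw [sub_mul, map_sub, h, sub_self]

theorem αA_condExp (b : s.B) :
    S.αA (s.condExp b) = LinearMap.rTensor _ B.expect (S.αB b) := by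
  have hex : ∃ E, s.IsCondExp E :=
    ⟨S.αA.symm.toLinearMap ∘ₗ LinearMap.rTensor _ B.expect ∘ₗ S.αB.toLinearMap,
      S.isCondExp_iff.2 fun b => S.αA.apply_symm_apply _⟩
  exact S.isCondExp_iff.1 (Square.isCondExp_condExp hex) b

end Expect

variable [FiniteDimensional k Y'] [FiniteDimensional k X] [FiniteDimensional k Y]

/-- The representation of `L(Y') ⊗ L(W)` on the bigger algebra of the square. -/
def rep : End k Y' ⊗[k] End k W →ₐ[k] End k s.B :=
  (S.αB.symm.toLinearEquiv.conjAlgEquiv k : _ →ₐ[k] _).comp (B.actTensor (End k W))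

theorem αB_rep (z : End k Y' ⊗[k] End k W) (b : s.B) :
    S.αB (S.rep z b) = B.actTensor (End k W) z (S.αB b) :=
  S.αB.apply_symm_apply _

theorem rep_mapLeft (b : s.B) :
    S.rep (mapLeft B.inc' (End k W) (S.αB b)) = Algebra.lmul k s.B b := by
  ext z
  refine S.αB.injective ?_
  rw [S.αB_rep, B.actTensor_mapLeft]
  exact (map_mul S.αB b z).symm

variable [FiniteDimensional k W]

theorem αB_jones (b : s.B) :
    S.αB (s.jones b) = B.actTensor (End k W) (B.proj ⊗ₜ[k] 1) (S.αB b) := by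
  rw [B.actTensor_proj, ← S.αA_condExp]
  exact S.αB_ι _

theorem rep_proj : S.rep (B.proj ⊗ₜ[k] 1) = s.jones := by
  ext z
  refine S.αB.injective ?_
  rw [S.αB_rep, S.αB_jones]

variable [Nontrivial X]

theorem rep_injective : Function.Injective S.rep :=
  (S.αB.symm.toLinearEquiv.conjAlgEquiv k).injective.comp (B.actTensor_injective _)

theorem range_rep : S.rep.range = s.basic := by
  have hgen : Algebra.adjoin k (Set.range (mapLeft B.inc' (End k W)) ∪ {B.proj ⊗ₜ[k] 1}) = ⊤ :=
    adjoin_range_mapLeft_union_eq_top B.adjoin_eq_top _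
  rw [← Algebra.map_top, ← hgen, AlgHom.map_adjoin, Square.basic, Set.image_union,
    Set.image_singleton, S.rep_proj, ← Set.range_comp, ← S.αB.surjective.range_comp]
  congr 3
  exact funext S.rep_mapLeft

/-- The identification of the basic construction with `L(Y') ⊗ L(W)`. -/
def basicEquiv : s.basic ≃ₐ[k] End k Y' ⊗[k] End k W :=
  ((AlgEquiv.ofInjective S.rep S.rep_injective).trans
    (Subalgebra.equivOfEq _ _ S.range_rep)).symm

theorem basicEquiv_eq {x : s.basic} {z : End k Y' ⊗[k] End k W} (h : S.rep z = x) :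
    S.basicEquiv x = z := by
  rw [basicEquiv, AlgEquiv.symm_apply_eq]
  exact Subtype.ext h.symm

theorem basicEquiv_toBasic (b : s.B) :
    S.basicEquiv (s.toBasic b) = mapLeft B.inc' (End k W) (S.αB b) :=
  S.basicEquiv_eq (S.rep_mapLeft b)

theorem basicEquiv_jonesMem : S.basicEquiv s.jonesMem = B.proj ⊗ₜ[k] 1 :=
  S.basicEquiv_eq S.rep_proj

theorem isMarkovExt_tensorTrace :
    s.IsMarkovExt ((S.c / B.d) • (tensorTrace k Y' W ∘ₗ S.basicEquiv.toLinearMap)) := by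
  simp only [Square.IsMarkovExt, LinearMap.smul_apply, LinearMap.comp_apply,
    AlgEquiv.toLinearMap_apply, smul_eq_mul, map_mul S.basicEquiv, S.basicEquiv_toBasic,
    S.basicEquiv_jonesMem, tensorTrace_mapLeft B.trace_inc', B.tensorTrace_mapLeft_mul_proj, S.τ_eq]
  have hd := B.d_ne_zero
  refine ⟨fun x y => by rw [tensorTrace_mul_comm], fun b => by field_simp,
    B.d ^ 2, pow_ne_zero 2 hd, fun b => by field_simp⟩

theorem eq_tensorTrace_of_isMarkovExt {σ : s.basic →ₗ[k] k} (hσ : s.IsMarkovExt σ)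
    (x : s.basic) : σ x = S.c / B.d * tensorTrace k Y' W (S.basicEquiv x) := by
  obtain ⟨hcomm, hext, -⟩ := hσ
  obtain ⟨c, hc⟩ := exists_eq_mul_tensorTrace (σ ∘ₗ S.basicEquiv.symm.toLinearMap) fun a b => by
    simp only [LinearMap.comp_apply, AlgEquiv.toLinearMap_apply, map_mul, hcomm]
  have hone : c * (finrank k Y' * finrank k W) = 1 := by
    rw [← tensorTrace_one, ← hc, LinearMap.comp_apply, AlgEquiv.toLinearMap_apply, map_one,
      ← map_one s.toBasic, hext, S.τ_eq, map_one, tensorTrace_one, S.c_mul]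
  have hcd : c = S.c / B.d :=
    mul_right_cancel₀ (right_ne_zero_of_mul_eq_one hone) (hone.trans S.c_div_mul.symm)
  rw [← hcd, ← hc, LinearMap.comp_apply, AlgEquiv.toLinearMap_apply, AlgEquiv.symm_apply_apply]

theorem markovExt_eq (x : s.basic) :
    s.markovExt x = S.c / B.d * tensorTrace k Y' W (S.basicEquiv x) :=
  S.eq_tensorTrace_of_isMarkovExt
    (Square.isMarkovExt_markovExt ⟨_, S.isMarkovExt_tensorTrace⟩) x

theorem map_next_B₀ {U' : (End k Y' ⊗[k] End k W)ˣ} {L : End k Y' ⊗[k] End k W}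
    (hU : U'.1 = mapLeft B.inc' (End k W) U.1 * L)
    (hL : ∀ T, Commute (B.inc' T ⊗ₜ[k] (1 : End k W)) L)
    (hP : Commute ((B.cup ∘ₗ B.cap) ⊗ₜ[k] 1) U'.1) :
    Subalgebra.map (S.basicEquiv : s.basic →ₐ[k] End k Y' ⊗[k] End k W) s.next.B₀ =
      (conjLeft U').range := by
  have hproj : conjLeft U' B.proj = B.proj ⊗ₜ[k] 1 := by
    rw [conjLeft_apply, Units.mul_inv_eq_iff_eq_mul, BasicData.proj, ← TensorProduct.smul_tmul',
      mul_smul_comm, smul_mul_assoc, hP.eq]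
  have hB₀ : S.basicEquiv '' (s.toBasic '' s.B₀) = conjLeft U' '' Set.range B.inc' :=
    calc S.basicEquiv '' (s.toBasic '' s.B₀) = mapLeft B.inc' (End k W) '' (S.αB '' s.B₀) := by
          simp only [Set.image_image, S.basicEquiv_toBasic]
      _ = mapLeft B.inc' (End k W) '' Set.range (conjLeft U) :=
          congrArg _ (congrArg SetLike.coe S.map_B₀)
      _ = conjLeft U' '' Set.range B.inc' := by
          rw [← Set.range_comp, ← Set.range_comp]
          exact congrArg Set.range (funext fun T => (conjLeft_map hU hL T).symm)
  change (Algebra.adjoin k (s.toBasic '' s.B₀ ∪ {s.jonesMem})).map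
    (S.basicEquiv : s.basic →ₐ[k] End k Y' ⊗[k] End k W) = _
  rw [← Algebra.map_top, ← B.adjoin_eq_top, AlgHom.map_adjoin, AlgHom.map_adjoin,
    Set.image_union, Set.image_union, Set.image_singleton, Set.image_singleton, hproj, ← hB₀]
  congr 3
  exact S.basicEquiv_jonesMem

/-- The identification of the basic construction of an identified square. -/
def next (U' : (End k Y' ⊗[k] End k W)ˣ) (L : End k Y' ⊗[k] End k W)
    (hU : U'.1 = mapLeft B.inc' (End k W) U.1 * L)
    (hL : ∀ T, Commute (B.inc' T ⊗ₜ[k] (1 : End k W)) L)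
    (hP : Commute ((B.cup ∘ₗ B.cap) ⊗ₜ[k] 1) U'.1) : Stage s.next B.inc' U' where
  αA := S.αB
  αB := S.basicEquiv
  αB_ι := S.basicEquiv_toBasic
  c := S.c / B.d
  c_mul := S.c_div_mul
  τ_eq := S.markovExt_eq
  map_B₀ := S.map_next_B₀ hU hL hP

end Stage

end Stage

section Transposition

variable {k A A' C R : Type*} [Field k] [Ring A] [Algebra k A] [Ring A'] [Algebra k A'] [Ring C]
  [Algebra k C] [Ring R] [Algebra k R] {f : A →ₐ[k] C} {g : A' →ₐ[k] C} {t : A →ₗ[k] A'} {c : C}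

theorem tmul_one_mul_mapLeft (h : ∀ a, c * f a = c * g (t a)) (z : A ⊗[k] R) :
    c ⊗ₜ[k] 1 * mapLeft f R z = c ⊗ₜ[k] 1 * mapLeft g R (t.rTensor R z) := by
  induction z with
  | zero => simp
  | add a b ha hb => simp only [map_add, mul_add, ha, hb]
  | tmul a r => rw [map_tmul, tmul_mul_tmul, h, LinearMap.rTensor_tmul, map_tmul, tmul_mul_tmul]

theorem mapLeft_mul_tmul_one (h : ∀ a, f a * c = g (t a) * c) (z : A ⊗[k] R) :
    mapLeft f R z * c ⊗ₜ[k] 1 = mapLeft g R (t.rTensor R z) * c ⊗ₜ[k] 1 := by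
  induction z with
  | zero => simp
  | add a b ha hb => simp only [map_add, add_mul, ha, hb]
  | tmul a r => rw [map_tmul, tmul_mul_tmul, h, LinearMap.rTensor_tmul, map_tmul, tmul_mul_tmul]

end Transposition

namespace DualPair

variable {k Z Z' R : Type*} [Field k] [AddCommGroup Z] [Module k Z] [AddCommGroup Z']
  [Module k Z'] [Ring R] [Algebra k R] (D : DualPair k Z Z') {t : End k Z →ₗ[k] End k Z'}
  {u : (End k Z ⊗[k] R)ˣ} {v : (End k Z' ⊗[k] R)ˣ} (hv : t.rTensor R u⁻¹.1 = v.1)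
  (hv' : t.rTensor R u.1 = v⁻¹.1)
include hv hv'

theorem commute_cupCap_legMul
    (hl : ∀ T, D.cupCap * rTensorAlgHom k Z Z' T = D.cupCap * lTensorAlgHom k Z' Z (t T))
    (hr : ∀ T, rTensorAlgHom k Z Z' T * D.cupCap = lTensorAlgHom k Z' Z (t T) * D.cupCap) :
    Commute (D.cupCap ⊗ₜ[k] 1) (legMul u.1 v.1) := by
  refine Eq.trans (b := D.cupCap ⊗ₜ[k] 1) ?_ ?_
  · rw [← mul_assoc, tmul_one_mul_mapLeft hl, hv', mul_assoc, ← map_mul, Units.inv_mul, map_one,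
      mul_one]
  · rw [mul_assoc, ← hv, ← mapLeft_mul_tmul_one hr, ← mul_assoc, ← map_mul, Units.mul_inv, map_one,
      one_mul]

theorem commute_symm_cupCap_legMul
    (hl : ∀ T, D.symm.cupCap * lTensorAlgHom k Z Z' T = D.symm.cupCap * rTensorAlgHom k Z' Z (t T))
    (hr : ∀ T, lTensorAlgHom k Z Z' T * D.symm.cupCap =
      rTensorAlgHom k Z' Z (t T) * D.symm.cupCap) :
    Commute (D.symm.cupCap ⊗ₜ[k] 1) (legMul v.1 u.1) := by
  refine Eq.trans (b := D.symm.cupCap ⊗ₜ[k] 1) ?_ ?_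
  · rw [← mul_assoc, ← hv, ← tmul_one_mul_mapLeft hl, mul_assoc, ← map_mul, Units.inv_mul, map_one,
      mul_one]
  · rw [mul_assoc, mapLeft_mul_tmul_one hr, hv', ← mul_assoc, ← map_mul, Units.mul_inv, map_one,
      one_mul]

end DualPair

section CanonicalDuality

variable {k Z : Type*} [Field k] [AddCommGroup Z] [Module k Z] [FiniteDimensional k Z]

theorem rTensor_coevaluation (T : End k Z) :
    LinearMap.rTensor (Dual k Z) T (coevaluation k Z 1) =
      LinearMap.lTensor Z (Dual.transpose (R := k) T) (coevaluation k Z 1) := by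
  have hone : dualTensorHom k Z Z (TensorProduct.comm k Z _ (coevaluation k Z 1)) = 1 := by
    rw [coevaluation_apply_one]
    ext z
    simpa using (Module.Basis.ofVectorSpace k Z).sum_repr z
  have hr (z : Z ⊗[k] Dual k Z) :
      dualTensorHom k Z Z (TensorProduct.comm k Z _ (LinearMap.rTensor _ T z)) =
        T * dualTensorHom k Z Z (TensorProduct.comm k Z _ z) := by
    induction z with
    | zero => simp
    | add a b ha hb => simp only [map_add, mul_add, ha, hb]
    | tmul a φ => ext; simp
  have hl (z : Z ⊗[k] Dual k Z) :
      dualTensorHom k Z Z (TensorProduct.comm k Z _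
        (LinearMap.lTensor Z (Dual.transpose (R := k) T) z)) =
          dualTensorHom k Z Z (TensorProduct.comm k Z _ z) * T := by
    induction z with
    | zero => simp
    | add a b ha hb => simp only [map_add, add_mul, ha, hb]
    | tmul a φ => exact LinearMap.ext fun _ => rfl
  refine (TensorProduct.comm k Z _).injective ((dualTensorHomEquiv k Z Z).injective ?_)
  refine (hr _).trans (Eq.trans ?_ (hl _).symm)
  rw [hone, mul_one, one_mul]

namespace DualPair

variable (T : End k Z)

theorem canonical_cupCap_mul :
    (canonical k Z).cupCap * rTensorAlgHom k Z (Dual k Z) T =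
      (canonical k Z).cupCap * lTensorAlgHom k (Dual k Z) Z (Dual.transpose (R := k) T) := by
  ext
  rfl

theorem mul_canonical_cupCap :
    rTensorAlgHom k Z (Dual k Z) T * (canonical k Z).cupCap =
      lTensorAlgHom k (Dual k Z) Z (Dual.transpose (R := k) T) * (canonical k Z).cupCap := by
  refine LinearMap.ext fun z => ?_
  refine (map_smul (LinearMap.rTensor _ T) _ _).trans ?_
  refine Eq.trans ?_ (map_smul (LinearMap.lTensor Z (Dual.transpose (R := k) T)) _ _).symm
  exact congrArg _ (rTensor_coevaluation T)

theorem canonical_symm_cupCap_mul :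
    (canonical k Z).symm.cupCap * lTensorAlgHom k Z (Dual k Z) T =
      (canonical k Z).symm.cupCap * rTensorAlgHom k (Dual k Z) Z (Dual.transpose (R := k) T) := by
  ext
  rfl

theorem mul_canonical_symm_cupCap :
    lTensorAlgHom k Z (Dual k Z) T * (canonical k Z).symm.cupCap =
      rTensorAlgHom k (Dual k Z) Z (Dual.transpose (R := k) T) * (canonical k Z).symm.cupCap := by
  have h : LinearMap.lTensor (Dual k Z) T (canonical k Z).symm.coev =
      LinearMap.rTensor Z (Dual.transpose (R := k) T) (canonical k Z).symm.coev :=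
    (LinearMap.lTensor_comm T (coevaluation k Z 1)).trans
      ((congrArg (TensorProduct.comm k Z (Dual k Z)) (rTensor_coevaluation T)).trans
        (LinearMap.rTensor_comm _ _).symm)
  refine LinearMap.ext fun z => ?_
  refine (map_smul (LinearMap.lTensor _ T) _ _).trans ?_
  refine Eq.trans ?_ (map_smul (LinearMap.rTensor Z (Dual.transpose (R := k) T)) _ _).symm
  exact congrArg _ h

end DualPair

end CanonicalDuality

section Star

variable {k Z W : Type u} [Field k] [AddCommGroup Z] [Module k Z] [FiniteDimensional k Z]
  [AddCommGroup W] [Module k W] (u : (End k Z ⊗[k] End k W)ˣ) (hu : SatisfiesStar u)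

theorem commute_canonical_cupCap :
    Commute ((DualPair.canonical k Z).cupCap ⊗ₜ[k] 1) (legMul u.1 (hatUnit u hu).1) :=
  DualPair.commute_cupCap_legMul _ rfl rfl DualPair.canonical_cupCap_mul
    DualPair.mul_canonical_cupCap

theorem commute_canonical_symm_cupCap :
    Commute ((DualPair.canonical k Z).symm.cupCap ⊗ₜ[k] 1) (legMul (hatUnit u hu).1 u.1) :=
  DualPair.commute_symm_cupCap_legMul _ rfl rfl DualPair.canonical_symm_cupCap_mul
    DualPair.mul_canonical_symm_cupCap

end Star

/-! ### The tower of basic constructions -/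

section Base

theorem includeRight_bijective (k R : Type*) [Field k] [Ring R] [Algebra k R] :
    Function.Bijective (includeRight : R →ₐ[k] End k k ⊗[k] R) := by
  refine ⟨Algebra.TensorProduct.includeRight_injective
    (algebraMap k (End k k)).injective, fun z => ?_⟩
  induction z with
  | zero => exact ⟨0, map_zero _⟩
  | add a b ha hb =>
    obtain ⟨r, rfl⟩ := ha
    obtain ⟨s, rfl⟩ := hb
    exact ⟨r + s, map_add _ _ _⟩
  | tmul T r =>
    obtain ⟨c, rfl⟩ := exists_eq_algebraMap T
    refine ⟨c • r, ?_⟩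
    rw [Algebra.algebraMap_eq_smul_one, TensorProduct.smul_tmul]
    rfl

/-- The identification of `k ⊗ R ⊂ A ⊗ R` with `L(k) ⊗ R`. -/
def rightEquiv (k A R : Type*) [Field k] [Ring A] [Nontrivial A] [Algebra k A] [Ring R]
    [Algebra k R] : (includeRight : R →ₐ[k] A ⊗[k] R).range ≃ₐ[k] End k k ⊗[k] R :=
  (AlgEquiv.ofInjective _ (Algebra.TensorProduct.includeRight_injective
    (algebraMap k A).injective)).symm.trans
      (AlgEquiv.ofBijective _ (includeRight_bijective k R))

theorem rightEquiv_includeRight {k A R : Type*} [Field k] [Ring A] [Nontrivial A] [Algebra k A]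
    [Ring R] [Algebra k R] (r : R) (h) : rightEquiv k A R ⟨1 ⊗ₜ[k] r, h⟩ = 1 ⊗ₜ[k] r :=
  congrArg (AlgEquiv.ofBijective _ (includeRight_bijective k R))
    ((AlgEquiv.symm_apply_eq _).2 (Subtype.ext rfl))

/-- The identification of `L(V) ⊗ R` with `L(V ⊗ k) ⊗ R`. -/
def unitEquiv (k V R : Type*) [Field k] [AddCommGroup V] [Module k V] [Ring R] [Algebra k R] :
    End k V ⊗[k] R ≃ₐ[k] End k (V ⊗[k] k) ⊗[k] R :=
  Algebra.TensorProduct.congr ((TensorProduct.rid k V).symm.conjAlgEquiv k) AlgEquiv.refl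

section UnitEquiv

variable {k V : Type*} [Field k] [AddCommGroup V] [Module k V]

theorem conj_rid_symm (T : End k V) :
    (TensorProduct.rid k V).symm.conjAlgEquiv k T = rTensorAlgHom k V k T := by
  ext a
  simp
  rfl

theorem unitEquiv_tmul {R : Type*} [Ring R] [Algebra k R] (T : End k V) (r : R) :
    unitEquiv k V R (T ⊗ₜ[k] r) = rTensorAlgHom k V k T ⊗ₜ[k] r :=
  congrArg (· ⊗ₜ[k] r) (conj_rid_symm T)

theorem unitEquiv_eq_mapLeft {R : Type*} [Ring R] [Algebra k R] (z : End k V ⊗[k] R) :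
    unitEquiv k V R z = mapLeft (rTensorAlgHom k V k) R z := by
  induction z with
  | zero => simp
  | add a b ha hb => simp only [map_add, ha, hb]
  | tmul T r => rw [unitEquiv_tmul, map_tmul, AlgHom.id_apply]

theorem tensorTrace_unitEquiv {W : Type*} [AddCommGroup W] [Module k W] [FiniteDimensional k V]
    (z : End k V ⊗[k] End k W) :
    tensorTrace k (V ⊗[k] k) W (unitEquiv k V (End k W) z) = tensorTrace k V W z := by
  rw [unitEquiv_eq_mapLeft, tensorTrace_mapLeft (c := 1), one_mul]
  intro S
  rw [one_mul, ← conj_rid_symm]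
  exact LinearMap.trace_conj' S (TensorProduct.rid k V).symm

end UnitEquiv
end Base

section Box

variable {k V W : Type u} [Field k] [AddCommGroup V] [Module k V] [AddCommGroup W] [Module k W]

theorem unitEquiv_conjLeft (a : (End k V ⊗[k] End k W)ˣ) (T : End k V) :
    unitEquiv k V (End k W) (conjLeft a T) =
      conjLeft (legMulU a (1 : (End k k ⊗[k] End k W)ˣ)) (rTensorAlgHom k V k T) := by
  rw [unitEquiv_eq_mapLeft]
  refine (conjLeft_map (L := 1) ?_ (fun _ => Commute.one_right _) T).symm
  rw [coe_legMulU, legMul, Units.val_one, map_one]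

theorem map_box_B₀ [FiniteDimensional k V] [FiniteDimensional k W]
    (a : (End k V ⊗[k] End k W)ˣ) :
    (box a).B₀.map (unitEquiv k V (End k W) : End k V ⊗[k] End k W →ₐ[k] _) =
      (conjLeft (legMulU a (1 : (End k k ⊗[k] End k W)ˣ))).range := by
  ext z
  constructor
  · rintro ⟨_, ⟨_, ⟨T, rfl⟩, rfl⟩, rfl⟩
    exact ⟨_, (unitEquiv_conjLeft a T).symm⟩
  · rintro ⟨T, rfl⟩
    obtain ⟨T, rfl⟩ := ((TensorProduct.rid k V).symm.conjAlgEquiv k).surjective T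
    refine ⟨_, ⟨_, ⟨T, rfl⟩, rfl⟩, (unitEquiv_conjLeft a T).trans ?_⟩
    rw [← conj_rid_symm]
    rfl

variable [FiniteDimensional k V] [Nontrivial V] [FiniteDimensional k W]

/-- The stage at the square of algebras of `a`. -/
def boxStage (hV : (finrank k V : k) ≠ 0) (hW : (finrank k W : k) ≠ 0)
    (inc : End k k →ₐ[k] End k (V ⊗[k] k)) (a : (End k V ⊗[k] End k W)ˣ) :
    Stage (box a) inc (legMulU a (1 : (End k k ⊗[k] End k W)ˣ)) where
  αA := rightEquiv k (End k V) (End k W)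
  αB := unitEquiv k V (End k W)
  αB_ι := by
    rintro ⟨_, r, rfl⟩
    refine Eq.trans ?_ (congrArg (mapLeft inc (End k W)) (rightEquiv_includeRight r _)).symm
    rw [map_tmul, map_one]
    exact (unitEquiv_tmul 1 r).trans (by rw [map_one]; rfl)
  c := (finrank k V * finrank k W : k)⁻¹
  c_mul := by
    rw [Module.finrank_tensorProduct, Module.finrank_self, mul_one]
    exact inv_mul_cancel₀ (mul_ne_zero hV hW)
  τ_eq b := congrArg ((finrank k V * finrank k W : k)⁻¹ * ·) (tensorTrace_unitEquiv b).symm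
  map_B₀ := map_box_B₀ a

end Box

section Tower

variable {k A W : Type u} [Field k] [Ring A] [Algebra k A] [AddCommGroup W] [Module k W]
  (x y : Obj k A)

theorem commute_addRight_onLast {R : Type u} [Ring R] [Algebra k R] (j m : ℕ)
    (T : End k (word x y j m).X) (z : End k (alt x y (nextIndex j m)).X ⊗[k] R) :
    Commute (addRight x y j m T ⊗ₜ[k] (1 : R)) (mapLeft (onLast x y j m) R z) := by
  have h := (Obj.commute_legs_left (word x y j m).X (alt x y (nextIndex j m)).X T
    z).map (Obj.cj (wordSnoc x y j m))
  rw [Obj.map_map_apply, map_tmul, map_one] at h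
  exact h

variable [FiniteDimensional k x.X] [FiniteDimensional k y.X] (D : DualPair k x.X y.X)
  (hxy : finrank k y.X = finrank k x.X) (hx : (finrank k x.X : k) ≠ 0)

/-- The basic construction of `L(X_i) ⊂ L(X_{i+1})`, where `X_i` is the alternating tensor product
with `i` terms. -/
def wordBasic (i : ℕ) :
    BasicData k (word x y 0 i).X (word x y 0 (i + 1)).X (word x y 0 (i + 2)).X where
  inc := addRight x y 0 i
  inc' := addRight x y 0 (i + 1)
  cup := wordCoev x y D 0 i
  cap := wordEv x y D 0 i
  d := finrank k x.X
  d_ne_zero := hx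
  inc'_inc_comp_cup := addRight_addRight_comp_wordCoev x y D 0 i
  trace_inc := trace_addRight rfl hxy 0 i
  trace_inc' := trace_addRight rfl hxy 0 (i + 1)
  trace_cap_comp_cup := trace_wordEv_addRight_wordCoev x y D 0 i
  finrank_mul_self := by
    rw [finrank_word rfl hxy, finrank_word rfl hxy, finrank_word rfl hxy]
    ring

variable [Nontrivial x.X] [Nontrivial y.X] [FiniteDimensional k W] (hW : (finrank k W : k) ≠ 0)
  {a : (End k x.X ⊗[k] End k W)ˣ} {b : (End k y.X ⊗[k] End k W)ˣ}
  (h : Commute (D.cupCap ⊗ₜ[k] 1) (legMul a.1 b.1))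
  (h' : Commute (D.symm.cupCap ⊗ₜ[k] 1) (legMul b.1 a.1))

/-- The stages at the successive basic constructions of the square of algebras of `a`. -/
def towerStage : (i : ℕ) →
    Stage ((box a).tower i) (addRight x y 0 i) (wordU x y a b 0 (i + 1))
  | 0 => boxStage hx hW _ a
  | i + 1 =>
    (towerStage i).next (B := wordBasic x y D hxy hx i) (wordU x y a b 0 (i + 2))
      (mapLeft (onLast x y 0 (i + 1)) (End k W) (altU x y a b (nextIndex 0 (i + 1))).1)
      (coe_wordU_snoc x y a b 0 (i + 1)) (fun T => commute_addRight_onLast x y 0 (i + 1) T _)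
      (commute_wordCoev_comp_wordEv x y D h h' 0 i)

end Tower

/-! ### Relative commutants -/

section Centralizer

variable {k A B E : Type*} [Field k] [Ring A] [Algebra k A] [Ring B] [Algebra k B] [Ring E]
  [Algebra k E] {f : A →ₐ[k] B} {g : E →ₐ[k] B}

theorem range_lift (h : ∀ a e, Commute (f a) (g e)) :
    (Algebra.TensorProduct.lift f g h).range = f.range ⊔ g.range := by
  refine le_antisymm ?_ (sup_le ?_ ?_)
  · rintro _ ⟨z, rfl⟩
    induction z with
    | zero => rw [map_zero]; exact zero_mem _
    | add z w hz hw => rw [map_add]; exact add_mem hz hw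
    | tmul a e =>
      exact mul_mem (le_sup_left (a := f.range) ⟨a, rfl⟩) (le_sup_right (b := g.range) ⟨e, rfl⟩)
  · rintro _ ⟨a, rfl⟩
    exact ⟨a ⊗ₜ 1, by simp⟩
  · rintro _ ⟨e, rfl⟩
    exact ⟨1 ⊗ₜ e, by simp⟩

theorem centralizer_image_of_bijective_lift {h : ∀ a e, Commute (f a) (g e)}
    (hfg : Function.Bijective (Algebra.TensorProduct.lift f g h)) (C : Set A) :
    Subalgebra.centralizer k (f '' C) = (Subalgebra.centralizer k C).map f ⊔ g.range := by
  have hval (a : Subalgebra.centralizer k C) (e : E) :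
      Commute (f.comp (Subalgebra.centralizer k C).val a) (g e) := h a e
  have hC := calc
    (Subalgebra.centralizer k C).map f ⊔ g.range
      = (f.comp (Subalgebra.centralizer k C).val).range ⊔ g.range := by
        rw [Subalgebra.range_comp_val]
    _ = (Algebra.TensorProduct.lift _ g hval).range := (range_lift hval).symm
    _ = ((Algebra.TensorProduct.lift f g h).comp
          (map (Subalgebra.centralizer k C).val (AlgHom.id k E))).range := by
        congr 1
        ext <;> simp
    _ = (Subalgebra.centralizer k (includeLeft (S := k) '' C)).map
          (Algebra.TensorProduct.lift f g h) := by
        rw [AlgHom.range_comp, Subalgebra.centralizer_coe_image_includeLeft_eq_center_tensorProduct]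
  rw [hC]
  ext z
  obtain ⟨w, rfl⟩ := hfg.2 z
  have hc (c : A) : f c = Algebra.TensorProduct.lift f g h (includeLeft (S := k) c) := by simp
  simp only [Subalgebra.mem_map, hfg.1.eq_iff, exists_eq_right, Subalgebra.mem_centralizer_iff,
    Set.forall_mem_image, hc, ← map_mul]

theorem commute_mapLeft_tmul_one (h : ∀ a e, Commute (f a) (g e)) {R : Type*} [Ring R]
    [Algebra k R] (z : A ⊗[k] R) (e : E) : Commute (mapLeft f R z) (g e ⊗ₜ[k] 1) := by
  simpa using commute_map_map (f' := AlgHom.id k R) (g' := Algebra.ofId k R) h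
    (fun r c => (Algebra.commutes c r).symm) z (e ⊗ₜ[k] 1)

theorem bijective_lift_mapLeft (h : ∀ a e, Commute (f a) (g e)) {R : Type*} [Ring R] [Algebra k R]
    (hfg : Function.Bijective (Algebra.TensorProduct.lift f g h)) :
    Function.Bijective (Algebra.TensorProduct.lift (mapLeft f R)
      ((includeLeft : B →ₐ[k] B ⊗[k] R).comp g) (commute_mapLeft_tmul_one h)) := by
  let e := (TensorProduct.rightComm k A R E).trans (TensorProduct.congr
    (LinearEquiv.ofBijective (Algebra.TensorProduct.lift f g h).toLinearMap hfg)
    (LinearEquiv.refl k R))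
  have he : (Algebra.TensorProduct.lift (mapLeft f R) ((includeLeft : B →ₐ[k] B ⊗[k] R).comp g)
      (commute_mapLeft_tmul_one h)).toLinearMap = e.toLinearMap :=
    TensorProduct.ext_threefold fun a r b =>
      (tmul_mul_tmul (f a) (g b) r 1).trans (by rw [mul_one]; rfl)
  exact (congrArg DFunLike.coe he) ▸ e.bijective

end Centralizer

section WordCentralizer

variable {k A : Type u} [Field k] [Ring A] [Algebra k A] (x y : Obj k A)

theorem commute_addRight_onLast_self (j m : ℕ) (S : End k (word x y j m).X)
    (T : End k (alt x y (nextIndex j m)).X) :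
    Commute (addRight x y j m S) (onLast x y j m T) :=
  (commute_rTensorAlgHom_lTensorAlgHom S T).map ((wordSnoc x y j m).conjAlgEquiv k)

theorem range_emb_comp_onLast (j m i : ℕ) (h : j + (m + 1) = i + 1) :
    ((emb x y j (m + 1) (i + 1) h).comp (onLast x y j m)).range = (onLast x y 0 i).range := by
  induction j generalizing m with
  | zero =>
    obtain rfl : m = i := by omega
    rfl
  | succ j ih =>
    refine Eq.trans (congrArg AlgHom.range (AlgHom.ext fun T => ?_)) (ih (m + 1) (by omega))
    exact congrArg (emb x y j (m + 2) (i + 1) _) (addLeft_onLast x y j m T)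

variable [FiniteDimensional k x.X] [FiniteDimensional k y.X]

theorem bijective_lift_addRight_onLast (j m : ℕ) :
    Function.Bijective (Algebra.TensorProduct.lift (addRight x y j m) (onLast x y j m)
      (commute_addRight_onLast_self x y j m)) := by
  let e := (endTensorEnd k (word x y j m).X (alt x y (nextIndex j m)).X).trans
    ((wordSnoc x y j m).conjAlgEquiv k)
  have he : (Algebra.TensorProduct.lift (addRight x y j m) (onLast x y j m)
      (commute_addRight_onLast_self x y j m)).toLinearMap = e.toLinearEquiv.toLinearMap :=
    TensorProduct.ext' fun S T =>
      (map_mul ((wordSnoc x y j m).conjAlgEquiv k) _ _).symm.trans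
        (congrArg ((wordSnoc x y j m).conjAlgEquiv k) (TensorProduct.ext' fun a b => rfl))
  exact (congrArg DFunLike.coe he) ▸ e.bijective

end WordCentralizer

section RelativeCommutants

theorem exists_algEquiv_of_map {k A B C : Type*} [Field k] [Ring A] [Algebra k A] [Ring B]
    [Algebra k B] [Ring C] [Algebra k C] (e : A ≃ₐ[k] B) {f : C →ₐ[k] B}
    (hf : Function.Injective f) {S : Subalgebra k A} {T : Subalgebra k C}
    (h : ∀ a, a ∈ S ↔ e a ∈ T.map f) : ∃ Φ : S ≃ₐ[k] T, ∀ a : S, e a = f (Φ a) := by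
  have hmap : S.map (e : A →ₐ[k] B) = T.map f := by
    ext b
    obtain ⟨a, rfl⟩ := e.surjective b
    simp [← h]
  refine ⟨(e.subalgebraMap S).trans ((Subalgebra.equivOfEq _ _ hmap).trans
    (T.equivMapOfInjective f hf).symm), fun a => ?_⟩
  exact congrArg Subtype.val ((T.equivMapOfInjective f hf).apply_symm_apply
    (Subalgebra.equivOfEq _ _ hmap (e.subalgebraMap S a))).symm

theorem upperIn_self {k : Type u} [Field k] (s : Square k) (i : ℕ) : s.upperIn i i = ⊤ := by
  cases i with
  | zero => rfl
  | succ i => exact if_neg (by omega)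

variable {k A W : Type u} [Field k] [Ring A] [Algebra k A] [AddCommGroup W] [Module k W]
  (x y : Obj k A)

variable (W) in
/-- `T ↦ id ⊗ T ⊗ 1`, from the operators on a word that starts at `j` to `L(X_i) ⊗ L(W)`. -/
def embLeft (j m i : ℕ) (h : j + m = i) :
    End k (word x y j m).X →ₐ[k] End k (word x y 0 i).X ⊗[k] End k W :=
  includeLeft.comp (emb x y j m i h)

theorem embLeft_zero_range (i : ℕ) : (embLeft W x y i 0 i rfl).range = ⊥ := by
  refine le_antisymm ?_ bot_le
  rintro _ ⟨T, rfl⟩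
  obtain ⟨c, rfl⟩ := exists_eq_algebraMap_word_zero x y i T
  exact ⟨c, (AlgHom.commutes _ c).symm⟩

theorem embLeft_comp_addRight (j m i : ℕ) (h : j + m = i) (h' : j + (m + 1) = i + 1) :
    (embLeft W x y j (m + 1) (i + 1) h').comp (addRight x y j m) =
      (mapLeft (addRight x y 0 i) (End k W)).comp (embLeft W x y j m i h) :=
  AlgHom.ext fun T => (congrArg (· ⊗ₜ[k] (1 : End k W)) (emb_addRight x y j m i h h' T)).trans
    (map_tmul (addRight x y 0 i) (AlgHom.id k (End k W)) (emb x y j m i h T) 1).symm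

theorem embLeft_injective [Nontrivial x.X] [Nontrivial y.X] [Nontrivial W] (j m i : ℕ)
    (h : j + m = i) : Function.Injective (embLeft W x y j m i h) :=
  (Algebra.TensorProduct.includeLeft_injective (S := k)
    (algebraMap k (End k W)).injective).comp (emb_injective x y j m i h)

variable {s : Square k}
  {α : ∀ i, s.upper i ≃ₐ[k] End k (word x y 0 i).X ⊗[k] End k W}
  (hα : ∀ i z, α (i + 1) (s.incl i z) = mapLeft (addRight x y 0 i) (End k W) (α i z))

include hα in
theorem image_upperIn_succ (i j : ℕ) (hij : j ≤ i) :
    α (i + 1) '' s.upperIn j (i + 1) =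
      mapLeft (addRight x y 0 i) (End k W) '' (α i '' s.upperIn j i) := by
  rw [show s.upperIn j (i + 1) = (s.upperIn j i).map (s.incl i) from if_pos hij,
    Subalgebra.coe_map, Set.image_image, Set.image_image]
  exact Set.image_congr fun z _ => hα i z

variable [FiniteDimensional k x.X] [FiniteDimensional k y.X]

theorem embLeft_succ_range (j m i : ℕ) (h : j + m = i) (h' : j + (m + 1) = i + 1) :
    (embLeft W x y j (m + 1) (i + 1) h').range =
      (embLeft W x y j m i h).range.map (mapLeft (addRight x y 0 i) (End k W)) ⊔
        (includeLeft.comp (onLast x y 0 i) : _ →ₐ[k] _ ⊗[k] End k W).range := by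
  have htop : (addRight x y j m).range ⊔ (onLast x y j m).range = ⊤ := by
    rw [← range_lift (commute_addRight_onLast_self x y j m), AlgHom.range_eq_top]
    exact (bijective_lift_addRight_onLast x y j m).2
  have hlast : ((embLeft W x y j (m + 1) (i + 1) h').comp (onLast x y j m)).range =
      (includeLeft.comp (onLast x y 0 i) : _ →ₐ[k] _ ⊗[k] End k W).range := by
    rw [embLeft, AlgHom.comp_assoc, AlgHom.range_comp, range_emb_comp_onLast, AlgHom.range_comp]
  rw [← hlast, ← AlgHom.range_comp, ← embLeft_comp_addRight x y j m i h h', AlgHom.range_comp,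
    AlgHom.range_comp (onLast x y j m), ← Algebra.map_sup, htop, Algebra.map_top]

include hα in
theorem centralizer_map_upperIn [FiniteDimensional k W] (j m i : ℕ) (h : j + m = i) :
    Subalgebra.centralizer k (α i '' s.upperIn j i) = (embLeft W x y j m i h).range := by
  induction m generalizing i with
  | zero =>
    obtain rfl : j = i := h
    have : Algebra.IsCentral k (End k (word x y 0 j).X ⊗[k] End k W) :=
      .of_algEquiv k _ _ (endTensorEnd k (word x y 0 j).X W).symm
    rw [upperIn_self, Algebra.coe_top, Set.image_univ, (α j).surjective.range_eq,
      Subalgebra.centralizer_univ, Algebra.IsCentral.center_eq_bot, embLeft_zero_range]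
  | succ m ih =>
    obtain rfl : j + m + 1 = i := h
    rw [image_upperIn_succ x y hα _ j (Nat.le_add_right j m),
      centralizer_image_of_bijective_lift
        (bijective_lift_mapLeft _ (bijective_lift_addRight_onLast x y 0 (j + m))),
      ih (j + m) rfl, ← embLeft_succ_range]

variable [Nontrivial x.X] [Nontrivial y.X] [FiniteDimensional k W]
  {a : (End k x.X ⊗[k] End k W)ˣ} {b : (End k y.X ⊗[k] End k W)ˣ}
  (hlow : ∀ i z T, α i z = T ⊗ₜ[k] 1 → (z ∈ s.lower i ↔ Conjugable (wordU x y a b 0 i) T))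
  (hend : ∀ j m T, T ∈ (word x y j m).endAlg ↔ Conjugable (wordU x y a b j m) T)

include hα hlow hend in
theorem mem_relComm_iff (j m i : ℕ) (h : j + m = i) (z : s.upper i) :
    z ∈ s.relComm i j ↔ α i z ∈ (word x y j m).endAlg.map (embLeft W x y j m i h) := by
  have hcomm : z ∈ Subalgebra.centralizer k (s.upperIn j i : Set (s.upper i)) ↔
      α i z ∈ (embLeft W x y j m i h).range := by
    rw [← centralizer_map_upperIn x y hα j m i h]
    simp [Subalgebra.mem_centralizer_iff, ← map_mul]
  have hlower (T : End k (word x y j m).X) (hT : embLeft W x y j m i h T = α i z) :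
      z ∈ s.lower i ↔ T ∈ (word x y j m).endAlg := by
    exact (hlow i z _ hT.symm).trans
      ((conjugable_emb_iff x y a b j m i h T).trans (hend j m T).symm)
  refine (and_congr_left' hcomm).trans ⟨?_, ?_⟩
  · rintro ⟨⟨T, hT⟩, hz⟩
    exact ⟨T, (hlower T hT).1 hz, hT⟩
  · rintro ⟨T, hT, hTz⟩
    exact ⟨⟨T, hTz⟩, (hlower T hTz).2 hT⟩

include hα hlow hend in
theorem exists_lattice_equiv [Nontrivial W] :
    ∃ Φ : ∀ i j m : ℕ, j + m = i → (s.relComm i j ≃ₐ[k] (word x y j m).endAlg),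
      (∀ (i j m : ℕ) (h : j + m = i) (h' : j + (m + 1) = i + 1) (hij : j ≤ i) (z : s.relComm i j),
        Φ (i + 1) j (m + 1) h' (s.horiz hij z) = Obj.endHoriz x y j m (Φ i j m h z)) ∧
      (∀ (i j m : ℕ) (h : (j + 1) + m = i) (h' : j + (m + 1) = i) (hij : j + 1 ≤ i)
          (z : s.relComm i (j + 1)),
        Φ i j (m + 1) h' (s.vert hij z) = Obj.endVert x y j m (Φ i (j + 1) m h z)) := by
  choose Φ hΦ using fun i j m h => exists_algEquiv_of_map (α i)
    (embLeft_injective x y j m i h) (mem_relComm_iff x y hα hlow hend j m i h)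
  refine ⟨Φ, fun i j m h h' hij z => ?_, fun i j m h h' hij z => ?_⟩
  · refine Subtype.ext (embLeft_injective (W := W) x y j (m + 1) (i + 1) h' ?_)
    calc embLeft W x y j (m + 1) (i + 1) h' (Φ (i + 1) j (m + 1) h' (s.horiz hij z))
        = α (i + 1) (s.incl i z) := (hΦ (i + 1) j (m + 1) h' (s.horiz hij z)).symm
      _ = mapLeft (addRight x y 0 i) (End k W) (embLeft W x y j m i h (Φ i j m h z)) := by
        rw [hα, hΦ i j m h]
      _ = embLeft W x y j (m + 1) (i + 1) h' (addRight x y j m (Φ i j m h z)) :=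
        (AlgHom.congr_fun (embLeft_comp_addRight x y j m i h h') _).symm
  · exact Subtype.ext (embLeft_injective (W := W) x y j (m + 1) i h'
      ((hΦ i j (m + 1) h' (s.vert hij z)).symm.trans (hΦ i (j + 1) m h z)))

end RelativeCommutants

section Lower

theorem Stage.mem_B₀_iff {k X Y W : Type u} [Field k] [AddCommGroup X] [Module k X]
    [AddCommGroup Y] [Module k Y] [AddCommGroup W] [Module k W] {s : Square k}
    {inc : End k X →ₐ[k] End k Y} {U : (End k Y ⊗[k] End k W)ˣ} (S : Stage s inc U) (z : s.B)
    (T : End k Y) (hT : S.αB z = T ⊗ₜ[k] 1) : z ∈ s.B₀ ↔ Conjugable U T := by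
  have hmap : z ∈ s.B₀ ↔ S.αB z ∈ s.B₀.map (S.αB : s.B →ₐ[k] End k Y ⊗[k] End k W) := by
    simp
  rw [hmap, S.map_B₀, hT]
  refine exists_congr fun R => ?_
  change conjLeft U R = _ ↔ _
  rw [conjLeft_apply, Units.mul_inv_eq_iff_eq_mul, mul_assoc,
    ← Units.eq_inv_mul_iff_mul_eq, eq_comm]

variable {k A W : Type u} [Field k] [Ring A] [Algebra k A] [AddCommGroup W] [Module k W]
  [FiniteDimensional k W] (x y : Obj k A) [FiniteDimensional k x.X] [FiniteDimensional k y.X]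
  [Nontrivial x.X] [Nontrivial y.X] (D : DualPair k x.X y.X)
  (hxy : finrank k y.X = finrank k x.X) (hx : (finrank k x.X : k) ≠ 0) (hW : (finrank k W : k) ≠ 0)
  {a : (End k x.X ⊗[k] End k W)ˣ} {b : (End k y.X ⊗[k] End k W)ˣ}
  (h : Commute (D.cupCap ⊗ₜ[k] (1 : End k W)) (legMul a.1 b.1))
  (h' : Commute (D.symm.cupCap ⊗ₜ[k] (1 : End k W)) (legMul b.1 a.1))

theorem mem_lower_iff (i : ℕ) (z : (box a).upper i) (T : End k (word x y 0 i).X)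
    (hT : (towerStage x y D hxy hx hW h h' i).αA z = T ⊗ₜ[k] 1) :
    z ∈ (box a).lower i ↔ Conjugable (wordU x y a b 0 i) T := by
  cases i with
  | zero =>
    obtain ⟨c, rfl⟩ := exists_eq_algebraMap_word_zero x y 0 T
    let S := towerStage x y D hxy hx hW h h' 0
    have hz : z = algebraMap k _ c := S.αA.injective (hT.trans (AlgEquiv.commutes S.αA c).symm)
    refine iff_of_true (hz ▸ (⊥ : Subalgebra k (box a).A).algebraMap_mem c)
      ⟨algebraMap k _ c, ?_⟩
    exact (mul_one _).trans (one_mul _)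
  | succ i => exact (towerStage x y D hxy hx hW h h' i).mem_B₀_iff z T hT

end Lower

end VertexModel

end

open Module (Dual End finrank) in
open VertexModel in
theorem theorem4p1_general {k V W H : Type u} [Field k] [AddCommGroup V] [Module k V]
    [AddCommGroup W] [Module k W] (hV : (finrank k V : k) ≠ 0) (hW : (finrank k W : k) ≠ 0)
    (u : (End k V ⊗[k] End k W)ˣ) (hu : SatisfiesStar u) [Ring H] [HopfAlgebra k H]
    (v : End k V ⊗[k] H) (π : H →ₐ[k] End k (W ⊗[k] Dual k W))
    (hmin : IsMinimalModel (uPrime u) v π) :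
    ∃ Φ : ∀ i j m : ℕ, j + m = i → ((box u).relComm i j ≃ₐ[k] latticeEnd v j m),
      (∀ (i j m : ℕ) (h : j + m = i) (h' : j + (m + 1) = i + 1) (hij : j ≤ i)
          (x : (box u).relComm i j),
        Φ (i + 1) j (m + 1) h' ((box u).horiz hij x) =
          Obj.endHoriz (vObj v) (vHatObj v) j m (Φ i j m h x)) ∧
      (∀ (i j m : ℕ) (h : (j + 1) + m = i) (h' : j + (m + 1) = i) (hij : j + 1 ≤ i)
          (x : (box u).relComm i (j + 1)),
        Φ i j (m + 1) h' ((box u).vert hij x) =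
          Obj.endVert (vObj v) (vHatObj v) j m (Φ i (j + 1) m h x)) := by
  have hV' : 0 < finrank k V := Nat.pos_of_ne_zero fun h => hV (by rw [h, Nat.cast_zero])
  have hW' : 0 < finrank k W := Nat.pos_of_ne_zero fun h => hW (by rw [h, Nat.cast_zero])
  have : FiniteDimensional k V := .of_finrank_pos hV'
  have : FiniteDimensional k W := .of_finrank_pos hW'
  have : Nontrivial V := Module.nontrivial_of_finrank_pos hV'
  have : Nontrivial W := Module.nontrivial_of_finrank_pos hW'
  have : FiniteDimensional k (vObj v).X := inferInstanceAs (FiniteDimensional k V)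
  have : FiniteDimensional k (vHatObj v).X := inferInstanceAs (FiniteDimensional k (Dual k V))
  have : Nontrivial (vObj v).X := inferInstanceAs (Nontrivial V)
  have : Nontrivial (vHatObj v).X := inferInstanceAs (Nontrivial (Dual k V))
  have hd : finrank k (vHatObj v).X = finrank k (vObj v).X := Subspace.dual_finrank_eq (V := V)
  let S := towerStage (vObj v) (vHatObj v) (DualPair.canonical k V) hd hV hW
    (commute_canonical_cupCap u hu) (commute_canonical_symm_cupCap u hu)
  exact exists_lattice_equiv (vObj v) (vHatObj v) (s := box u) (fun i z => (S i).αB_ι z)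
    (mem_lower_iff _ _ _ hd hV hW _ _) (mem_latticeEnd_iff hu hmin)

theorem theorem4p1 {k V W H : Type u} [Field k] [CharZero k]
    [AddCommGroup V] [Module k V] [FiniteDimensional k V] [Nontrivial V]
    [AddCommGroup W] [Module k W] [FiniteDimensional k W] [Nontrivial W]
    (u : (Module.End k V ⊗[k] Module.End k W)ˣ) (hu : VertexModel.SatisfiesStar u)
    [Ring H] [HopfAlgebra k H] (v : Module.End k V ⊗[k] H)
    (π : H →ₐ[k] Module.End k (W ⊗[k] Module.Dual k W))
    (hmin : VertexModel.IsMinimalModel (VertexModel.uPrime u) v π) :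
    ∃ Φ : ∀ i j m : ℕ, j + m = i →
        ((VertexModel.box u).relComm i j ≃ₐ[k] VertexModel.latticeEnd v j m),
      (∀ (i j m : ℕ) (h : j + m = i) (h' : j + (m + 1) = i + 1) (hij : j ≤ i)
          (x : (VertexModel.box u).relComm i j),
        Φ (i + 1) j (m + 1) h' ((VertexModel.box u).horiz hij x) =
          VertexModel.Obj.endHoriz (VertexModel.vObj v) (VertexModel.vHatObj v) j m
            (Φ i j m h x)) ∧
      (∀ (i j m : ℕ) (h : (j + 1) + m = i) (h' : j + (m + 1) = i) (hij : j + 1 ≤ i)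
          (x : (VertexModel.box u).relComm i (j + 1)),
        Φ i j (m + 1) h' ((VertexModel.box u).vert hij x) =
          VertexModel.Obj.endVert (VertexModel.vObj v) (VertexModel.vHatObj v) j m
            (Φ i (j + 1) m h x)) :=
  theorem4p1_general (Nat.cast_ne_zero.2 Module.finrank_pos.ne')
    (Nat.cast_ne_zero.2 Module.finrank_pos.ne') u hu v π hmin
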